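/- For complex numbers $a,b,c,e,f$ write ${}_3F_2(a,b,c;e,f\,|\,1)$ for the sum $\sum_{k\ge 0}\frac{(a)_k(b)_k(c)_k}{(e)_k(f)_k\,k!}$, which converges when $e,f\notin\{0,-1,-2,\dots\}$ and the excess $s=e+f-a-b-c$ has $\operatorname{Re}s>0$, and for its analytic continuation as a holomorphic function of the five parameters to the connected open set $U\subset\mathbb C^5$ on which none of $e,f,s$ is a nonpositive integer (this continuation exists, and is unique because $U$ is connected). Sums use the convention $\sum_{L=p}^{q}g(L)=-\sum_{L=q+1}^{p-1}g(L)$ for $q<p$; thus $\sum_{L=1}^{n-2}g(L)$ is empty for $n=2$ and equals $-g(0)$ for $n=1$. A gamma function in a denominator contributes $1/\Gamma=0$ at its poles. Let $n\ge 1$ be an integer and $a,b\in\mathbb C$. Each of the following identities holds whenever its five parameters lie in $U$, every gamma function in a numerator of its right-hand side (including those in the terms of the finite sum) is finite, and no explicit denominator (sine, cosine or linear factor) vanishes. (B.8) $${}_3F_2\left(a,b,\tfrac a2-b-\tfrac32-n;\ \tfrac a2+b+\tfrac12,\,a-b-1-n\,\middle|\,1\right)=\frac{\pi\,\Gamma(\frac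 a2+b+\frac12)\Gamma(b+n+2)\Gamma(a-b-1-n)}{2\cos(\frac{\pi}{2}(2b-a))\Gamma(-\frac a2+b+\frac12)\Gamma(\frac a2+\frac12)^2\Gamma(2+n+2b)\Gamma(-2b-n+a-1)}$$ $$+\frac{\Gamma(\frac a2+b+\frac12)\Gamma(a-b-1-n)}{2\,\Gamma(-b-n-1)\Gamma(a)\Gamma(-\frac a2+b+\frac12)}\sum_{L=0}^{n+1}\frac{\Gamma(-\frac a2+b+\frac12+L)\Gamma(-b-n-1+L)}{\Gamma(\frac a2-b-\frac12-n+L)\Gamma(b+1+L)}.$$ (B.9) $${}_3F_2\left(a,b,n+\tfrac a2-b-\tfrac32;\ \tfrac a2+b+\tfrac12,\,n+a-b-1\,\middle|\,1\right)=\frac{\Gamma(\frac a2-b+\frac12)\Gamma(\frac a2+b+\frac12)\Gamma(b-n+2)\Gamma(n+a-b-1)}{2\,\Gamma(\frac a2+\frac12)^2\Gamma(n+a-2b-1)\Gamma(-n+2b+2)}$$ $$-\frac{(-1)^n\sin(\pi b)\cos(\pi(\frac a2-b))\,\Gamma(\frac a2-b+\frac12)\Gamma(b-n+2)\Gamma(\frac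 a2+b+\frac12)\Gamma(n+a-b-1)}{2\pi^2\,\Gamma(a)}\sum_{L=1}^{n-2}\frac{\Gamma(\frac32-\frac a2+b-n+L)\Gamma(-b+L)}{\Gamma(\frac12+\frac a2-b+L)\Gamma(2+b-n+L)}.$$ (B.12) $${}_3F_2\left(a,b,\tfrac a2+\tfrac12;\ 1+a,\,\tfrac a2-\tfrac n2-\tfrac12+\tfrac b2\,\middle|\,1\right)=\frac{a\,\Gamma(\frac a2-\frac n2-\frac12+\frac b2)}{2\,\Gamma(-\frac a2-\frac n2-\frac12+\frac b2)}\sum_{L=0}^{n+1}\frac{\Gamma(-\frac a2-\frac n2-\frac12+\frac b2+L)\Gamma(-\frac b2-\frac n2+L)}{\Gamma(\frac a2-\frac n2+\frac12-\frac b2+L)\Gamma(\frac b2-\frac n2+L)}$$ $$-\frac{\sqrt\pi\,2^{a}\,\Gamma(\frac a2-\frac n2-\frac12+\frac b2)\Gamma(\frac a2+\frac n2+\frac32-\frac b2)\Gamma(1+\frac a2)}{2\,\Gamma(b)\Gamma(1+a-b)\Gamma(\frac a2+\frac12)\sin(\frac\pi2(b+n))}.$$ (B.13) $${}_3F_2\left(a,b,1;\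 2b,\,\tfrac a2-\tfrac n2\,\middle|\,1\right)=\frac{(b-\frac12)\Gamma(\frac a2-\frac n2)\Gamma(b-\frac n2-\frac a2-1)}{\Gamma(\frac a2-b-\frac n2)\Gamma(-\frac a2-\frac n2)}\sum_{L=0}^{n+1}\frac{\Gamma(-b-\frac n2+\frac a2+L)\Gamma(-\frac a2-\frac n2+L)}{\Gamma(b-\frac n2-\frac a2+L)\Gamma(\frac a2-\frac n2+L)}$$ $$-\frac{\sqrt\pi\,2^{2b-2}\,\Gamma(\frac a2-\frac n2)\Gamma(b+\frac n2-\frac a2+1)\Gamma(b+\frac12)\Gamma(b-\frac n2-\frac a2-1)}{\Gamma(2b-a)\Gamma(a)\sin(\frac\pi2(a+n))\Gamma(-\frac a2-\frac n2)\Gamma(b)}.$$ (B.14) $${}_3F_2\left(a,\tfrac a2-\tfrac n2-1,b;\ a-b-1-n,\,\tfrac a2-\tfrac n2\,\middle|\,1\right)=\frac{\Gamma(\frac a2+\frac n2+1)\Gamma(a-b-1-n)}{\Gamma(b)}\Bigg(\frac{\pi^{3/2}(-1)^n\,\Gamma(1-a)}{\sin(\pi b)\,2^{a-n}\,\Gamma(\frac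 a2-b-\frac n2)^2\Gamma(\frac12+\frac a2-\frac n2)\Gamma(n+1-a)}$$ $$-\frac{\sin(\frac\pi2(a+n))\Gamma(\frac a2-\frac n2)\Gamma(-n-2b)}{2\pi\,\Gamma(-2b-n+a-1)}\sum_{L=0}^{n+1}\frac{\Gamma(b+L)\Gamma(-\frac a2-\frac n2+L)}{\Gamma(-b-n+L)\Gamma(\frac a2-\frac n2+L)}\Bigg).$$ (B.15) $${}_3F_2\left(a,b,-b-n-1;\ -b-n-2+2a,\,b+1\,\middle|\,1\right)=\frac{\Gamma(a)\Gamma(b+1)\Gamma(-b-n-2+2a)}{2\,\Gamma(2a-1)\Gamma(-b-n-1)\Gamma(b-a+1)}\sum_{L=0}^{n+1}\frac{\Gamma(-b-n-1+L)\Gamma(b-a+1+L)}{\Gamma(b+1+L)\Gamma(a-b-1-n+L)}$$ $$+\frac{2^{2n-1}\sqrt\pi\,\Gamma(-1-n-2b)\Gamma(3+n-2a+2b)\Gamma(b+n+2)\Gamma(a-b)\Gamma(a-\frac12)\Gamma(-b-n-2+2a)}{\Gamma(3+2n-2a+2b)\Gamma(\frac32+b)\Gamma(-\frac12+a-b-n)\Gamma(2a-1)\Gamma(a-b-1-n)\Gamma(-1-2b)}.$$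 (B.16) $${}_3F_2\left(a,b,n-b-1;\ n-b-2+2a,\,b+1\,\middle|\,1\right)=-\frac{\pi\,\Gamma(a-b)\Gamma(n-b-2+2a)\Gamma(b-n+2)}{2\sin(\pi b)\Gamma(-b)\Gamma(n+2a-2b-2)\Gamma(a)\Gamma(-n+2b+2)}$$ $$-\frac{\Gamma(b-n+2)\Gamma(a-b)\Gamma(a)\Gamma(n-b-2+2a)}{2\,\Gamma(2+b-a-n)\Gamma(n+a-b-1)\Gamma(-b)\Gamma(2a-1)}\sum_{L=1}^{n-2}\frac{\Gamma(-b+L)\Gamma(-a+b+2+L-n)}{\Gamma(2+b-n+L)\Gamma(-b+a+L)}.$$ (B.18) $${}_3F_2\left(a,b,\tfrac a2+\tfrac12;\ 1+a,\,\tfrac n2+\tfrac a2-\tfrac12+\tfrac b2\,\middle|\,1\right)=\frac{1}{\sin(\frac\pi2(n-b))}\Bigg(\frac{2^{a-1}\sqrt\pi\,\Gamma(1+\frac a2)\Gamma(\frac n2+\frac a2-\frac12+\frac b2)\Gamma(\frac32+\frac a2-\frac n2-\frac b2)}{\Gamma(1+a-b)\Gamma(\frac a2+\frac12)\Gamma(b)}$$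 $$-\frac{a}{2\pi}\cos(\tfrac\pi2(b-a-n))\sin(\tfrac\pi2(b+n))\,\Gamma(\tfrac32+\tfrac a2-\tfrac n2-\tfrac b2)\Gamma(\tfrac n2+\tfrac a2-\tfrac12+\tfrac b2)\sum_{L=1}^{n-2}\frac{\Gamma(-\frac a2-\frac n2+\frac12+\frac b2+L)\Gamma(-\frac b2-\frac n2+1+L)}{\Gamma(\frac32+\frac a2-\frac n2-\frac b2+L)\Gamma(1+\frac b2-\frac n2+L)}\Bigg).$$ (B.19) $${}_3F_2\left(a,b,1;\ 2b,\,\tfrac a2+\tfrac n2\,\middle|\,1\right)=\frac{(b-\frac12)\Gamma(1+b-\frac n2-\frac a2)\Gamma(\frac a2-\frac n2+1)}{\Gamma(-b-\frac n2+\frac a2+2)\Gamma(-\frac n2-\frac a2+1)}\sum_{L=1}^{n-2}\frac{\Gamma(1-b-\frac n2+\frac a2+L)\Gamma(-\frac a2-\frac n2+1+L)}{\Gamma(1+b-\frac n2-\frac a2+L)\Gamma(1+\frac a2-\frac n2+L)}$$ $$+\frac{\sqrt\pi\,\Gamma(n-a+2b)\Gamma(a+n)\Gamma(b+\frac12)\Gamma(1+b-\frac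 n2-\frac a2)\Gamma(\frac a2-\frac n2+1)}{2^{2n}\,\Gamma(a)\Gamma(b)\Gamma(b+\frac n2+\frac12-\frac a2)\Gamma(\frac a2+\frac n2+\frac12)(\frac n2+b-\frac a2-1)\Gamma(2b-a)}.$$ (B.20) $${}_3F_2\left(a,\tfrac n2+\tfrac a2-1,b;\ n+a-b-1,\,\tfrac a2+\tfrac n2\,\middle|\,1\right)=\frac{2^{-2-2b}\,\Gamma(a+n)\Gamma(\frac n2+\frac a2-b-\frac12)\Gamma(1-b)\Gamma(\frac a2-\frac n2+1)\Gamma(n+a-b-1)}{\Gamma(a)\Gamma(\frac n2+\frac a2-b)\Gamma(\frac a2+\frac n2+\frac12)\Gamma(n+a-2b-1)}$$ $$-\frac{\Gamma(1-b)\Gamma(\frac a2-\frac n2+1)\Gamma(n-2b)\Gamma(n+a-b-1)}{2\,\Gamma(-n+b+1)\Gamma(-\frac n2-\frac a2+1)\Gamma(n+a-2b-1)\Gamma(n-b)}\sum_{L=1}^{n-2}\frac{\Gamma(b+1+L-n)\Gamma(-\frac a2-\frac n2+1+L)}{\Gamma(1-b+L)\Gamma(1+\frac a2-\frac n2+L)}.$$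 -/

import Mathlib

namespace Hyp32

open Complex (Gamma sin cos)
open scoped Real

/-- `z` is not a pole of the gamma function, i.e. `z ∉ {0, -1, -2, …}`. -/
def NonPole (z : ℂ) : Prop := ∀ k : ℕ, z ≠ -(k : ℂ)

/-- The parameters `(a, b, c, e, f)`: three upper ones, then two lower ones. -/
abbrev Params : Type := ℂ × ℂ × ℂ × ℂ × ℂ

/-- The parametric excess `e + f - a - b - c`. -/
def excess : Params → ℂ
  | (a, b, c, e, f) => e + f - a - b - c

/-- The `k`-th term `(a)_k (b)_k (c)_k / ((e)_k (f)_k k!)` of the series `₃F₂(a, b, c; e, f | 1)`. -/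
noncomputable def term : Params → ℕ → ℂ
  | (a, b, c, e, f), k =>
    (ascPochhammer ℂ k).eval a * (ascPochhammer ℂ k).eval b * (ascPochhammer ℂ k).eval c /
      ((ascPochhammer ℂ k).eval e * (ascPochhammer ℂ k).eval f * (k.factorial : ℂ))

/-- The domain of `₃F₂(a, b, c; e, f | 1)` as an analytic function of its five parameters:
neither a lower parameter nor the excess is a nonpositive integer.  It is open, dense and connected
(the complement of a locally finite family of complex hyperplanes). -/
def domain : Set Params :=
  {p | NonPole p.2.2.2.1 ∧ NonPole p.2.2.2.2 ∧ NonPole (excess p)}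

/-- `F` is the function `₃F₂(a, b, c; e, f | 1)` of the five parameters: it is holomorphic on
`domain`, and it is the sum of the hypergeometric series wherever the real part of the excess is
positive.  As `domain` is connected, these two properties determine `F` on `domain`. -/
structure IsHypergeometric (F : Params → ℂ) : Prop where
  holomorphic : DifferentiableOn ℂ F domain
  hasSum : ∀ p ∈ domain, 0 < (excess p).re → HasSum (term p) (F p)

/-- The indices occurring in the sum `∑_{L=1}^{n-2}`: those between `1` and `n - 2`, and for
`n = 1` (where the upper limit is `-1`) the index `0`. -/
noncomputable def idx (n : ℕ) : Finset ℤ := Finset.Icc 1 ((n : ℤ) - 2) ∪ Finset.Icc ((n : ℤ) - 1) 0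

/-- The sum `∑_{L=1}^{n-2} g L`, with the convention `∑_{L=p}^{q} = -∑_{L=q+1}^{p-1}` for
`q < p`: it is empty for `n = 2` and equals `-g 0` for `n = 1`. -/
noncomputable def osum (n : ℕ) (g : ℤ → ℂ) : ℂ :=
  ∑ L ∈ Finset.Icc 1 ((n : ℤ) - 2), g L - ∑ L ∈ Finset.Icc ((n : ℤ) - 1) 0, g L

/-! For each family: the parameters, the closed form, and the condition that every gamma function
in a numerator of the closed form is finite and no explicit denominator vanishes.  (A gamma
function with a pole in a denominator contributes the factor `1/Γ = 0`, which is also what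
`Complex.Gamma` and division in `ℂ` give.) -/

/-! ### Family 1 -/

noncomputable def params1 (n : ℕ) (a b : ℂ) : Params :=
  (a, b, a/2 - b - 3/2 - n, a/2 + b + 1/2, a - b - 1 - n)

def Regular1 (n : ℕ) (a b : ℂ) : Prop :=
  NonPole (a/2 + b + 1/2) ∧ NonPole (b + n + 2) ∧ NonPole (a - b - 1 - n) ∧
  cos (π/2 * (2*b - a)) ≠ 0 ∧
  ∀ L ∈ Finset.range (n + 2), NonPole (-a/2 + b + 1/2 + L) ∧ NonPole (-b - n - 1 + L)

noncomputable def value1 (n : ℕ) (a b : ℂ) : ℂ :=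
  1/2 * (Gamma (a/2 + b + 1/2) * Gamma (b + n + 2) * Gamma (a - b - 1 - n) * π) /
    (cos (π/2 * (2*b - a)) * Gamma (-a/2 + b + 1/2) * Gamma (a/2 + 1/2) ^ 2 *
      Gamma (2 + n + 2*b) * Gamma (-2*b - n + a - 1))
  + 1/2 * ((∑ L ∈ Finset.range (n + 2),
      Gamma (-a/2 + b + 1/2 + L) * Gamma (-b - n - 1 + L) /
        (Gamma (a/2 - b - 1/2 - n + L) * Gamma (b + 1 + L))) *
      Gamma (a/2 + b + 1/2) * Gamma (a - b - 1 - n)) /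
    (Gamma (-b - n - 1) * Gamma a * Gamma (-a/2 + b + 1/2))

/-! ### Family 2 -/

noncomputable def params2 (n : ℕ) (a b : ℂ) : Params :=
  (a, b, n + a/2 - b - 3/2, a/2 + b + 1/2, n + a - b - 1)

def Regular2 (n : ℕ) (a b : ℂ) : Prop :=
  NonPole (a/2 - b + 1/2) ∧ NonPole (b - n + 2) ∧ NonPole (a/2 + b + 1/2) ∧
  NonPole (n + a - b - 1) ∧
  ∀ L ∈ idx n, NonPole (3/2 - a/2 + b - n + L) ∧ NonPole (-b + L)

noncomputable def value2 (n : ℕ) (a b : ℂ) : ℂ :=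
  -(1/2) * Gamma (a/2 - b + 1/2) * Gamma (b - n + 2) *
    (osum n fun L => Gamma (3/2 - a/2 + b - n + L) * Gamma (-b + L) /
      (Gamma (1/2 + a/2 - b + L) * Gamma (2 + b - n + L))) *
    Gamma (a/2 + b + 1/2) * Gamma (n + a - b - 1) * sin (π * b) * (-1) ^ n *
    cos (π * (a/2 - b)) / (Gamma a * π ^ 2)
  + 1/2 * (Gamma (a/2 - b + 1/2) * Gamma (a/2 + b + 1/2) * Gamma (b - n + 2) *
      Gamma (n + a - b - 1)) /
    (Gamma (a/2 + 1/2) ^ 2 * Gamma (n + a - 2*b - 1) * Gamma (-n + 2*b + 2))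

/-! ### Family 3 -/

noncomputable def params3 (n : ℕ) (a b : ℂ) : Params :=
  (a, b, a/2 + 1/2, 1 + a, a/2 - n/2 - 1/2 + b/2)

def Regular3 (n : ℕ) (a b : ℂ) : Prop :=
  NonPole (a/2 - n/2 - 1/2 + b/2) ∧ NonPole (a/2 + n/2 + 3/2 - b/2) ∧ NonPole (1 + a/2) ∧
  sin (π/2 * (b + n)) ≠ 0 ∧
  ∀ L ∈ Finset.range (n + 2),
    NonPole (-a/2 - n/2 - 1/2 + b/2 + L) ∧ NonPole (-b/2 - n/2 + L)

noncomputable def value3 (n : ℕ) (a b : ℂ) : ℂ :=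
  1/2 * (Gamma (a/2 - n/2 - 1/2 + b/2) * a * (∑ L ∈ Finset.range (n + 2),
      Gamma (-a/2 - n/2 - 1/2 + b/2 + L) * Gamma (-b/2 - n/2 + L) /
        (Gamma (a/2 - n/2 + 1/2 - b/2 + L) * Gamma (b/2 - n/2 + L)))) /
    Gamma (-a/2 - n/2 - 1/2 + b/2)
  - 1/2 * (Gamma (a/2 - n/2 - 1/2 + b/2) * Gamma (a/2 + n/2 + 3/2 - b/2) * (√π : ℝ) *
      2 ^ a * Gamma (1 + a/2)) /
    (Gamma b * Gamma (1 + a - b) * Gamma (a/2 + 1/2) * sin (π/2 * (b + n)))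

/-! ### Family 4 -/

noncomputable def params4 (n : ℕ) (a b : ℂ) : Params :=
  (a, b, 1, 2*b, a/2 - n/2)

def Regular4 (n : ℕ) (a b : ℂ) : Prop :=
  NonPole (a/2 - n/2) ∧ NonPole (b - n/2 - a/2 - 1) ∧ NonPole (b + n/2 - a/2 + 1) ∧
  NonPole (b + 1/2) ∧ sin (π/2 * (a + n)) ≠ 0 ∧
  ∀ L ∈ Finset.range (n + 2), NonPole (-b - n/2 + a/2 + L) ∧ NonPole (-a/2 - n/2 + L)

noncomputable def value4 (n : ℕ) (a b : ℂ) : ℂ :=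
  Gamma (a/2 - n/2) * (b - 1/2) * Gamma (b - n/2 - a/2 - 1) *
    (∑ L ∈ Finset.range (n + 2),
      Gamma (-b - n/2 + a/2 + L) * Gamma (-a/2 - n/2 + L) /
        (Gamma (b - n/2 - a/2 + L) * Gamma (a/2 - n/2 + L))) /
    (Gamma (a/2 - b - n/2) * Gamma (-a/2 - n/2))
  - (√π : ℝ) * 2 ^ (2*b - 2) * Gamma (a/2 - n/2) * Gamma (b + n/2 - a/2 + 1) *
      Gamma (b + 1/2) * Gamma (b - n/2 - a/2 - 1) /
    (Gamma (2*b - a) * Gamma a * sin (π/2 * (a + n)) * Gamma (-a/2 - n/2) * Gamma b)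

/-! ### Family 5 -/

noncomputable def params5 (n : ℕ) (a b : ℂ) : Params :=
  (a, a/2 - n/2 - 1, b, a - b - 1 - n, a/2 - n/2)

def Regular5 (n : ℕ) (a b : ℂ) : Prop :=
  NonPole (a/2 - n/2) ∧ NonPole (-n - 2*b) ∧ NonPole (-a + 1) ∧ NonPole (a/2 + n/2 + 1) ∧
  NonPole (a - b - 1 - n) ∧ sin (π * b) ≠ 0 ∧
  ∀ L ∈ Finset.range (n + 2), NonPole (b + L) ∧ NonPole (-a/2 - n/2 + L)

noncomputable def value5 (n : ℕ) (a b : ℂ) : ℂ :=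
  (-(1/2) * ((∑ L ∈ Finset.range (n + 2),
        Gamma (b + L) * Gamma (-a/2 - n/2 + L) /
          (Gamma (-b - n + L) * Gamma (a/2 - n/2 + L))) *
        sin (π/2 * (a + n)) * Gamma (a/2 - n/2) * Gamma (-n - 2*b)) /
      (π * Gamma (-2*b - n + a - 1))
    + (π : ℂ) ^ (3/2 : ℂ) * (-1) ^ n * Gamma (-a + 1) /
      (sin (π * b) * 2 ^ (a - n) * Gamma (a/2 - b - n/2) ^ 2 * Gamma (1/2 + a/2 - n/2) *
        Gamma (n + 1 - a))) *
    Gamma (a/2 + n/2 + 1) * Gamma (a - b - 1 - n) / Gamma b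

/-! ### Family 6 -/

noncomputable def params6 (n : ℕ) (a b : ℂ) : Params :=
  (a, b, -b - n - 1, -b - n - 2 + 2*a, b + 1)

def Regular6 (n : ℕ) (a b : ℂ) : Prop :=
  NonPole a ∧ NonPole (b + 1) ∧ NonPole (-b - n - 2 + 2*a) ∧ NonPole (-1 - n - 2*b) ∧
  NonPole (3 + n - 2*a + 2*b) ∧ NonPole (b + n + 2) ∧ NonPole (a - b) ∧ NonPole (a - 1/2) ∧
  ∀ L ∈ Finset.range (n + 2), NonPole (-b - n - 1 + L) ∧ NonPole (b - a + 1 + L)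

noncomputable def value6 (n : ℕ) (a b : ℂ) : ℂ :=
  1/2 * (∑ L ∈ Finset.range (n + 2),
      Gamma (-b - n - 1 + L) * Gamma (b - a + 1 + L) /
        (Gamma (b + 1 + L) * Gamma (a - b - 1 - n + L))) *
    Gamma a * Gamma (b + 1) * Gamma (-b - n - 2 + 2*a) /
    (Gamma (2*a - 1) * Gamma (-b - n - 1) * Gamma (b - a + 1))
  + 2 ^ (2*(n : ℂ) - 1) * (√π : ℝ) * Gamma (-1 - n - 2*b) * Gamma (3 + n - 2*a + 2*b) *
      Gamma (b + n + 2) * Gamma (a - b) * Gamma (a - 1/2) * Gamma (-b - n - 2 + 2*a) /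
    (Gamma (3 + 2*n - 2*a + 2*b) * Gamma (3/2 + b) * Gamma (-1/2 + a - b - n) *
      Gamma (2*a - 1) * Gamma (a - b - 1 - n) * Gamma (-1 - 2*b))

/-! ### Family 7 -/

noncomputable def params7 (n : ℕ) (a b : ℂ) : Params :=
  (a, b, n - b - 1, n - b - 2 + 2*a, b + 1)

def Regular7 (n : ℕ) (a b : ℂ) : Prop :=
  NonPole (b - n + 2) ∧ NonPole (a - b) ∧ NonPole a ∧ NonPole (n - b - 2 + 2*a) ∧
  sin (π * b) ≠ 0 ∧
  ∀ L ∈ idx n, NonPole (-b + L) ∧ NonPole (-a + b + 2 + L - n)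

noncomputable def value7 (n : ℕ) (a b : ℂ) : ℂ :=
  -(1/2) * (Gamma (b - n + 2) * Gamma (a - b)) /
    (Gamma (2 + b - a - n) * Gamma (n + a - b - 1) * Gamma (-b) * Gamma (2*a - 1)) *
    (osum n fun L => Gamma (-b + L) * Gamma (-a + b + 2 + L - n) /
      (Gamma (2 + b - n + L) * Gamma (-b + a + L))) *
    Gamma a * Gamma (n - b - 2 + 2*a)
  - 1/2 * (π * Gamma (a - b) * Gamma (n - b - 2 + 2*a) * Gamma (b - n + 2)) /
    (sin (π * b) * Gamma (-b) * Gamma (n + 2*a - 2*b - 2) * Gamma a * Gamma (-n + 2*b + 2))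

/-! ### Family 8 -/

noncomputable def params8 (n : ℕ) (a b : ℂ) : Params :=
  (a, b, a/2 + 1/2, 1 + a, n/2 + a/2 - 1/2 + b/2)

def Regular8 (n : ℕ) (a b : ℂ) : Prop :=
  NonPole (3/2 + a/2 - n/2 - b/2) ∧ NonPole (n/2 + a/2 - 1/2 + b/2) ∧ NonPole (1 + a/2) ∧
  sin (π/2 * (-b + n)) ≠ 0 ∧
  ∀ L ∈ idx n, NonPole (-a/2 - n/2 + 1/2 + b/2 + L) ∧ NonPole (-b/2 - n/2 + 1 + L)

noncomputable def value8 (n : ℕ) (a b : ℂ) : ℂ :=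
  (-(1/2) * cos (π/2 * (b - a - n)) * Gamma (3/2 + a/2 - n/2 - b/2) * a *
      Gamma (n/2 + a/2 - 1/2 + b/2) * sin (π/2 * (b + n)) *
      (osum n fun L => Gamma (-a/2 - n/2 + 1/2 + b/2 + L) * Gamma (-b/2 - n/2 + 1 + L) /
        (Gamma (3/2 + a/2 - n/2 - b/2 + L) * Gamma (1 + b/2 - n/2 + L))) / π
    + 2 ^ (a - 1) * (√π : ℝ) * Gamma (1 + a/2) * Gamma (n/2 + a/2 - 1/2 + b/2) *
        Gamma (3/2 + a/2 - n/2 - b/2) /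
      (Gamma (1 + a - b) * Gamma (a/2 + 1/2) * Gamma b)) /
    sin (π/2 * (-b + n))

/-! ### Family 9 -/

noncomputable def params9 (n : ℕ) (a b : ℂ) : Params :=
  (a, b, 1, 2*b, a/2 + n/2)

def Regular9 (n : ℕ) (a b : ℂ) : Prop :=
  NonPole (1 + b - n/2 - a/2) ∧ NonPole (a/2 - n/2 + 1) ∧ NonPole (n - a + 2*b) ∧
  NonPole (a + n) ∧ NonPole (b + 1/2) ∧ n/2 + b - a/2 - 1 ≠ 0 ∧
  ∀ L ∈ idx n, NonPole (1 - b - n/2 + a/2 + L) ∧ NonPole (-a/2 - n/2 + 1 + L)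

noncomputable def value9 (n : ℕ) (a b : ℂ) : ℂ :=
  Gamma (1 + b - n/2 - a/2) * Gamma (a/2 - n/2 + 1) *
    (osum n fun L => Gamma (1 - b - n/2 + a/2 + L) * Gamma (-a/2 - n/2 + 1 + L) /
      (Gamma (1 + b - n/2 - a/2 + L) * Gamma (1 + a/2 - n/2 + L))) * (b - 1/2) /
    (Gamma (-b - n/2 + a/2 + 2) * Gamma (-n/2 - a/2 + 1))
  + (√π : ℝ) * Gamma (n - a + 2*b) * Gamma (a + n) * Gamma (b + 1/2) *
      Gamma (1 + b - n/2 - a/2) * Gamma (a/2 - n/2 + 1) /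
    (Gamma a * Gamma b * 2 ^ (2*n) * Gamma (b + n/2 + 1/2 - a/2) *
      Gamma (a/2 + n/2 + 1/2) * (n/2 + b - a/2 - 1) * Gamma (2*b - a))

/-! ### Family 10 -/

noncomputable def params10 (n : ℕ) (a b : ℂ) : Params :=
  (a, n/2 + a/2 - 1, b, n + a - b - 1, a/2 + n/2)

def Regular10 (n : ℕ) (a b : ℂ) : Prop :=
  NonPole (a + n) ∧ NonPole (n/2 + a/2 - b - 1/2) ∧ NonPole (-b + 1) ∧
  NonPole (a/2 - n/2 + 1) ∧ NonPole (n + a - b - 1) ∧ NonPole (n - 2*b) ∧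
  ∀ L ∈ idx n, NonPole (b + 1 + L - n) ∧ NonPole (-a/2 - n/2 + 1 + L)

noncomputable def value10 (n : ℕ) (a b : ℂ) : ℂ :=
  2 ^ (-2 - 2*b) * Gamma (a + n) * Gamma (n/2 + a/2 - b - 1/2) * Gamma (-b + 1) *
      Gamma (a/2 - n/2 + 1) * Gamma (n + a - b - 1) /
    (Gamma a * Gamma (n/2 + a/2 - b) * Gamma (a/2 + n/2 + 1/2) * Gamma (n + a - 2*b - 1))
  - 1/2 * Gamma (-b + 1) * Gamma (a/2 - n/2 + 1) *
    (osum n fun L => Gamma (b + 1 + L - n) * Gamma (-a/2 - n/2 + 1 + L) /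
      (Gamma (1 - b + L) * Gamma (1 + a/2 - n/2 + L))) *
    Gamma (n - 2*b) * Gamma (n + a - b - 1) /
    (Gamma (-n + b + 1) * Gamma (-n/2 - a/2 + 1) * Gamma (n + a - 2*b - 1) * Gamma (-b + n))

end Hyp32

/-! All ten families are images of one basic family, (2y − m, y, B; 2y + 1 − B, y + 1) with m an
integer. At m = 0 it is well-poised and Dixon's theorem sums it. Because (y)_k / (y+1)_k = y /
(y+k), writing A + k = (y + k) + (A − y) expresses A·F(A+1) as a Gauss sum plus (A − y)·F(A). For A
= 2y − m this is a first-order inhomogeneous recurrence in m, valid in both directions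
(`IsHypergeometric.base_rec`).

The recurrence is solved explicitly. The homogeneous equation is solved by a gamma quotient `baseH`.
A particular solution is a gamma quotient `baseCoeff` times the oriented self-convolution of z_L =
Γ(L − y) / Γ(1 − B + L). Since z itself satisfies a first-order recurrence, so does its
self-convolution, with boundary term 2y·z_0·z_m (`ozsum_convolution`), and that boundary term
reproduces the Gauss sum. The reflection formula then turns z_L z_{m+1−L} into the four-gamma
summand of the stated sums (`baseVal_eq`). Oriented sums give one formula for all m: m = −n − 2
yields the five families with n + 2 summands, m = n − 2 the other five. One Thomae–Kummer
transformation, or none, carries the basic family to each of the ten, and what remains are gamma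
identities: recurrence, reflection and duplication.

The classical ingredients are proved along the way. Gauss's and Dixon's theorems follow one pattern:
a telescoping contiguous relation makes the sum solve a first-order recurrence, and a dominated
limit fixes the constant. Thomae's relation comes from Euler's transformation at the level of
coefficients, an exchange of summations, and Gauss's theorem.

The function of five parameters is built by a contiguous relation that expresses the value at excess
s through values at excess s + 1 and s + 2. Identities between series are continued one parameter at
a time by the identity theorem on open sets with countable complement. The closed forms are first
proved when 1, a, b are linearly independent over ℚ, where no gamma argument in use meets a pole;
they extend to all regular parameters by density and continuity, 1/Γ being entire. -/

namespace Hyp32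

open Filter Topology

/-! ### Rising factorials and the poles of the gamma function -/

/-- The rising factorial `(a)_k`. -/
noncomputable abbrev poch (a : ℂ) (k : ℕ) : ℂ := (ascPochhammer ℂ k).eval a

lemma poch_zero (a : ℂ) : poch a 0 = 1 := by simp [poch]

lemma poch_succ (a : ℂ) (k : ℕ) : poch a (k + 1) = poch a k * (a + k) :=
  ascPochhammer_succ_eval k a

lemma poch_succ_left (a : ℂ) (k : ℕ) : poch a (k + 1) = a * poch (a + 1) k := by
  simp [poch, ascPochhammer_succ_left]

lemma poch_mul_add (a : ℂ) (k : ℕ) : poch a k * (a + k) = a * poch (a + 1) k := by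
  rw [← poch_succ, poch_succ_left]

lemma poch_one (k : ℕ) : poch 1 k = k.factorial := by
  simp [poch]

lemma poch_add (a : ℂ) (j i : ℕ) : poch a (j + i) = poch a j * poch (a + j) i := by
  induction i with
  | zero => simp [poch_zero]
  | succ i ih =>
    rw [← add_assoc, poch_succ, poch_succ, ih]; push_cast; ring

lemma differentiable_poch (k : ℕ) : Differentiable ℂ fun a => poch a k :=
  (ascPochhammer ℂ k).differentiable

lemma NonPole.add_natCast {z : ℂ} (h : NonPole z) (n : ℕ) : NonPole (z + n) := fun k hk =>
  h (k + n) (by push_cast; linear_combination hk)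

lemma NonPole.add_one {z : ℂ} (h : NonPole z) : NonPole (z + 1) := by
  simpa using h.add_natCast 1

lemma NonPole.add_natCast_ne {z : ℂ} (h : NonPole z) (n : ℕ) : z + n ≠ 0 := fun hk =>
  h n (by linear_combination hk)

lemma NonPole.ne_zero {z : ℂ} (h : NonPole z) : z ≠ 0 := by
  simpa using h.add_natCast_ne 0

lemma nonPole_of_re_pos {z : ℂ} (h : 0 < z.re) : NonPole z := by
  intro k hk
  rw [hk] at h
  simp only [Complex.neg_re, Complex.natCast_re] at h
  have : (0 : ℝ) ≤ k := k.cast_nonneg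
  linarith

lemma NonPole.poch_ne_zero {z : ℂ} (h : NonPole z) (k : ℕ) : poch z k ≠ 0 := by
  induction k with
  | zero => simp
  | succ k ih => rw [poch_succ]; exact mul_ne_zero ih (h.add_natCast_ne k)

lemma nonPole_iff {z : ℂ} : NonPole z ↔ Complex.Gamma z ≠ 0 := by
  simp [NonPole, Complex.Gamma_eq_zero_iff]

lemma isOpen_nonPole : IsOpen {z : ℂ | NonPole z} := by
  have h : {z : ℂ | NonPole z} = {z : ℂ | (Complex.Gamma z)⁻¹ ≠ 0} := by
    ext z; simp [nonPole_iff]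
  rw [h]
  exact isOpen_ne_fun Complex.differentiable_one_div_Gamma.continuous continuous_const

/-! ### The terms of the series -/

lemma term_succ (a b c e f : ℂ) (k : ℕ) :
    term (a, b, c, e, f) (k + 1) = term (a, b, c, e, f) k *
      ((a + k) * (b + k) * (c + k) / ((e + k) * (f + k) * (k + 1))) := by
  simp only [term, ascPochhammer_succ_eval, Nat.factorial_succ]
  push_cast
  rw [div_mul_div_comm]
  congr 1 <;> ring

lemma term_zero (p : Params) : term p 0 = 1 := by
  obtain ⟨a, b, c, e, f⟩ := p
  simp [term]

lemma differentiableAt_term {p : Params} (he : NonPole p.2.2.2.1) (hf : NonPole p.2.2.2.2)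
    (k : ℕ) : DifferentiableAt ℂ (fun p => term p k) p := by
  have h : (fun p : Params => term p k) = fun p => poch p.1 k * poch p.2.1 k * poch p.2.2.1 k /
      (poch p.2.2.2.1 k * poch p.2.2.2.2 k * (k.factorial : ℂ)) := rfl
  have d : ∀ g : Params → ℂ, Differentiable ℂ g → DifferentiableAt ℂ (fun p => poch (g p) k) p :=
    fun g hg => ((differentiable_poch k).comp hg).differentiableAt
  have hne : poch p.2.2.2.1 k * poch p.2.2.2.2 k * (k.factorial : ℂ) ≠ 0 :=
    mul_ne_zero (mul_ne_zero (he.poch_ne_zero k) (hf.poch_ne_zero k))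
      (Nat.cast_ne_zero.2 k.factorial_ne_zero)
  rw [h]
  have h1 := ((d (fun p => p.1) (by fun_prop)).fun_mul (d (fun p => p.2.1) (by fun_prop))).fun_mul
    (d (fun p => p.2.2.1) (by fun_prop))
  have h2 := ((d (fun p => p.2.2.2.1) (by fun_prop)).fun_mul
    (d (fun p => p.2.2.2.2) (by fun_prop))).mul_const (k.factorial : ℂ)
  simp only [div_eq_mul_inv]
  exact h1.fun_mul (h2.fun_inv hne)

/-! ### Locally uniform decay of the terms -/

/-- A cubic with positive leading coefficient is eventually nonnegative. -/
lemma eventually_cubic_nonneg {d : ℝ} (hd : 0 < d) (u v w : ℝ) :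
    ∀ᶠ k : ℕ in atTop, 0 ≤ d * (k : ℝ) ^ 3 + u * (k : ℝ) ^ 2 + v * k + w := by
  filter_upwards [tendsto_natCast_atTop_atTop.eventually_ge_atTop
    (max 1 ((|u| + |v| + |w|) / d))] with k hk
  have h1 : (1 : ℝ) ≤ k := (le_max_left _ _).trans hk
  have h2 : |u| + |v| + |w| ≤ d * k := by
    have := (le_max_right _ _).trans hk
    rw [div_le_iff₀ hd] at this
    linarith
  have hk2 : (1 : ℝ) ≤ (k : ℝ) ^ 2 := one_le_pow₀ h1
  have h3 : (k : ℝ) ≤ (k : ℝ) ^ 2 := by nlinarith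
  have h4 : (|u| + |v| + |w|) * (k : ℝ) ^ 2 ≤ d * (k : ℝ) ^ 3 := by
    have := mul_le_mul_of_nonneg_right h2 (sq_nonneg (k : ℝ))
    calc _ ≤ _ := this
      _ = _ := by ring
  have h5 : -(|u| * (k : ℝ) ^ 2) ≤ u * (k : ℝ) ^ 2 := by
    have := mul_le_mul_of_nonneg_right (neg_abs_le u) (sq_nonneg (k : ℝ)); linarith
  have h6 : -(|v| * (k : ℝ) ^ 2) ≤ v * (k : ℝ) := by
    have := mul_le_mul_of_nonneg_right (neg_abs_le v) (zero_le_one.trans h1)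
    have := mul_le_mul_of_nonneg_left h3 (abs_nonneg v)
    linarith
  have h7 : -(|w| * (k : ℝ) ^ 2) ≤ w := by
    have := neg_abs_le w
    have := mul_le_mul_of_nonneg_left hk2 (abs_nonneg w)
    linarith
  linarith

/-- For large k an imaginary part costs only an arbitrarily small ε: (k+α)² + β² ≤ (k+α+ε)² as soon
as β² ≤ 2ε(k+α). -/
lemma norm_add_natCast_le {z : ℂ} {α β : ℝ} (hα : z.re ≤ α) (hβ : |z.im| ≤ β) {ε : ℝ} {k : ℕ}
    (hk : 0 ≤ (k : ℝ) + z.re) (h : β ^ 2 ≤ 2 * ε * (k + α)) (hε : 0 ≤ ε) :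
    ‖z + k‖ ≤ k + (α + ε) := by
  have h0 : 0 ≤ (k : ℝ) + (α + ε) := by linarith
  rw [← abs_of_nonneg h0, ← abs_of_nonneg (norm_nonneg (z + k)), ← sq_le_sq, Complex.sq_norm,
    Complex.normSq_apply]
  simp only [Complex.add_re, Complex.natCast_re, Complex.add_im, Complex.natCast_im, add_zero]
  have h1 : z.im * z.im ≤ β ^ 2 := by
    rw [← abs_mul_abs_self, ← pow_two]; gcongr
  nlinarith

lemma le_norm_add_natCast {z : ℂ} {α : ℝ} (hα : α ≤ z.re) (k : ℕ) : k + α ≤ ‖z + k‖ := by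
  have := Complex.re_le_norm (z + k)
  simp only [Complex.add_re, Complex.natCast_re] at this
  linarith

/-- Locally uniform bound for the ratio of consecutive terms of the hypergeometric series. -/
lemma eventually_ratio_le (p₀ : Params) {q : ℝ} (hq : q < 1 + (excess p₀).re) :
    ∃ K : ℕ, ∀ᶠ p in 𝓝 p₀, ∀ k ≥ K,
      ‖p.1 + (k : ℂ)‖ * ‖p.2.1 + (k : ℂ)‖ * ‖p.2.2.1 + (k : ℂ)‖ * ((k : ℝ) + 2) ≤
        ((k : ℝ) + 2 - q) * (‖p.2.2.2.1 + (k : ℂ)‖ * ‖p.2.2.2.2 + (k : ℂ)‖ * ((k : ℝ) + 1)) := by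
  obtain ⟨a, b, c, e, f⟩ := p₀
  set s := (excess (a, b, c, e, f)).re with hs
  have hs' : s = e.re + f.re - a.re - b.re - c.re := by simp [hs, excess]
  -- Each of the three upper factors will give up 2ε and each of the two lower ones ε, so the cubic
  -- coefficient `hd` equals 10ε − 8ε = 2ε.
  set ε : ℝ := (1 + s - q) / 10 with hε
  have hε0 : 0 < ε := by rw [hε]; linarith
  set B : ℝ := |a.im| + |b.im| + |c.im| + ε with hB
  have near : ∀ z : ℂ, ∀ᶠ w in 𝓝 z, ‖w - z‖ < ε := fun z => by
    filter_upwards [Metric.ball_mem_nhds z hε0] with w hw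
    rwa [Metric.mem_ball, dist_eq_norm] at hw
  have nearp : ∀ᶠ p : Params in 𝓝 (a, b, c, e, f), ‖p.1 - a‖ < ε ∧ ‖p.2.1 - b‖ < ε ∧
      ‖p.2.2.1 - c‖ < ε ∧ ‖p.2.2.2.1 - e‖ < ε ∧ ‖p.2.2.2.2 - f‖ < ε := by
    have hc : ∀ (g : Params → ℂ), Continuous g →
        ∀ᶠ p in 𝓝 ((a, b, c, e, f) : Params), ‖g p - g (a, b, c, e, f)‖ < ε :=
      fun g hg => hg.continuousAt.eventually (near _)
    filter_upwards [hc (fun p => p.1) (by fun_prop), hc (fun p => p.2.1) (by fun_prop),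
      hc (fun p => p.2.2.1) (by fun_prop), hc (fun p => p.2.2.2.1) (by fun_prop),
      hc (fun p => p.2.2.2.2) (by fun_prop)] with p h1 h2 h3 h4 h5
    exact ⟨h1, h2, h3, h4, h5⟩
  set α := a.re + ε
  set β := b.re + ε
  set γ := c.re + ε
  set η := e.re - ε with hη
  set φ := f.re - ε with hφ
  have hd : 0 < (2 - q + η + φ + 1) - ((α + ε) + (β + ε) + (γ + ε) + 2) := by
    simp only [hη, hφ, α, β, γ]; linarith
  -- The two sides to be compared are monic quartics in k; these are the coefficients of their
  -- difference.
  have hpoly := eventually_cubic_nonneg hd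
    (((2 - q) * η + (2 - q) * φ + (2 - q) * 1 + η * φ + η * 1 + φ * 1)
      - ((α + ε) * (β + ε) + (α + ε) * (γ + ε) + (α + ε) * 2 + (β + ε) * (γ + ε) + (β + ε) * 2
        + (γ + ε) * 2))
    (((2 - q) * η * φ + (2 - q) * η * 1 + (2 - q) * φ * 1 + η * φ * 1)
      - ((α + ε) * (β + ε) * (γ + ε) + (α + ε) * (β + ε) * 2 + (α + ε) * (γ + ε) * 2
        + (β + ε) * (γ + ε) * 2))
    ((2 - q) * η * φ * 1 - (α + ε) * (β + ε) * (γ + ε) * 2)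
  obtain ⟨K₁, hK₁⟩ := eventually_atTop.1 hpoly
  -- Beyond K₂ all linear factors are nonnegative and the imaginary parts of the upper factors,
  -- bounded by B, are absorbed by ε.
  obtain ⟨K₂, hK₂⟩ := exists_nat_ge
    (|a.re| + |b.re| + |c.re| + |e.re| + |f.re| + |q| + 2 * ε + B ^ 2 / (2 * ε))
  refine ⟨max K₁ K₂, ?_⟩
  filter_upwards [nearp] with p ⟨h1, h2, h3, h4, h5⟩ k hk
  have hkK : (K₂ : ℝ) ≤ k := by exact_mod_cast (le_max_right _ _).trans hk
  have hp := hK₁ k ((le_max_left _ _).trans hk)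
  have key : ∀ {z w : ℂ}, ‖z - w‖ < ε → w.re - ε ≤ z.re ∧ z.re ≤ w.re + ε ∧
      |z.im| ≤ |w.im| + ε := by
    intro z w h
    have hr := abs_le.1 ((Complex.abs_re_le_norm (z - w)).trans h.le)
    have hi := (Complex.abs_im_le_norm (z - w)).trans h.le
    simp only [Complex.sub_re, Complex.sub_im] at hr hi
    refine ⟨by linarith, by linarith, ?_⟩
    have := abs_sub_abs_le_abs_sub z.im w.im
    linarith
  have hB0 : 0 ≤ B ^ 2 / (2 * ε) := by positivity
  have na := neg_abs_le a.re
  have nb := neg_abs_le b.re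
  have nc := neg_abs_le c.re
  have ne := neg_abs_le e.re
  have nf := neg_abs_le f.re
  have nq := le_abs_self q
  have pa := abs_nonneg a.re
  have pb := abs_nonneg b.re
  have pc := abs_nonneg c.re
  have pe := abs_nonneg e.re
  have pf := abs_nonneg f.re
  have pq := abs_nonneg q
  have qa := abs_nonneg a.im
  have qb := abs_nonneg b.im
  have qc := abs_nonneg c.im
  have up : ∀ {z w : ℂ}, ‖z - w‖ < ε → |w.im| ≤ B - ε →
      0 ≤ (K₂ : ℝ) + w.re - ε - B ^ 2 / (2 * ε) → ‖z + k‖ ≤ k + (w.re + ε + ε) := by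
    intro z w h hw hK
    obtain ⟨l, u, i⟩ := key h
    refine norm_add_natCast_le u (i.trans (by linarith : _ ≤ B)) (by linarith) ?_
      hε0.le
    have : B ^ 2 / (2 * ε) ≤ k + (w.re + ε) := by linarith
    rw [div_le_iff₀ (by positivity)] at this
    linarith
  have u1 := up h1 (by simp only [hB]; linarith) (by linarith)
  have u2 := up h2 (by simp only [hB]; linarith) (by linarith)
  have u3 := up h3 (by simp only [hB]; linarith) (by linarith)
  have l4 := le_norm_add_natCast (key h4).1 k
  have l5 := le_norm_add_natCast (key h5).1 k
  have k0 : (0 : ℝ) ≤ k := k.cast_nonneg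
  calc ‖p.1 + k‖ * ‖p.2.1 + k‖ * ‖p.2.2.1 + k‖ * (k + 2)
      ≤ (k + (a.re + ε + ε)) * (k + (b.re + ε + ε)) * (k + (c.re + ε + ε)) * (k + 2) := by
        have : 0 ≤ (k : ℝ) + (a.re + ε + ε) := by linarith
        have : 0 ≤ (k : ℝ) + (b.re + ε + ε) := by linarith
        gcongr
    _ ≤ (k + 2 - q) * ((k + η) * (k + φ) * (k + 1)) := by
        simp only [α, β, γ] at hp
        linarith
    _ ≤ _ := by
        have : 0 ≤ (k : ℝ) + 2 - q := by linarith
        have : 0 ≤ (k : ℝ) + η := by simp only [hη]; linarith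
        have : 0 ≤ (k : ℝ) + φ := by simp only [hφ]; linarith
        gcongr

/-- Locally uniform bound for the terms of the hypergeometric series. -/
lemma eventually_norm_term_le {p₀ : Params} (he : NonPole p₀.2.2.2.1) (hf : NonPole p₀.2.2.2.2)
    {q : ℝ} (h1 : 1 ≤ q) (hq : q < 1 + (excess p₀).re) :
    ∃ C : ℝ, ∀ᶠ p in 𝓝 p₀, ∀ k : ℕ, ‖term p k‖ ≤ C * ((k : ℝ) + 1) ^ (-q) := by
  obtain ⟨K, hK⟩ := eventually_ratio_le p₀ hq
  -- The weighted norms ‖term p k‖ (k+1)^q do not increase from K on, so their maximum is attained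
  -- among the first K + 1 and is at most S p, which is continuous in p and hence locally bounded.
  set S : Params → ℝ := fun p => ∑ k ∈ Finset.range (K + 1), ‖term p k‖ * ((k : ℝ) + 1) ^ q
  have hS : ContinuousAt S p₀ := by
    refine tendsto_finsetSum _ fun k _ => ?_
    exact ((differentiableAt_term he hf k).continuousAt.norm.mul continuousAt_const)
  have hSe : ∀ᶠ p in 𝓝 p₀, S p < S p₀ + 1 := hS.eventually (gt_mem_nhds (by linarith))
  have he' : ∀ᶠ p : Params in 𝓝 p₀, NonPole p.2.2.2.1 :=
    (show ContinuousAt (fun p : Params => p.2.2.2.1) p₀ by fun_prop).eventually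
      (isOpen_nonPole.mem_nhds he)
  have hf' : ∀ᶠ p : Params in 𝓝 p₀, NonPole p.2.2.2.2 :=
    (show ContinuousAt (fun p : Params => p.2.2.2.2) p₀ by fun_prop).eventually
      (isOpen_nonPole.mem_nhds hf)
  refine ⟨S p₀ + 1, ?_⟩
  filter_upwards [hK, hSe, he', hf'] with p hp hSp hep hfp k
  have main : ∀ k : ℕ, ‖term p k‖ * ((k : ℝ) + 1) ^ q ≤ S p := by
    have small : ∀ k ≤ K, ‖term p k‖ * ((k : ℝ) + 1) ^ q ≤ S p := fun k hk =>
      Finset.single_le_sum (f := fun k : ℕ => ‖term p k‖ * ((k : ℝ) + 1) ^ q)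
        (fun i _ => by positivity) (Finset.mem_range.2 (by omega))
    intro k
    induction k with
    | zero => exact small 0 (Nat.zero_le _)
    | succ k ih =>
      rcases Nat.lt_or_ge k K with hk | hk
      · exact small _ hk
      refine le_trans ?_ ih
      obtain ⟨a, b, c, e, f⟩ := p
      have hr := hp k hk
      simp only at hr hep hfp
      have e0 : 0 < ‖e + k‖ := norm_pos_iff.2 (hep.add_natCast_ne k)
      have f0 : 0 < ‖f + k‖ := norm_pos_iff.2 (hfp.add_natCast_ne k)
      have k0 : (0 : ℝ) ≤ k := k.cast_nonneg
      have k1 : ‖(k : ℂ) + 1‖ = k + 1 := by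
        rw [← Nat.cast_succ, Complex.norm_natCast]; push_cast; ring
      rw [term_succ, norm_mul, norm_div, norm_mul, norm_mul, norm_mul, norm_mul, k1, mul_assoc]
      refine mul_le_mul_of_nonneg_left ?_ (norm_nonneg _)
      -- Bernoulli's inequality, the reason for requiring q ≥ 1: it converts the rational ratio
      -- bound into the ratio of consecutive powers (k+1)^(−q).
      have hb : 1 - q / (k + 2) ≤ (((k : ℝ) + 1) / (k + 2)) ^ q := by
        have := one_add_mul_self_le_rpow_one_add (s := -1 / ((k : ℝ) + 2)) (by
          rw [le_div_iff₀ (by positivity)]; linarith) h1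
        have e1 : 1 + -1 / ((k : ℝ) + 2) = ((k : ℝ) + 1) / (k + 2) := by field_simp; ring
        rw [e1] at this
        refine le_trans (le_of_eq ?_) this
        ring
      have hr' : ‖a + k‖ * ‖b + k‖ * ‖c + k‖ / (‖e + k‖ * ‖f + k‖ * (k + 1)) ≤ 1 - q / (k + 2) := by
        rw [div_le_iff₀ (by positivity)]
        have : 1 - q / ((k : ℝ) + 2) = (k + 2 - q) / (k + 2) := by field_simp
        rw [this, div_mul_eq_mul_div, le_div_iff₀ (by positivity)]
        exact hr
      push_cast
      have e2 : (k : ℝ) + 1 + 1 = k + 2 := by ring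
      rw [e2]
      calc _ ≤ (((k : ℝ) + 1) / (k + 2)) ^ q * ((k : ℝ) + 2) ^ q := by
            gcongr; exact hr'.trans hb
        _ = _ := by
            rw [← Real.mul_rpow (by positivity) (by positivity)]
            congr 1; field_simp
  have := (main k).trans hSp.le
  rw [Real.rpow_neg (by positivity), ← div_eq_mul_inv, le_div_iff₀ (by positivity)]
  exact this

lemma norm_term_le {p : Params} (he : NonPole p.2.2.2.1) (hf : NonPole p.2.2.2.2)
    {q : ℝ} (h1 : 1 ≤ q) (hq : q < 1 + (excess p).re) :
    ∃ C : ℝ, ∀ k : ℕ, ‖term p k‖ ≤ C * ((k : ℝ) + 1) ^ (-q) := by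
  obtain ⟨C, hC⟩ := eventually_norm_term_le he hf h1 hq
  exact ⟨C, hC.self_of_nhds⟩

lemma summable_rpow_shift {q : ℝ} (hq : 1 < q) (C : ℝ) :
    Summable fun k : ℕ => C * ((k : ℝ) + 1) ^ (-q) := by
  have := (summable_nat_add_iff 1).2 (Real.summable_nat_rpow.2 (by linarith : -q < -1))
  simpa using this.mul_left C

lemma summable_norm_term {p : Params} (he : NonPole p.2.2.2.1) (hf : NonPole p.2.2.2.2)
    (hs : 0 < (excess p).re) : Summable fun k => ‖term p k‖ := by
  obtain ⟨C, hC⟩ := norm_term_le he hf (q := 1 + (excess p).re / 2) (by linarith) (by linarith)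
  exact Summable.of_nonneg_of_le (fun _ => norm_nonneg _) hC (summable_rpow_shift (by linarith) C)

lemma summable_term {p : Params} (he : NonPole p.2.2.2.1) (hf : NonPole p.2.2.2.2)
    (hs : 0 < (excess p).re) : Summable (term p) :=
  (summable_norm_term he hf hs).of_norm

/-- The terms decay faster than `1 / k` where the excess has positive real part. -/
lemma tendsto_natCast_mul_term {p : Params} (he : NonPole p.2.2.2.1) (hf : NonPole p.2.2.2.2)
    (hs : 0 < (excess p).re) : Tendsto (fun k : ℕ => (k : ℂ) * term p k) atTop (𝓝 0) := by
  set δ := (excess p).re / 2 with hδ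
  have hδ0 : 0 < δ := by rw [hδ]; linarith
  obtain ⟨C, hC⟩ := norm_term_le he hf (q := 1 + δ) (by linarith) (by linarith)
  have hlim : Tendsto (fun k : ℕ => C * ((k : ℝ) + 1) ^ (-δ)) atTop (𝓝 0) := by
    have h1 : Tendsto (fun k : ℕ => (k : ℝ) + 1) atTop atTop :=
      tendsto_atTop_add_const_right _ _ tendsto_natCast_atTop_atTop
    simpa using ((tendsto_rpow_neg_atTop hδ0).comp h1).const_mul C
  refine squeeze_zero_norm (fun k => ?_) hlim
  have hC0 : 0 ≤ C := by
    have := (norm_nonneg _).trans (hC 0)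
    simpa using this
  rw [norm_mul, Complex.norm_natCast]
  have h1 : (0 : ℝ) < (k : ℝ) + 1 := by positivity
  calc (k : ℝ) * ‖term p k‖ ≤ ((k : ℝ) + 1) * (C * ((k : ℝ) + 1) ^ (-(1 + δ))) :=
        mul_le_mul (by linarith) (hC k) (norm_nonneg _) h1.le
    _ = C * ((k : ℝ) + 1) ^ (-δ) := by
        rw [neg_add, Real.rpow_add h1, Real.rpow_neg_one]; field_simp

end Hyp32

namespace Hyp32

open Filter Topology

/-! ### Analytic continuation of the hypergeometric series -/

lemma term_lower_right (a b c e : ℂ) {f : ℂ} (hf : NonPole f) (k : ℕ) :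
    term (a, b, c, e, f + 1) k = term (a, b, c, e, f) k * (f / (f + k)) := by
  have h := poch_mul_add f k
  have h1 := hf.poch_ne_zero k
  have h2 := hf.add_one.poch_ne_zero k
  have h3 := hf.add_natCast_ne k
  have h4 := hf.ne_zero
  have h5 : poch (f + 1) k = poch f k * (f + k) / f := by rw [h]; field_simp
  have h6 : (ascPochhammer ℂ k).eval (f + 1) = (ascPochhammer ℂ k).eval f * (f + k) / f := h5
  simp only [term, h6, div_eq_mul_inv, mul_inv, inv_inv]
  ring

lemma term_swap_lower (a b c e f : ℂ) (k : ℕ) :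
    term (a, b, c, e, f) k = term (a, b, c, f, e) k := by
  simp only [term]; ring

lemma term_lower_left (a b c f : ℂ) {e : ℂ} (he : NonPole e) (k : ℕ) :
    term (a, b, c, e + 1, f) k = term (a, b, c, e, f) k * (e / (e + k)) := by
  rw [term_swap_lower, term_lower_right a b c f he, term_swap_lower]

/-- The telescoping principle behind the contiguous relations for the continuation, for Gauss's
theorem and for Dixon's: a combination of terms is recognised as v(k+1) − v(k). -/
lemma tsum_sub_eq_zero {v : ℕ → ℂ} (hs : Summable fun k => v (k + 1) - v k) (h0 : v 0 = 0)
    (hv : Tendsto v atTop (𝓝 0)) : ∑' k, (v (k + 1) - v k) = 0 := by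
  refine tendsto_nhds_unique hs.hasSum.tendsto_sum_nat ?_
  simpa only [Finset.sum_range_sub, h0, sub_zero] using hv

/-- First coefficient in the contiguous relation raising the lower parameters. -/
noncomputable def coefP : Params → ℂ
  | (a, b, c, e, f) => (e + f - a - b - c) * (e + f) + (a * b + b * c + c * a) - e * f

/-- Second coefficient in the contiguous relation raising the lower parameters. -/
noncomputable def coefQ : Params → ℂ
  | (a, b, c, e, f) => (e + f - a - b - c) * e * f + a * b * c

/-- Over the common denominator (e+k)(f+k), the sum of the excess and the telescoping part has
numerator s(e+k)(f+k) + (a+k)(b+k)(c+k) − k(e+k)(f+k). Its cubic terms cancel, its quadratic terms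
cancel by the definition of the excess s, and what remains is `coefP`·k + `coefQ`. Expanding this in
1 and e + k gives the two series on the right. -/
lemma contiguous_term (a b c : ℂ) {e f : ℂ} (he : NonPole e) (hf : NonPole f) (k : ℕ) :
    excess (a, b, c, e, f) * e * f * term (a, b, c, e, f) k =
      coefP (a, b, c, e, f) * e * term (a, b, c, e, f + 1) k +
      (coefQ (a, b, c, e, f) - coefP (a, b, c, e, f) * e) * term (a, b, c, e + 1, f + 1) k -
      (e * f * (((k + 1 : ℕ) : ℂ) * term (a, b, c, e, f) (k + 1)) -
        e * f * ((k : ℂ) * term (a, b, c, e, f) k)) := by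
  rw [term_lower_left a b c (f + 1) he, term_lower_right a b c e hf, term_succ]
  have h1 := hf.add_natCast_ne k
  have h2 := he.add_natCast_ne k
  have h3 : (k : ℂ) + 1 ≠ 0 := Nat.cast_add_one_ne_zero k
  simp only [excess, coefP, coefQ]
  push_cast
  field_simp
  ring

/-- The series on the right have excess larger by 1 and by 2, and the factor on the left vanishes
nowhere on the domain. Solving for the left series therefore extends it one strip further to the
left. -/
lemma contiguous_tsum (a b c : ℂ) {e f : ℂ} (he : NonPole e) (hf : NonPole f)
    (hs : 0 < (excess (a, b, c, e, f)).re) :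
    excess (a, b, c, e, f) * e * f * ∑' k, term (a, b, c, e, f) k =
      coefP (a, b, c, e, f) * e * ∑' k, term (a, b, c, e, f + 1) k +
      (coefQ (a, b, c, e, f) - coefP (a, b, c, e, f) * e) *
        ∑' k, term (a, b, c, e + 1, f + 1) k := by
  have h0 : Summable (term (a, b, c, e, f)) := summable_term he hf hs
  have h1 : Summable (term (a, b, c, e, f + 1)) := summable_term he hf.add_one (by
    simp only [excess, Complex.sub_re, Complex.add_re, Complex.one_re] at hs ⊢; linarith)
  have h2 : Summable (term (a, b, c, e + 1, f + 1)) := summable_term he.add_one hf.add_one (by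
    simp only [excess, Complex.sub_re, Complex.add_re, Complex.one_re] at hs ⊢; linarith)
  set v : ℕ → ℂ := fun k => e * f * ((k : ℂ) * term (a, b, c, e, f) k) with hv
  have hv0 : Tendsto v atTop (𝓝 0) := by
    simpa using (tendsto_natCast_mul_term he hf hs).const_mul (e * f)
  have hd : ∀ k, v (k + 1) - v k = coefP (a, b, c, e, f) * e * term (a, b, c, e, f + 1) k +
      (coefQ (a, b, c, e, f) - coefP (a, b, c, e, f) * e) * term (a, b, c, e + 1, f + 1) k -
      excess (a, b, c, e, f) * e * f * term (a, b, c, e, f) k := by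
    intro k
    rw [contiguous_term a b c he hf k, hv]
    ring
  have e1 := h1.mul_left (coefP (a, b, c, e, f) * e)
  have e2 := h2.mul_left (coefQ (a, b, c, e, f) - coefP (a, b, c, e, f) * e)
  have e0 := h0.mul_left (excess (a, b, c, e, f) * e * f)
  have hz := tsum_sub_eq_zero (v := v) (by simp only [hd]; exact (e1.add e2).sub e0) (by simp [hv])
    hv0
  simp only [hd] at hz
  rw [(e1.add e2).tsum_sub e0, e1.tsum_add e2, tsum_mul_left, tsum_mul_left, tsum_mul_left] at hz
  linear_combination -hz

/-- Successive analytic continuations of the hypergeometric series. -/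
noncomputable def hypCont : ℕ → Params → ℂ
  | 0, p => ∑' k, term p k
  | m + 1, (a, b, c, e, f) =>
    (coefP (a, b, c, e, f) * e * hypCont m (a, b, c, e, f + 1) +
      (coefQ (a, b, c, e, f) - coefP (a, b, c, e, f) * e) * hypCont m (a, b, c, e + 1, f + 1)) /
      (excess (a, b, c, e, f) * e * f)

/-- The part of the domain where `hypCont m` is the continuation of the series. -/
def region (m : ℕ) : Set Params := {p | p ∈ domain ∧ -(m : ℝ) < (excess p).re}

lemma differentiable_excess : Differentiable ℂ excess := by
  have : excess = fun p : Params => p.2.2.2.1 + p.2.2.2.2 - p.1 - p.2.1 - p.2.2.1 := rfl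
  rw [this]; fun_prop

lemma isOpen_domain : IsOpen domain :=
  (isOpen_nonPole.preimage (f := fun p : Params => p.2.2.2.1) (by fun_prop)).inter
    ((isOpen_nonPole.preimage (f := fun p : Params => p.2.2.2.2) (by fun_prop)).inter
      (isOpen_nonPole.preimage differentiable_excess.continuous))

lemma isOpen_region (m : ℕ) : IsOpen (region m) :=
  isOpen_domain.inter (isOpen_lt continuous_const
    (Complex.continuous_re.comp differentiable_excess.continuous))

lemma region_mono {m m' : ℕ} (h : m ≤ m') : region m ⊆ region m' := fun _ hp =>
  ⟨hp.1, lt_of_le_of_lt (neg_le_neg (by exact_mod_cast h)) hp.2⟩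

lemma region_shift_right {m : ℕ} {a b c e f : ℂ} (h : (a, b, c, e, f) ∈ region (m + 1)) :
    (a, b, c, e, f + 1) ∈ region m := by
  obtain ⟨⟨h1, h2, h3⟩, h4⟩ := h
  have hs : excess (a, b, c, e, f + 1) = excess (a, b, c, e, f) + 1 := by simp only [excess]; ring
  refine ⟨⟨h1, h2.add_one, ?_⟩, ?_⟩
  · rw [hs]; exact h3.add_one
  · rw [hs]; push_cast at h4; simp only [Complex.add_re, Complex.one_re]; linarith

lemma region_shift_both {m : ℕ} {a b c e f : ℂ} (h : (a, b, c, e, f) ∈ region (m + 1)) :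
    (a, b, c, e + 1, f + 1) ∈ region m := by
  obtain ⟨⟨h1, h2, h3⟩, h4⟩ := h
  have hs : excess (a, b, c, e + 1, f + 1) = excess (a, b, c, e, f) + 1 + 1 := by
    simp only [excess]; ring
  refine ⟨⟨h1.add_one, h2.add_one, ?_⟩, ?_⟩
  · rw [hs]; exact h3.add_one.add_one
  · rw [hs]; push_cast at h4; simp only [Complex.add_re, Complex.one_re]; linarith

/-- A summable bound, uniform on a ball, bounds the derivatives on the ball of half the radius by
Cauchy's estimate, so the series may be differentiated term by term. -/
lemma differentiableAt_tsum_term {p₀ : Params} (he : NonPole p₀.2.2.2.1)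
    (hf : NonPole p₀.2.2.2.2) (hs : 0 < (excess p₀).re) :
    DifferentiableAt ℂ (fun p => ∑' k, term p k) p₀ := by
  set q := 1 + (excess p₀).re / 2 with hq
  have hq1 : 1 < q := by rw [hq]; linarith
  obtain ⟨C, hC⟩ := eventually_norm_term_le he hf hq1.le (by rw [hq]; linarith)
  have he' : ∀ᶠ p : Params in 𝓝 p₀, NonPole p.2.2.2.1 :=
    (show ContinuousAt (fun p : Params => p.2.2.2.1) p₀ by fun_prop).eventually
      (isOpen_nonPole.mem_nhds he)
  have hf' : ∀ᶠ p : Params in 𝓝 p₀, NonPole p.2.2.2.2 :=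
    (show ContinuousAt (fun p : Params => p.2.2.2.2) p₀ by fun_prop).eventually
      (isOpen_nonPole.mem_nhds hf)
  obtain ⟨r, hr, hball⟩ := Metric.eventually_nhds_iff_ball.1 (hC.and (he'.and hf'))
  set u : ℕ → ℝ := fun k => (|C| + 1) * ((k : ℝ) + 1) ^ (-q) with hu
  have hu0 : ∀ k, 0 < u k := fun k => by positivity
  have hbound : ∀ p ∈ Metric.ball p₀ r, ∀ k, ‖term p k‖ ≤ u k := fun p hp k => by
    refine ((hball p hp).1 k).trans (mul_le_mul_of_nonneg_right ?_ (by positivity))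
    linarith [le_abs_self C]
  have hdiff : ∀ p ∈ Metric.ball p₀ r, ∀ k, DifferentiableAt ℂ (fun p => term p k) p :=
    fun p hp k => differentiableAt_term (hball p hp).2.1 (hball p hp).2.2 k
  have hsub : ∀ p ∈ Metric.ball p₀ (r / 2), Metric.ball p (r / 2) ⊆ Metric.ball p₀ r := by
    intro p hp
    refine Metric.ball_subset_ball' ?_
    rw [Metric.mem_ball] at hp
    linarith
  have hmem : p₀ ∈ Metric.ball p₀ (r / 2) := Metric.mem_ball_self (by positivity)
  refine (hasFDerivAt_tsum_of_isPreconnected (u := fun k => 3 * u k / (r / 2))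
    (f := fun k p => term p k) (f' := fun k p => fderiv ℂ (fun p => term p k) p)
    (s := Metric.ball p₀ (r / 2)) (x₀ := p₀) ?_ Metric.isOpen_ball
    (convex_ball p₀ (r / 2)).isPreconnected ?_ ?_ hmem ?_ hmem).differentiableAt
  · exact ((summable_rpow_shift hq1 _).mul_left 3).div_const _
  · exact fun k p hp => (hdiff p (hsub p hp (Metric.mem_ball_self (by positivity))) k).hasFDerivAt
  · intro k p hp
    refine Complex.norm_fderiv_le_div_of_mapsTo_ball
      (fun x hx => (hdiff x (hsub p hp hx) k).differentiableWithinAt) ?_ (by positivity)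
    intro x hx
    rw [Metric.mem_closedBall, dist_eq_norm]
    have h1 := hbound x (hsub p hp hx) k
    have h2 := hbound p (hsub p hp (Metric.mem_ball_self (by positivity))) k
    have h3 := norm_sub_le (term x k) (term p k)
    have := hu0 k
    linarith
  · exact summable_term he hf hs

lemma differentiableOn_hypCont (m : ℕ) : DifferentiableOn ℂ (hypCont m) (region m) := by
  induction m with
  | zero =>
    rintro p ⟨⟨h1, h2, _⟩, h4⟩
    exact (differentiableAt_tsum_term h1 h2 (by simpa using h4)).differentiableWithinAt
  | succ m ih =>
    have hrec : hypCont (m + 1) = fun p : Params =>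
        (coefP p * p.2.2.2.1 * hypCont m (p.1, p.2.1, p.2.2.1, p.2.2.2.1, p.2.2.2.2 + 1) +
          (coefQ p - coefP p * p.2.2.2.1) *
            hypCont m (p.1, p.2.1, p.2.2.1, p.2.2.2.1 + 1, p.2.2.2.2 + 1)) *
          (excess p * p.2.2.2.1 * p.2.2.2.2)⁻¹ := rfl
    have hP : Differentiable ℂ coefP := by
      have : coefP = fun p : Params => (p.2.2.2.1 + p.2.2.2.2 - p.1 - p.2.1 - p.2.2.1) *
        (p.2.2.2.1 + p.2.2.2.2) + (p.1 * p.2.1 + p.2.1 * p.2.2.1 + p.2.2.1 * p.1)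
        - p.2.2.2.1 * p.2.2.2.2 := rfl
      rw [this]; fun_prop
    have hQ : Differentiable ℂ coefQ := by
      have : coefQ = fun p : Params => (p.2.2.2.1 + p.2.2.2.2 - p.1 - p.2.1 - p.2.2.1) *
        p.2.2.2.1 * p.2.2.2.2 + p.1 * p.2.1 * p.2.2.1 := rfl
      rw [this]; fun_prop
    rintro ⟨a, b, c, e, f⟩ hp
    have d1 : DifferentiableAt ℂ
        (fun p : Params => hypCont m (p.1, p.2.1, p.2.2.1, p.2.2.2.1, p.2.2.2.2 + 1))
        (a, b, c, e, f) := by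
      have := ih.differentiableAt ((isOpen_region m).mem_nhds (region_shift_right hp))
      exact DifferentiableAt.comp (g := hypCont m)
        (f := fun p : Params => (p.1, p.2.1, p.2.2.1, p.2.2.2.1, p.2.2.2.2 + 1))
        (a, b, c, e, f) this (by fun_prop)
    have d2 : DifferentiableAt ℂ
        (fun p : Params => hypCont m (p.1, p.2.1, p.2.2.1, p.2.2.2.1 + 1, p.2.2.2.2 + 1))
        (a, b, c, e, f) := by
      have := ih.differentiableAt ((isOpen_region m).mem_nhds (region_shift_both hp))
      exact DifferentiableAt.comp (g := hypCont m)
        (f := fun p : Params => (p.1, p.2.1, p.2.2.1, p.2.2.2.1 + 1, p.2.2.2.2 + 1))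
        (a, b, c, e, f) this (by fun_prop)
    have d3 : DifferentiableAt ℂ (fun p : Params => excess p * p.2.2.2.1 * p.2.2.2.2)
        (a, b, c, e, f) := by
      have := differentiable_excess (a, b, c, e, f)
      fun_prop
    have hne : excess (a, b, c, e, f) * e * f ≠ 0 :=
      mul_ne_zero (mul_ne_zero hp.1.2.2.ne_zero hp.1.1.ne_zero) hp.1.2.1.ne_zero
    have d4 := d3.fun_inv hne
    have d5 := hP (a, b, c, e, f)
    have d6 := hQ (a, b, c, e, f)
    rw [hrec]
    refine DifferentiableAt.differentiableWithinAt ?_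
    fun_prop

/-- At level 0 this is the contiguous relation between convergent series. Higher levels are defined
by the same recursion evaluated at shifted points one region lower, so agreement propagates. -/
lemma hypCont_succ_eq (m : ℕ) : ∀ p ∈ region m, hypCont (m + 1) p = hypCont m p := by
  induction m with
  | zero =>
    rintro ⟨a, b, c, e, f⟩ ⟨⟨h1, h2, h3⟩, h4⟩
    have := contiguous_tsum a b c h1 h2 (by simpa using h4)
    have hne : excess (a, b, c, e, f) * e * f ≠ 0 :=
      mul_ne_zero (mul_ne_zero h3.ne_zero h1.ne_zero) h2.ne_zero
    simp only [hypCont]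
    rw [div_eq_iff hne, ← this, mul_comm]
  | succ m ih =>
    rintro ⟨a, b, c, e, f⟩ hp
    rw [hypCont, ih _ (region_shift_right hp), ih _ (region_shift_both hp), hypCont]

lemma hypCont_eq_of_le {m m' : ℕ} (h : m ≤ m') {p : Params} (hp : p ∈ region m) :
    hypCont m' p = hypCont m p := by
  induction m', h using Nat.le_induction with
  | base => rfl
  | succ k hk ih => rw [hypCont_succ_eq k p (region_mono hk hp), ih]

/-- The hypergeometric function `₃F₂(a, b, c; e, f | 1)` of its five parameters. -/
noncomputable def hyp (p : Params) : ℂ := hypCont (⌈|(excess p).re|⌉₊ + 1) p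

/-- The level used in `hyp` varies with p; independence of the level makes `hyp` coincide near each
point with a single `hypCont m`, which gives holomorphy. -/
lemma hyp_eq_hypCont {m : ℕ} {p : Params} (hp : p ∈ region m) : hyp p = hypCont m p := by
  have h : p ∈ region (⌈|(excess p).re|⌉₊ + 1) := by
    refine ⟨hp.1, ?_⟩
    have h1 := Nat.le_ceil |(excess p).re|
    have h2 := neg_abs_le (excess p).re
    push_cast
    linarith
  rw [hyp]
  rcases le_total m (⌈|(excess p).re|⌉₊ + 1) with hm | hm
  · exact hypCont_eq_of_le hm hp
  · exact (hypCont_eq_of_le hm h).symm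

theorem isHypergeometric_hyp : IsHypergeometric hyp where
  holomorphic := by
    intro p hp
    obtain ⟨m, hm⟩ := exists_nat_gt (-(excess p).re)
    have hpm : p ∈ region m := ⟨hp, by linarith⟩
    have hnhds := (isOpen_region m).mem_nhds hpm
    refine DifferentiableAt.differentiableWithinAt ?_
    refine ((differentiableOn_hypCont m).differentiableAt hnhds).congr_of_eventuallyEq ?_
    filter_upwards [hnhds] with x hx using hyp_eq_hypCont hx
  hasSum := by
    intro p hp hs
    rw [hyp_eq_hypCont (m := 0) ⟨hp, by simpa using hs⟩]
    exact (summable_term hp.1 hp.2.1 hs).hasSum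

/-! ### Identity theorem on the complement of a countable set -/

/-- The complement of a countable set in the plane is connected, and an interval is uncountable, so
U contains a point of the interval, at which nearby real points accumulate. The identity theorem
applies there. -/
lemma eqOn_of_eq_on_real {U : Set ℂ} (hU : IsOpen U) (hc : Uᶜ.Countable) {f g : ℂ → ℂ}
    (hf : DifferentiableOn ℂ f U) (hg : DifferentiableOn ℂ g U) {α β : ℝ} (hαβ : α < β)
    (h : ∀ t : ℝ, (t : ℂ) ∈ U → α < t → t < β → f t = g t) : ∀ z ∈ U, f z = g z := by
  have hcr : ((fun t : ℝ => (t : ℂ)) ⁻¹' Uᶜ).Countable :=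
    hc.preimage_of_injOn (Complex.ofReal_injective.injOn)
  obtain ⟨t₀, ht', ht⟩ := (hcr.dense_compl ℝ).exists_mem_open isOpen_Ioo (Set.nonempty_Ioo.2 hαβ)
  have htU : (t₀ : ℂ) ∈ U := by simpa using ht'
  have hconn : IsPreconnected U := by
    have := (hc.isConnected_compl_of_one_lt_rank (E := ℂ) (by simp)).isPreconnected
    rwa [compl_compl] at this
  refine (hf.analyticOnNhd hU).eqOn_of_preconnected_of_frequently_eq (hg.analyticOnNhd hU) hconn htU
    ?_
  have h1 : Tendsto (fun t : ℝ => (t : ℂ)) (𝓝[≠] t₀) (𝓝[≠] (t₀ : ℂ)) :=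
    tendsto_nhdsWithin_of_tendsto_nhds_of_eventually_within _
      (Complex.continuous_ofReal.continuousAt.mono_left nhdsWithin_le_nhds)
      (by filter_upwards [self_mem_nhdsWithin] with t ht; simpa using ht)
  refine h1.frequently (Eventually.frequently ?_)
  refine nhdsWithin_le_nhds ?_
  filter_upwards [isOpen_Ioo.mem_nhds ht,
    Complex.continuous_ofReal.continuousAt.preimage_mem_nhds (hU.mem_nhds htU)] with t h2 h3
  exact h t h3 h2.1 h2.2

end Hyp32

namespace Hyp32

open Filter Topology

/-! ### Asymptotics of quotients of gamma functions -/

lemma Gamma_add_natCast {s : ℂ} (hs : NonPole s) (n : ℕ) :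
    Complex.Gamma (s + n) = Complex.Gamma s * poch s n := by
  induction n with
  | zero => simp [poch_zero]
  | succ n ih =>
    have : s + ((n + 1 : ℕ) : ℂ) = s + n + 1 := by push_cast; ring
    rw [this, Complex.Gamma_add_one _ (hs.add_natCast_ne n), ih, poch_succ]; ring

lemma poch_eq_prod (s : ℂ) (n : ℕ) : poch s n = ∏ j ∈ Finset.range n, (s + j) := by
  induction n with
  | zero => simp [poch_zero]
  | succ n ih => rw [poch_succ, ih, Finset.prod_range_succ]

/-- Euler's limit n^s n! / (s)_{n+1} → Γ(s), applied four times; the balance s₁ + s₂ = s₃ + s₄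
cancels the powers of n. Euler's product has n + 1 factors, hence the shift of the index by one. -/
lemma tendsto_poch_quotient {s₁ s₂ s₃ s₄ : ℂ} (h₁ : NonPole s₁) (h₂ : NonPole s₂)
    (h₃ : NonPole s₃) (h₄ : NonPole s₄) (h : s₁ + s₂ = s₃ + s₄) :
    Tendsto (fun n => poch s₃ n * poch s₄ n / (poch s₁ n * poch s₂ n)) atTop
      (𝓝 (Complex.Gamma s₁ * Complex.Gamma s₂ / (Complex.Gamma s₃ * Complex.Gamma s₄))) := by
  rw [← tendsto_add_atTop_iff_nat 1]
  have hG : ∀ {s : ℂ}, NonPole s → Complex.Gamma s ≠ 0 := fun h => nonPole_iff.1 h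
  have lim := ((Complex.GammaSeq_tendsto_Gamma s₁).mul (Complex.GammaSeq_tendsto_Gamma s₂)).div
    ((Complex.GammaSeq_tendsto_Gamma s₃).mul (Complex.GammaSeq_tendsto_Gamma s₄))
    (mul_ne_zero (hG h₃) (hG h₄))
  refine lim.congr' ?_
  filter_upwards [eventually_ne_atTop 0] with n hn
  have hn' : (n : ℂ) ≠ 0 := Nat.cast_ne_zero.2 hn
  have p₁ := h₁.poch_ne_zero (n + 1)
  have p₂ := h₂.poch_ne_zero (n + 1)
  have p₃ := h₃.poch_ne_zero (n + 1)
  have p₄ := h₄.poch_ne_zero (n + 1)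
  have hf : (n.factorial : ℂ) ≠ 0 := Nat.cast_ne_zero.2 n.factorial_ne_zero
  have hp : (n : ℂ) ^ s₁ * (n : ℂ) ^ s₂ = (n : ℂ) ^ s₃ * (n : ℂ) ^ s₄ := by
    rw [← Complex.cpow_add _ _ hn', h, Complex.cpow_add _ _ hn']
  have q₃ : (n : ℂ) ^ s₃ ≠ 0 := by simp [Complex.cpow_eq_zero_iff, hn']
  have q₄ : (n : ℂ) ^ s₄ ≠ 0 := by simp [Complex.cpow_eq_zero_iff, hn']
  simp only [Pi.div_apply, Complex.GammaSeq, ← poch_eq_prod]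
  field_simp
  linear_combination hp

/-- A sequence with a first-order recurrence whose coefficient is a quotient of linear factors. -/
lemma eq_of_tendsto_of_recurrence {s₁ s₂ s₃ s₄ : ℂ} (h₁ : NonPole s₁) (h₂ : NonPole s₂)
    (h₃ : NonPole s₃) (h₄ : NonPole s₄) (h : s₁ + s₂ = s₃ + s₄) {D : ℕ → ℂ} {l : ℂ}
    (hD : ∀ n : ℕ, (s₁ + n) * (s₂ + n) * D (n + 1) = (s₃ + n) * (s₄ + n) * D n)
    (hl : Tendsto D atTop (𝓝 l)) :
    l = D 0 * (Complex.Gamma s₁ * Complex.Gamma s₂ / (Complex.Gamma s₃ * Complex.Gamma s₄)) := by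
  have hsol : ∀ n, D n = D 0 * (poch s₃ n * poch s₄ n / (poch s₁ n * poch s₂ n)) := by
    intro n
    induction n with
    | zero => simp [poch_zero]
    | succ n ih =>
      have p₁ := h₁.poch_ne_zero n
      have p₂ := h₂.poch_ne_zero n
      have q₁ := h₁.add_natCast_ne n
      have q₂ := h₂.add_natCast_ne n
      have hn := hD n
      rw [ih] at hn
      have : D (n + 1) = (s₃ + n) * (s₄ + n) * (D 0 * (poch s₃ n * poch s₄ n /
          (poch s₁ n * poch s₂ n))) / ((s₁ + n) * (s₂ + n)) := by
        rw [eq_div_iff (mul_ne_zero q₁ q₂), ← hn]; ring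
      rw [this]
      simp only [poch_succ]
      field_simp
  refine tendsto_nhds_unique hl ?_
  exact ((tendsto_poch_quotient h₁ h₂ h₃ h₄ h).const_mul (D 0)).congr fun n => (hsol n).symm

/-! ### Gauss's summation theorem -/

/-- The Gauss series is encoded with an upper and a lower parameter 1, which cancel. The relation
telescopes with v(k) = c·k·(k-th term). -/
lemma gauss_contiguous (a b : ℂ) {c : ℂ} (hc : NonPole c) (hs : 0 < (c - a - b).re) :
    (c - a) * (c - b) * ∑' k, term (a, b, 1, c + 1, 1) k =
      c * (c - a - b) * ∑' k, term (a, b, 1, c, 1) k := by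
  have hone : NonPole 1 := nonPole_of_re_pos (by simp)
  have hex : (excess (a, b, 1, c, 1)).re = (c - a - b).re := by simp [excess]; ring
  have h0 : Summable (term (a, b, 1, c, 1)) := summable_term hc hone (by rw [hex]; exact hs)
  have h1 : Summable (term (a, b, 1, c + 1, 1)) := summable_term hc.add_one hone (by
    simp [excess] at hs ⊢; linarith)
  set v : ℕ → ℂ := fun k => c * ((k : ℂ) * term (a, b, 1, c, 1) k) with hv
  have hv0 : Tendsto v atTop (𝓝 0) := by
    simpa using (tendsto_natCast_mul_term (p := (a, b, 1, c, 1)) hc hone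
      (by rw [hex]; exact hs)).const_mul c
  have hd : ∀ k, v (k + 1) - v k = (c - a) * (c - b) * term (a, b, 1, c + 1, 1) k -
      c * (c - a - b) * term (a, b, 1, c, 1) k := by
    intro k
    have q := hc.add_natCast_ne k
    have q1 : (1 : ℂ) + k ≠ 0 := hone.add_natCast_ne k
    have q2 : (k : ℂ) + 1 ≠ 0 := Nat.cast_add_one_ne_zero k
    simp only [hv, term_lower_left a b 1 1 hc, term_succ]
    push_cast
    field_simp
    ring
  have e1 := h1.mul_left ((c - a) * (c - b))
  have e0 := h0.mul_left (c * (c - a - b))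
  have hz := tsum_sub_eq_zero (v := v) (by simp only [hd]; exact e1.sub e0) (by simp [hv]) hv0
  simp only [hd] at hz
  rw [e1.tsum_sub e0, tsum_mul_left, tsum_mul_left] at hz
  linear_combination hz

lemma tendsto_inv_add_natCast (z : ℂ) : Tendsto (fun n : ℕ => (z + n)⁻¹) atTop (𝓝 0) := by
  rw [tendsto_zero_iff_norm_tendsto_zero]
  simp only [norm_inv]
  refine tendsto_inv_atTop_zero.comp ?_
  refine tendsto_atTop_mono (fun n => le_norm_add_natCast le_rfl n) ?_
  exact tendsto_atTop_add_const_right _ _ tendsto_natCast_atTop_atTop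

/-- Comparison of the ratios of consecutive terms. It supplies a majorant with fixed real parameters
for dominated convergence. -/
lemma norm_term_le_of_le {a b c e f : ℂ} {A B C E F : ℝ} (ha : ‖a‖ ≤ A) (hb : ‖b‖ ≤ B)
    (hc : ‖c‖ ≤ C) (he : E ≤ e.re) (hE : 0 < E) (hf : F ≤ f.re) (hF : 0 < F) (k : ℕ) :
    ‖term (a, b, c, e, f) k‖ ≤ ‖term ((A : ℂ), (B : ℂ), (C : ℂ), (E : ℂ), (F : ℂ)) k‖ := by
  induction k with
  | zero => simp [term_zero]
  | succ k ih =>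
    rw [term_succ, term_succ, norm_mul, norm_mul]
    have up : ∀ {z : ℂ} {Z : ℝ}, ‖z‖ ≤ Z → ‖z + k‖ ≤ ‖(Z : ℂ) + k‖ := by
      intro z Z hz
      have h0 : 0 ≤ Z + k := add_nonneg ((norm_nonneg _).trans hz) k.cast_nonneg
      have : ‖(Z : ℂ) + k‖ = Z + k := by
        rw [← Complex.ofReal_natCast, ← Complex.ofReal_add, Complex.norm_real, Real.norm_of_nonneg h0]
      rw [this]
      refine (norm_add_le _ _).trans ?_
      rw [Complex.norm_natCast]; linarith
    have lo : ∀ {z : ℂ} {Z : ℝ}, Z ≤ z.re → 0 < Z → 0 < ‖(Z : ℂ) + k‖ ∧ ‖(Z : ℂ) + k‖ ≤ ‖z + k‖ := by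
      intro z Z hz hZ
      have h0 : 0 < Z + k := add_pos_of_pos_of_nonneg hZ k.cast_nonneg
      have : ‖(Z : ℂ) + k‖ = Z + k := by
        rw [← Complex.ofReal_natCast, ← Complex.ofReal_add, Complex.norm_real,
          Real.norm_of_nonneg h0.le]
      rw [this]
      exact ⟨h0, (by linarith [le_norm_add_natCast hz k])⟩
    refine mul_le_mul ih ?_ (norm_nonneg _) (norm_nonneg _)
    simp only [norm_div, norm_mul]
    have k1 : 0 < ‖(k : ℂ) + 1‖ := norm_pos_iff.2 (Nat.cast_add_one_ne_zero k)
    have l1 := (lo he hE).1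
    have l2 := (lo hf hF).1
    have u1 := up ha
    have u2 := up hb
    have u3 := up hc
    have u4 := (lo he hE).2
    have u5 := (lo hf hF).2
    gcongr

/-- When the lower parameter tends to infinity only the term k = 0 survives. -/
lemma gauss_tendsto (a b c : ℂ) :
    Tendsto (fun n : ℕ => ∑' k, term (a, b, 1, c + n, 1) k) atTop (𝓝 1) := by
  -- This choice gives the majorant series excess exactly 1.
  set X : ℝ := ‖a‖ + ‖b‖ + 1 with hX
  have hX0 : 0 < X := by positivity
  have hbound : Summable fun k => ‖term ((‖a‖ : ℂ), (‖b‖ : ℂ), ((1 : ℝ) : ℂ), (X : ℂ), ((1 : ℝ) : ℂ)) k‖ := by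
    refine summable_norm_term (nonPole_of_re_pos (by simpa using hX0))
      (nonPole_of_re_pos (by simp)) ?_
    simp only [excess, hX, Complex.sub_re, Complex.add_re, Complex.ofReal_re]; linarith
  have hev : ∀ᶠ n : ℕ in atTop, ∀ k, ‖term (a, b, 1, c + n, 1) k‖ ≤
      ‖term ((‖a‖ : ℂ), (‖b‖ : ℂ), ((1 : ℝ) : ℂ), (X : ℂ), ((1 : ℝ) : ℂ)) k‖ := by
    filter_upwards [tendsto_natCast_atTop_atTop.eventually_ge_atTop (X - c.re)] with n hn k
    refine norm_term_le_of_le le_rfl le_rfl (by simp) ?_ hX0 (by simp) one_pos k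
    simp only [Complex.add_re, Complex.natCast_re]; linarith
  have hpt : ∀ k, Tendsto (fun n : ℕ => term (a, b, 1, c + n, 1) k) atTop
      (𝓝 (if k = 0 then 1 else 0)) := by
    intro k
    induction k with
    | zero => simp [term_zero]
    | succ k ih =>
      simp only [term_succ, Nat.succ_ne_zero, if_false]
      have := ih.mul ((tendsto_inv_add_natCast (c + k)).const_mul
        ((a + k) * (b + k) * (1 + k) / ((1 + k) * (k + 1))))
      simp only [mul_zero] at this
      refine this.congr fun n => ?_
      congr 1
      rw [add_right_comm c (k : ℂ) n]; simp only [div_eq_mul_inv, mul_inv]; ring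
  have := tendsto_tsum_of_dominated_convergence hbound hpt hev
  simpa using this

/-- **Gauss's summation theorem.** -/
theorem tsum_gauss {a b c : ℂ} (hc : NonPole c) (hca : NonPole (c - a)) (hcb : NonPole (c - b))
    (hs : 0 < (c - a - b).re) :
    ∑' k, term (a, b, 1, c, 1) k =
      Complex.Gamma c * Complex.Gamma (c - a - b) /
        (Complex.Gamma (c - a) * Complex.Gamma (c - b)) := by
  have hcab : NonPole (c - a - b) := nonPole_of_re_pos hs
  -- The lower parameter is moved to infinity along c + n, where the sum tends to 1; the recurrence
  -- carries this value back to n = 0.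
  have := eq_of_tendsto_of_recurrence hca hcb hc hcab (by ring)
    (D := fun n => ∑' k, term (a, b, 1, c + n, 1) k) (l := 1) ?_ (gauss_tendsto a b c)
  · simp only [Nat.cast_zero, add_zero] at this
    have g1 := nonPole_iff.1 hc
    have g2 := nonPole_iff.1 hcab
    have g3 := nonPole_iff.1 hca
    have g4 := nonPole_iff.1 hcb
    field_simp at this ⊢
    linear_combination -this
  · intro n
    have := gauss_contiguous a b (hc.add_natCast n) (by
      simp only [Complex.sub_re, Complex.add_re, Complex.natCast_re] at hs ⊢
      have : (0 : ℝ) ≤ n := n.cast_nonneg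
      linarith)
    push_cast
    rw [← add_assoc]
    linear_combination this

end Hyp32

namespace Hyp32

open Filter Topology

/-! ### The Thomae–Kummer two-term relation -/

/-- Certificate for comparing coefficients in ₂F₁(a, b; e; z) = (1 − z)^(e−a−b) ₂F₁(e−a, e−b; e; z).
The left side is the recurrence in k = i + j wanted for the Cauchy product; on the right, the
coefficients depend on j alone and match the recurrence of the second factor. -/
lemma euler_coeff_aux (a b e : ℂ) (i j : ℕ) :
    ((i + j + 1 : ℕ) : ℂ) * (e + (i + j : ℕ)) * (poch (a + b - e) (i + 1) / ((i + 1).factorial : ℂ)) -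
      (a + (i + j : ℕ)) * (b + (i + j : ℕ)) * (poch (a + b - e) i / (i.factorial : ℂ)) =
    (j : ℂ) * (e + j - 1) * (poch (a + b - e) (i + 1) / ((i + 1).factorial : ℂ)) -
      (e - a + j) * (e - b + j) * (poch (a + b - e) i / (i.factorial : ℂ)) := by
  have h1 : (i : ℂ) + 1 ≠ 0 := Nat.cast_add_one_ne_zero i
  have h2 : (i.factorial : ℂ) ≠ 0 := Nat.cast_ne_zero.2 i.factorial_ne_zero
  rw [poch_succ, Nat.factorial_succ]
  push_cast
  field_simp
  ring

lemma coeff_succ (a b : ℂ) {e : ℂ} (he : NonPole e) (j : ℕ) :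
    ((j + 1 : ℕ) : ℂ) * (e + j) * (poch a (j + 1) * poch b (j + 1) /
      (poch e (j + 1) * ((j + 1).factorial : ℂ))) =
    (a + j) * (b + j) * (poch a j * poch b j / (poch e j * (j.factorial : ℂ))) := by
  have h1 : (j : ℂ) + 1 ≠ 0 := Nat.cast_add_one_ne_zero j
  have h2 : (j.factorial : ℂ) ≠ 0 := Nat.cast_ne_zero.2 j.factorial_ne_zero
  have h3 := he.poch_ne_zero j
  have h4 := he.add_natCast_ne j
  rw [poch_succ, poch_succ, poch_succ, Nat.factorial_succ]
  push_cast
  field_simp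

/-- Coefficients in Euler's transformation of the Gauss hypergeometric function. -/
lemma sum_antidiagonal_euler (a b : ℂ) {e : ℂ} (he : NonPole e) (k : ℕ) :
    ∑ ij ∈ Finset.HasAntidiagonal.antidiagonal k, poch (a + b - e) ij.1 / (ij.1.factorial : ℂ) *
        (poch (e - a) ij.2 * poch (e - b) ij.2 / (poch e ij.2 * (ij.2.factorial : ℂ))) =
      poch a k * poch b k / (poch e k * (k.factorial : ℂ)) := by
  set X : ℕ → ℂ := fun i => poch (a + b - e) i / (i.factorial : ℂ) with hX
  set Y : ℕ → ℂ := fun j => poch (e - a) j * poch (e - b) j / (poch e j * (j.factorial : ℂ)) with hY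
  induction k with
  | zero => simp [poch_zero]
  | succ k ih =>
    have hk : (k : ℂ) + 1 ≠ 0 := Nat.cast_add_one_ne_zero k
    have hek := he.add_natCast_ne k
    have hX0 : X 0 = 1 := by simp [hX, poch_zero]
    have hYs : ∀ j : ℕ, ((j + 1 : ℕ) : ℂ) * (e + j) * Y (j + 1) = (e - a + j) * (e - b + j) * Y j :=
      fun j => coeff_succ (e - a) (e - b) he j
    -- split the sum at `i = 0`
    have split : ∀ g : ℕ × ℕ → ℂ, ∑ ij ∈ Finset.HasAntidiagonal.antidiagonal (k + 1), g ij =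
        g (0, k + 1) + ∑ ij ∈ Finset.HasAntidiagonal.antidiagonal k, g (ij.1 + 1, ij.2) :=
      fun g => Finset.Nat.sum_antidiagonal_succ
    have split' : ∀ g : ℕ × ℕ → ℂ, ∑ ij ∈ Finset.HasAntidiagonal.antidiagonal (k + 1), g ij =
        g (k + 1, 0) + ∑ ij ∈ Finset.HasAntidiagonal.antidiagonal k, g (ij.1, ij.2 + 1) :=
      fun g => Finset.Nat.sum_antidiagonal_succ'
    -- The weight j(e + j − 1) vanishes at j = 0, so shifting j by one and using the recurrence of Y
    -- turns one sum into the other. Together with the certificate summed over the antidiagonal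
    -- (`e2`), this gives the Cauchy product the first-order recurrence of the coefficients of
    -- ₂F₁(a, b; e).
    have e1 : ∑ ij ∈ Finset.HasAntidiagonal.antidiagonal (k + 1), (ij.2 : ℂ) * (e + ij.2 - 1) * (X ij.1 * Y ij.2) =
        ∑ ij ∈ Finset.HasAntidiagonal.antidiagonal k, (e - a + ij.2) * (e - b + ij.2) * (X ij.1 * Y ij.2) := by
      rw [split']
      simp only [Nat.cast_zero, zero_mul, zero_add]
      refine Finset.sum_congr rfl fun ij _ => ?_
      have := hYs ij.2
      push_cast at this ⊢
      linear_combination X ij.1 * this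
    have e2 : ∑ ij ∈ Finset.HasAntidiagonal.antidiagonal k, (((k : ℂ) + 1) * (e + k) * (X (ij.1 + 1) * Y ij.2) -
        (ij.2 : ℂ) * (e + ij.2 - 1) * (X (ij.1 + 1) * Y ij.2)) =
        ∑ ij ∈ Finset.HasAntidiagonal.antidiagonal k, ((a + k) * (b + k) * (X ij.1 * Y ij.2) -
          (e - a + ij.2) * (e - b + ij.2) * (X ij.1 * Y ij.2)) := by
      refine Finset.sum_congr rfl fun ij hij => ?_
      have h := euler_coeff_aux a b e ij.1 ij.2
      rw [Finset.HasAntidiagonal.mem_antidiagonal.1 hij] at h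
      push_cast at h
      simp only [hX]
      linear_combination Y ij.2 * h
    rw [Finset.sum_sub_distrib, Finset.sum_sub_distrib, ← Finset.mul_sum, ← Finset.mul_sum, ih] at e2
    rw [split] at e1 ⊢
    have h3 := coeff_succ a b he k
    push_cast at e1 h3
    have : ((k : ℂ) + 1) * (e + k) * (X 0 * Y (k + 1) +
        ∑ ij ∈ Finset.HasAntidiagonal.antidiagonal k, X (ij.1 + 1) * Y ij.2) =
        ((k : ℂ) + 1) * (e + k) * (poch a (k + 1) * poch b (k + 1) /
          (poch e (k + 1) * ((k + 1).factorial : ℂ))) := by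
      rw [h3]
      linear_combination e1 + e2
    exact mul_left_cancel₀ (mul_ne_zero hk hek) this

/-- Here (1+M)_k / k! is a binomial coefficient, a product of M factors (i+1+k)/(i+1) ≤ k + 1. -/
lemma norm_poch_one_add_le (M k : ℕ) :
    ‖poch (1 + M) k‖ ≤ (k.factorial : ℝ) * ((k : ℝ) + 1) ^ M := by
  induction M with
  | zero => simp [poch]
  | succ M ih =>
    have h := poch_mul_add (1 + M : ℂ) k
    have h1 : (1 + M : ℂ) ≠ 0 := by rw [add_comm]; exact Nat.cast_add_one_ne_zero M
    have h2 : poch (1 + (M + 1 : ℕ)) k = poch (1 + M) k * ((1 + M + k) / (1 + M)) := by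
      have e : (1 + ((M + 1 : ℕ) : ℂ)) = 1 + M + 1 := by push_cast; ring
      rw [e, mul_div_assoc', h]; field_simp
    have h3 : ‖(1 + M + k : ℂ) / (1 + M)‖ ≤ (k : ℝ) + 1 := by
      have e1 : (1 + M + k : ℂ) = ((1 + M + k : ℕ) : ℂ) := by push_cast; ring
      have e2 : (1 + M : ℂ) = ((1 + M : ℕ) : ℂ) := by push_cast; ring
      rw [e1, e2, norm_div, Complex.norm_natCast, Complex.norm_natCast, div_le_iff₀ (by positivity)]
      push_cast
      have : (0 : ℝ) ≤ M := M.cast_nonneg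
      have : (0 : ℝ) ≤ k := k.cast_nonneg
      nlinarith
    rw [h2, norm_mul, pow_succ, ← mul_assoc]
    gcongr

/-- An extra lower parameter 1 + M, with M large, makes the excess positive and the terms bounded;
undoing it costs the factor (1+M)_k / k!, of polynomial growth. -/
lemma exists_norm_coeff_le (a b : ℂ) {e : ℂ} (he : NonPole e) : ∃ (C : ℝ) (M : ℕ), 0 ≤ C ∧
    ∀ k : ℕ, ‖poch a k * poch b k / (poch e k * (k.factorial : ℂ))‖ ≤ C * ((k : ℝ) + 1) ^ M := by
  obtain ⟨M, hM⟩ := exists_nat_gt (a.re + b.re - e.re)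
  have h1M : NonPole (1 + M : ℂ) := nonPole_of_re_pos (by
    simp only [Complex.add_re, Complex.one_re, Complex.natCast_re]; positivity)
  obtain ⟨C, hC⟩ := norm_term_le (p := (a, b, 1, e, 1 + M)) he h1M le_rfl (by
    simp only [excess, Complex.sub_re, Complex.add_re, Complex.one_re, Complex.natCast_re]
    linarith)
  have hC0 : 0 ≤ C := by simpa using (norm_nonneg _).trans (hC 0)
  refine ⟨C, M, hC0, fun k => ?_⟩
  have hfac : (k.factorial : ℂ) ≠ 0 := Nat.cast_ne_zero.2 k.factorial_ne_zero
  have hfac' : (0 : ℝ) < k.factorial := Nat.cast_pos.2 k.factorial_pos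
  have hM0 := h1M.poch_ne_zero k
  have heq : poch a k * poch b k / (poch e k * (k.factorial : ℂ)) =
      term (a, b, 1, e, 1 + M) k * (poch (1 + M) k / (k.factorial : ℂ)) := by
    have h1 := poch_one k
    have h2 := he.poch_ne_zero k
    simp only [term]
    change _ = poch a k * poch b k * poch 1 k / (poch e k * poch (1 + M) k * (k.factorial : ℂ)) * _
    rw [h1]
    field_simp
  rw [heq, norm_mul, norm_div, Complex.norm_natCast]
  have h4 : ‖term (a, b, 1, e, 1 + M) k‖ ≤ C := by
    refine (hC k).trans ?_
    have : ((k : ℝ) + 1) ^ (-1 : ℝ) ≤ 1 := by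
      rw [Real.rpow_neg_one]
      exact inv_le_one_of_one_le₀ (by linarith [(Nat.cast_nonneg k : (0 : ℝ) ≤ k)])
    exact mul_le_of_le_one_right hC0 this
  have h5 : ‖poch (1 + M) k‖ / (k.factorial : ℝ) ≤ ((k : ℝ) + 1) ^ M := by
    rw [div_le_iff₀ hfac', mul_comm]; exact norm_poch_one_add_le M k
  gcongr

lemma term_eq_coeff (a b c e f : ℂ) (k : ℕ) : term (a, b, c, e, f) k =
    poch a k * poch b k / (poch e k * (k.factorial : ℂ)) * (poch c k / poch f k) := by
  simp only [term, poch, div_eq_mul_inv, mul_inv]; ring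

/-- The two coefficient sequences grow polynomially, while (c)_k / (f)_k decays like any prescribed
power of k once Re f is large. -/
lemma summable_double (a b c : ℂ) {e : ℂ} (he : NonPole e) : ∃ N : ℝ, ∀ f : ℂ, N < f.re →
    Summable fun ij : ℕ × ℕ => poch (a + b - e) ij.1 / (ij.1.factorial : ℂ) *
        (poch (e - a) ij.2 * poch (e - b) ij.2 / (poch e ij.2 * (ij.2.factorial : ℂ))) *
        (poch c (ij.2 + ij.1) / poch f (ij.2 + ij.1)) := by
  have hone : NonPole 1 := nonPole_of_re_pos (by simp)
  obtain ⟨C₁, M₁, hC₁, h₁⟩ := exists_norm_coeff_le (a + b - e) 1 hone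
  obtain ⟨C₂, M₂, hC₂, h₂⟩ := exists_norm_coeff_le (e - a) (e - b) he
  -- The power M₁ + M₂ cancels the polynomial growth, and the remaining (i+j+1)^(−4) is at most
  -- (i+1)^(−2) (j+1)^(−2).
  refine ⟨max 0 (c.re + M₁ + M₂ + 4), fun f hf => ?_⟩
  have hf0 : NonPole f := nonPole_of_re_pos ((le_max_left _ _).trans_lt hf)
  have hfc := (le_max_right _ _).trans_lt hf
  obtain ⟨C₃, h₃⟩ := norm_term_le (p := (c, 1, 1, f, 1)) (q := M₁ + M₂ + 4) hf0 hone
    (by have h1 : (0 : ℝ) ≤ M₁ := M₁.cast_nonneg; have h2 : (0 : ℝ) ≤ M₂ := M₂.cast_nonneg; linarith) (by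
      simp only [excess, Complex.sub_re, Complex.add_re, Complex.one_re]; linarith)
  have hC₃ : 0 ≤ C₃ := by simpa using (norm_nonneg _).trans (h₃ 0)
  have hs : Summable fun k : ℕ => ((k : ℝ) + 1) ^ (-2 : ℝ) := by
    simpa using summable_rpow_shift (q := 2) (by norm_num) 1
  have hprod : Summable fun ij : ℕ × ℕ =>
      C₁ * C₂ * C₃ * (((ij.1 : ℝ) + 1) ^ (-2 : ℝ) * ((ij.2 : ℝ) + 1) ^ (-2 : ℝ)) :=
    (hs.mul_of_nonneg hs (fun _ => by positivity) (fun _ => by positivity)).mul_left _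
  refine Summable.of_norm_bounded hprod ?_
  rintro ⟨i, j⟩
  have b1 := h₁ i
  have b2 := h₂ j
  have b3 := h₃ (j + i)
  have e1 : poch (a + b - e) i * poch 1 i / (poch 1 i * (i.factorial : ℂ)) =
      poch (a + b - e) i / (i.factorial : ℂ) := by
    have := hone.poch_ne_zero i
    field_simp
  have e3 : term (c, 1, 1, f, 1) (j + i) = poch c (j + i) / poch f (j + i) := by
    have h1 := hone.poch_ne_zero (j + i)
    have h2 := hf0.poch_ne_zero (j + i)
    have h3 : ((j + i).factorial : ℂ) = poch 1 (j + i) := (poch_one _).symm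
    rw [term_eq_coeff, h3]
    field_simp
  rw [e1] at b1
  rw [e3] at b3
  simp only [norm_mul]
  set x : ℝ := (i : ℝ) + 1
  set y : ℝ := (j : ℝ) + 1
  set z : ℝ := (((j + i : ℕ) : ℕ) : ℝ) + 1 with hz
  have hx1 : 1 ≤ x := by simp [x]
  have hy1 : 1 ≤ y := by simp [y]
  have hxz : x ≤ z := by simp [x, z]
  have hyz : y ≤ z := by simp [y, z]
  have hz0 : 0 < z := by linarith
  calc _ ≤ (C₁ * x ^ M₁) * (C₂ * y ^ M₂) * (C₃ * z ^ (-((M₁ : ℝ) + M₂ + 4))) := by gcongr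
    _ ≤ (C₁ * z ^ M₁) * (C₂ * z ^ M₂) * (C₃ * z ^ (-((M₁ : ℝ) + M₂ + 4))) := by gcongr
    _ = C₁ * C₂ * C₃ * (z ^ (-2 : ℝ) * z ^ (-2 : ℝ)) := by
      rw [← Real.rpow_natCast, ← Real.rpow_natCast]
      have : z ^ (-((M₁ : ℝ) + M₂ + 4)) =
          z ^ (-(M₁ : ℝ)) * z ^ (-(M₂ : ℝ)) * (z ^ (-2 : ℝ) * z ^ (-2 : ℝ)) := by
        rw [← Real.rpow_add hz0, ← Real.rpow_add hz0, ← Real.rpow_add hz0]; congr 1; ring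
      rw [this, Real.rpow_neg hz0.le, Real.rpow_neg hz0.le]
      have p1 : z ^ (M₁ : ℝ) ≠ 0 := (Real.rpow_pos_of_pos hz0 _).ne'
      have p2 : z ^ (M₂ : ℝ) ≠ 0 := (Real.rpow_pos_of_pos hz0 _).ne'
      field_simp
    _ ≤ C₁ * C₂ * C₃ * (x ^ (-2 : ℝ) * y ^ (-2 : ℝ)) := by
      have h5 : z ^ (-2 : ℝ) ≤ x ^ (-2 : ℝ) :=
        Real.rpow_le_rpow_of_nonpos (by linarith) hxz (by norm_num)
      have h6 : z ^ (-2 : ℝ) ≤ y ^ (-2 : ℝ) :=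
        Real.rpow_le_rpow_of_nonpos (by linarith) hyz (by norm_num)
      gcongr

lemma tsum_prod_eq_tsum_antidiagonal {g : ℕ × ℕ → ℂ} (hg : Summable g) :
    ∑' ij, g ij = ∑' k, ∑ ij ∈ Finset.HasAntidiagonal.antidiagonal k, g ij := by
  have h := (Finset.HasAntidiagonal.sigmaAntidiagonalEquivProd (A := ℕ)).summable_iff.2 hg
  rw [← (Finset.HasAntidiagonal.sigmaAntidiagonalEquivProd (A := ℕ)).tsum_eq g]
  refine (h.tsum_sigma' fun n => (hasSum_fintype _).summable).trans (tsum_congr fun k => ?_)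
  rw [tsum_fintype]
  exact Finset.sum_coe_sort (Finset.HasAntidiagonal.antidiagonal k) g

lemma tsum_prod_eq_tsum_tsum_swap {g : ℕ × ℕ → ℂ} (hg : Summable g) :
    ∑' ij, g ij = ∑' j, ∑' i, g (i, j) := by
  rw [← (Equiv.prodComm ℕ ℕ).tsum_eq g]
  exact ((Equiv.prodComm ℕ ℕ).summable_iff.2 hg).tsum_prod

/-- The coefficient (a)_k (b)_k / ((e)_k k!) is replaced by the Cauchy product from Euler's
transformation, and the summations are exchanged. The inner sum is the Gauss series with upper
parameters a + b − e and c + j and lower parameter f + j; its value depends on j only through the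
rising factorials of the transformed series. -/
lemma thomae_series (a b c : ℂ) {e : ℂ} (he : NonPole e) : ∃ N : ℝ, ∀ f : ℂ, N < f.re →
    ∑' k, term (a, b, c, e, f) k =
      Complex.Gamma f * Complex.Gamma (e + f - a - b - c) /
        (Complex.Gamma (f - c) * Complex.Gamma (e + f - a - b)) *
        ∑' k, term (e - a, e - b, c, e, e + f - a - b) k := by
  obtain ⟨N, hN⟩ := summable_double a b c he
  refine ⟨max N (max 0 (max c.re (max (a + b - e).re (a + b + c - e).re))), fun f hf => ?_⟩
  simp only [max_lt_iff] at hf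
  obtain ⟨hf1, hf2, hf3, hf4, hf5⟩ := hf
  simp only [Complex.sub_re, Complex.add_re] at hf4 hf5
  have hsum := hN f hf1
  have hfp : NonPole f := nonPole_of_re_pos hf2
  have hfc : NonPole (f - c) := nonPole_of_re_pos (by simp only [Complex.sub_re]; linarith)
  have hfw : NonPole (e + f - a - b) := nonPole_of_re_pos (by
    simp only [Complex.sub_re, Complex.add_re]; linarith)
  have left : ∑' k, term (a, b, c, e, f) k = ∑' ij : ℕ × ℕ,
      poch (a + b - e) ij.1 / (ij.1.factorial : ℂ) *
        (poch (e - a) ij.2 * poch (e - b) ij.2 / (poch e ij.2 * (ij.2.factorial : ℂ))) *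
        (poch c (ij.2 + ij.1) / poch f (ij.2 + ij.1)) := by
    rw [tsum_prod_eq_tsum_antidiagonal hsum]
    refine tsum_congr fun k => ?_
    rw [term_eq_coeff, ← sum_antidiagonal_euler a b he k, Finset.sum_mul]
    refine Finset.sum_congr rfl fun ij hij => ?_
    have h := Finset.HasAntidiagonal.mem_antidiagonal.1 hij
    rw [add_comm] at h
    rw [h]
  rw [left, tsum_prod_eq_tsum_tsum_swap hsum, ← tsum_mul_left]
  refine tsum_congr fun j => ?_
  have hg := tsum_gauss (a := a + b - e) (b := c + j) (hfp.add_natCast j)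
    (by have := hfw.add_natCast j; rwa [show f + j - (a + b - e) = e + f - a - b + j by ring])
    (by rwa [show f + j - (c + j) = f - c by ring])
    (by
      rw [show f + j - (a + b - e) - (c + j) = e + f - a - b - c by ring]
      simp only [Complex.sub_re, Complex.add_re]; linarith)
  rw [show f + j - (a + b - e) - (c + j) = e + f - a - b - c by ring,
    show f + j - (c + j) = f - c by ring, show f + j - (a + b - e) = e + f - a - b + j by ring,
    Gamma_add_natCast hfp, Gamma_add_natCast hfw] at hg
  have hone : NonPole 1 := nonPole_of_re_pos (by simp)
  have ht : ∀ i, poch (a + b - e) i / (i.factorial : ℂ) *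
        (poch (e - a) j * poch (e - b) j / (poch e j * (j.factorial : ℂ))) *
        (poch c (j + i) / poch f (j + i)) =
      (poch (e - a) j * poch (e - b) j / (poch e j * (j.factorial : ℂ))) *
        (poch c j / poch f j) * term (a + b - e, c + j, 1, f + j, 1) i := by
    intro i
    have h1 := hone.poch_ne_zero i
    rw [poch_add, poch_add, term_eq_coeff, div_self h1]
    simp only [div_eq_mul_inv, mul_inv]
    ring
  simp only [ht]
  rw [tsum_mul_left, hg, term_eq_coeff]
  have h1 := hfp.poch_ne_zero j
  have h2 := hfw.poch_ne_zero j
  have h3 := nonPole_iff.1 hfc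
  have h4 := nonPole_iff.1 hfw
  field_simp

/-! ### Continuation of the two-term relation -/

lemma countable_not_nonPole {g : ℂ → ℂ} (hg : Function.Injective g) :
    {t | ¬ NonPole (g t)}.Countable := by
  have h : {t | ¬ NonPole (g t)} ⊆ g ⁻¹' Set.range (fun k : ℕ => -(k : ℂ)) := by
    intro t ht
    simp only [NonPole, Set.mem_ofPred_eq, not_forall, not_not] at ht
    obtain ⟨k, hk⟩ := ht
    exact ⟨k, hk.symm⟩
  exact ((Set.countable_range _).preimage_of_injOn hg.injOn).mono h

lemma differentiableOn_Gamma_comp {g : ℂ → ℂ} (hg : Differentiable ℂ g) {U : Set ℂ}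
    (h : ∀ t ∈ U, NonPole (g t)) : DifferentiableOn ℂ (fun t => Complex.Gamma (g t)) U := fun t ht =>
  ((Complex.differentiableAt_Gamma _ (h t ht)).comp t (hg t)).differentiableWithinAt

lemma IsHypergeometric.differentiableOn_comp {F : Params → ℂ} (hF : IsHypergeometric F)
    {g : ℂ → Params} (hg : Differentiable ℂ g) {U : Set ℂ} (h : ∀ t ∈ U, g t ∈ domain) :
    DifferentiableOn ℂ (fun t => F (g t)) U :=
  hF.holomorphic.comp hg.differentiableOn h

/-- The Thomae–Kummer two-term relation. -/
theorem IsHypergeometric.thomae {F : Params → ℂ} (hF : IsHypergeometric F) {a b c e f : ℂ}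
    (he : NonPole e) (hf : NonPole f) (hs : NonPole (e + f - a - b - c)) (hfc : NonPole (f - c))
    (hsc : NonPole (e + f - a - b)) :
    F (a, b, c, e, f) = Complex.Gamma f * Complex.Gamma (e + f - a - b - c) /
        (Complex.Gamma (f - c) * Complex.Gamma (e + f - a - b)) *
        F (e - a, e - b, c, e, e + f - a - b) := by
  set U : Set ℂ := {f | NonPole f} ∩ ({f | NonPole (e + f - a - b - c)} ∩
    ({f | NonPole (f - c)} ∩ {f | NonPole (e + f - a - b)})) with hU
  have open1 : ∀ g : ℂ → ℂ, Continuous g → IsOpen {f | NonPole (g f)} :=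
    fun g hg => isOpen_nonPole.preimage hg
  have hUo : IsOpen U := (open1 _ (by fun_prop)).inter ((open1 _ (by fun_prop)).inter
    ((open1 _ (by fun_prop)).inter (open1 _ (by fun_prop))))
  have hUc : Uᶜ.Countable := by
    simp only [hU, Set.compl_inter]
    refine (countable_not_nonPole (g := fun f => f) ?_).union
      ((countable_not_nonPole (g := fun f => e + f - a - b - c) ?_).union
      ((countable_not_nonPole (g := fun f => f - c) ?_).union
      (countable_not_nonPole (g := fun f => e + f - a - b) ?_))) <;>
    · intro x y hxy
      simpa using hxy
  have ex1 : ∀ f, excess (e - a, e - b, c, e, e + f - a - b) = f - c := fun f => by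
    simp only [excess]; ring
  obtain ⟨N, hN⟩ := thomae_series a b c he
  -- Continuation is in f alone. To the right of α both series converge, their excesses being e + f
  -- − a − b − c and f − c.
  refine eqOn_of_eq_on_real hUo hUc (f := fun f => F (a, b, c, e, f))
    (g := fun f => Complex.Gamma f * Complex.Gamma (e + f - a - b - c) /
        (Complex.Gamma (f - c) * Complex.Gamma (e + f - a - b)) *
        F (e - a, e - b, c, e, e + f - a - b))
    (α := max N (max (a + b + c - e).re c.re))
    (β := max N (max (a + b + c - e).re c.re) + 1) ?_ ?_ (by linarith) ?_ f ⟨hf, hs, hfc, hsc⟩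
  · exact hF.differentiableOn_comp (g := fun f => (a, b, c, e, f)) (by fun_prop)
      fun f hf => ⟨he, hf.1, hf.2.1⟩
  · refine DifferentiableOn.mul (DifferentiableOn.div (DifferentiableOn.mul
      (differentiableOn_Gamma_comp (by fun_prop) fun t ht => ht.1)
      (differentiableOn_Gamma_comp (by fun_prop) fun t ht => ht.2.1)) (DifferentiableOn.mul
      (differentiableOn_Gamma_comp (by fun_prop) fun t ht => ht.2.2.1)
      (differentiableOn_Gamma_comp (by fun_prop) fun t ht => ht.2.2.2)) ?_) ?_
    · exact fun t ht => mul_ne_zero (nonPole_iff.1 ht.2.2.1) (nonPole_iff.1 ht.2.2.2)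
    · exact hF.differentiableOn_comp (g := fun f => (e - a, e - b, c, e, e + f - a - b))
        (by fun_prop) fun f hf => ⟨he, hf.2.2.2, by rw [ex1]; exact hf.2.2.1⟩
  · intro t ht h1 _
    simp only [max_lt_iff] at h1
    obtain ⟨h1, h2, h3⟩ := h1
    simp only [Complex.sub_re, Complex.add_re] at h2
    have s1 := (hF.hasSum (a, b, c, e, (t : ℂ)) ⟨he, ht.1, ht.2.1⟩ (by
      simp only [excess, Complex.sub_re, Complex.add_re, Complex.ofReal_re]; linarith)).tsum_eq
    have s2 := (hF.hasSum (e - a, e - b, c, e, e + (t : ℂ) - a - b)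
      ⟨he, ht.2.2.2, by rw [ex1]; exact ht.2.2.1⟩ (by
      rw [ex1]; simp only [Complex.sub_re, Complex.ofReal_re]; linarith)).tsum_eq
    change F (a, b, c, e, (t : ℂ)) = _ * F (e - a, e - b, c, e, e + (t : ℂ) - a - b)
    rw [← s1, ← s2]
    exact hN t (by simpa using h1)

end Hyp32

namespace Hyp32

open Filter Topology

/-! ### Dixon's theorem with unit difference of parameters -/

/-- Since (y)_k / (y+1)_k = y / (y+k), a factor y + k removes the pair y, y + 1 and leaves a Gauss
term. -/
lemma term_lower_cancel (a b y : ℂ) {e : ℂ} (hy : NonPole (y + 1)) (k : ℕ) :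
    (y + k) * term (a, y, b, e, y + 1) k = y * term (a, 1, b, e, 1) k := by
  have h := poch_mul_add y k
  have h1 := hy.poch_ne_zero k
  have h2 : ((ascPochhammer ℂ k).eval 1 : ℂ) ≠ 0 := (nonPole_of_re_pos (by simp)).poch_ne_zero k
  have h3 : (ascPochhammer ℂ k).eval y * (y + k) = y * (ascPochhammer ℂ k).eval (y + 1) := h
  simp only [term]
  rw [mul_div_assoc', mul_div_assoc', mul_comm _ ((ascPochhammer ℂ k).eval (y + 1))]
  simp only [div_eq_mul_inv, mul_inv]
  calc _ = ((ascPochhammer ℂ k).eval y * (y + k)) * ((ascPochhammer ℂ k).eval (y + 1))⁻¹ *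
        ((ascPochhammer ℂ k).eval a * (ascPochhammer ℂ k).eval b *
        (((ascPochhammer ℂ k).eval e)⁻¹ * (k.factorial : ℂ)⁻¹)) := by ring
    _ = ((ascPochhammer ℂ k).eval 1 * ((ascPochhammer ℂ k).eval 1)⁻¹) * y *
        ((ascPochhammer ℂ k).eval a * (ascPochhammer ℂ k).eval b *
        (((ascPochhammer ℂ k).eval e)⁻¹ * (k.factorial : ℂ)⁻¹)) := by
      rw [h3, mul_inv_cancel₀ h2, mul_assoc y, mul_inv_cancel₀ h1]; ring
    _ = _ := by ring

/-- The well-poised series of Dixon's theorem. -/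
noncomputable abbrev dixonParams (y b : ℂ) : Params := (2 * y, y, b, 2 * y + 1 - b, y + 1)

/-- Expressed through the terms t_k with parameter b − 1, the difference of the two sides has
summand (y+k)² t_k, because (1+y−b)² + (b−1+k)(1+2y−b+k) = (y+k)². This summand telescopes. -/
lemma dixon_contiguous {y b : ℂ} (hy : NonPole (y + 1)) (hyb : NonPole (1 + 2 * y - b))
    (hb : NonPole (1 - b)) (hs : 0 < (2 - 2 * b).re) :
    (1 + y - b) ^ 2 * ∑' k, term (dixonParams y (b - 1)) k =
      (1 - b) * (1 + 2 * y - b) * ∑' k, term (dixonParams y b) k := by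
  have e1 : 2 * y + 1 - (b - 1) = 1 + 2 * y - b + 1 := by ring
  have e2 : 2 * y + 1 - b = 1 + 2 * y - b := by ring
  have hb0 : b - 1 ≠ 0 := fun h => hb.ne_zero (by linear_combination -h)
  have hone : NonPole 1 := nonPole_of_re_pos (by simp)
  simp only [dixonParams, e1, e2]
  simp only [Complex.sub_re, Complex.mul_re, Complex.re_ofNat, Complex.im_ofNat, zero_mul,
    sub_zero] at hs
  have h0 : Summable (term (2 * y, y, b, 1 + 2 * y - b, y + 1)) := summable_term hyb hy (by
    simp [excess]; linarith)
  have h1 : Summable (term (2 * y, y, b - 1, 1 + 2 * y - b + 1, y + 1)) :=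
    summable_term hyb.add_one hy (by simp [excess]; linarith)
  set t : ℕ → ℂ := fun k => term (2 * y, y, b - 1, 1 + 2 * y - b + 1, y + 1) k with ht
  have hrel : ∀ k, (b - 1) * (1 + 2 * y - b) * term (2 * y, y, b, 1 + 2 * y - b, y + 1) k =
      (b - 1 + k) * (1 + 2 * y - b + k) * t k := by
    intro k
    have p1 := poch_mul_add (b - 1) k
    have p2 := hyb.add_natCast_ne k
    have p3 : poch b k = poch (b - 1) k * (b - 1 + k) / (b - 1) := by
      rw [p1, sub_add_cancel]; field_simp
    have p4 : (ascPochhammer ℂ k).eval b = (ascPochhammer ℂ k).eval (b - 1) * (b - 1 + k) / (b - 1) :=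
      p3
    simp only [ht]
    rw [term_lower_left _ _ _ _ hyb]
    simp only [term, p4]
    field_simp
  set v : ℕ → ℂ := fun k => k * (y + k) * (1 + 2 * y - b + k) / (2 * (b - 1)) * t k with hv
  -- The factor y + k in v cancels the pair y, y + 1, so v is a constant times k times a Gauss term
  -- whose excess is 2 − 2b.
  have hv0 : Tendsto v atTop (𝓝 0) := by
    have := (tendsto_natCast_mul_term (p := (2 * y, 1, b - 1, 1 + 2 * y - b, 1)) hyb hone (by
      simp [excess]; linarith)).const_mul (y * (1 + 2 * y - b) / (2 * (b - 1)))
    rw [mul_zero] at this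
    refine this.congr fun k => ?_
    have p1 := term_lower_cancel (2 * y) (b - 1) y (e := 1 + 2 * y - b) hy k
    have p2 := hyb.add_natCast_ne k
    simp only [hv, ht]
    rw [term_lower_left _ _ _ _ hyb]
    generalize 1 + 2 * y - b = d at p1 p2 ⊢
    generalize term (2 * y, y, b - 1, d, y + 1) k = T₁ at p1 ⊢
    generalize term (2 * y, 1, b - 1, d, 1) k = T₂ at p1 ⊢
    field_simp
    linear_combination -(k * d) * p1
  have hd : ∀ k, v (k + 1) - v k = (1 + y - b) ^ 2 * t k -
      (1 - b) * (1 + 2 * y - b) * term (2 * y, y, b, 1 + 2 * y - b, y + 1) k := by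
    intro k
    have p1 : 1 + 2 * y - b + 1 + k ≠ 0 := hyb.add_one.add_natCast_ne k
    have p2 := hy.add_natCast_ne k
    have p3 : (k : ℂ) + 1 ≠ 0 := Nat.cast_add_one_ne_zero k
    have p4 : (1 - b) * (1 + 2 * y - b) * term (2 * y, y, b, 1 + 2 * y - b, y + 1) k =
      -((b - 1 + k) * (1 + 2 * y - b + k) * t k) := by rw [← hrel k]; ring
    rw [p4]
    simp only [hv, ht]
    rw [term_succ]
    push_cast
    generalize term (2 * y, y, b - 1, 1 + 2 * y - b + 1, y + 1) k = T
    have e3 : ((k : ℂ) + 1) * (y + (k + 1)) * (1 + 2 * y - b + (k + 1)) / (2 * (b - 1)) *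
        (T * ((2 * y + k) * (y + k) * (b - 1 + k) / ((1 + 2 * y - b + 1 + k) * (y + 1 + k) * (k + 1)))) =
        (2 * y + k) * (y + k) * (b - 1 + k) / (2 * (b - 1)) * T := by
      have e4 : y + ((k : ℂ) + 1) = y + 1 + k := by ring
      have e5 : 1 + 2 * y - b + ((k : ℂ) + 1) = 1 + 2 * y - b + 1 + k := by ring
      rw [e4, e5]
      generalize 1 + 2 * y - b + 1 + (k : ℂ) = w at p1 ⊢
      field_simp
    rw [e3]
    field_simp
    ring
  have q1 := h1.mul_left ((1 + y - b) ^ 2)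
  have q0 := h0.mul_left ((1 - b) * (1 + 2 * y - b))
  have hz := tsum_sub_eq_zero (v := v) (by simp only [hd]; exact q1.sub q0) (by simp [hv]) hv0
  simp only [hd] at hz
  rw [q1.tsum_sub q0, tsum_mul_left, tsum_mul_left] at hz
  linear_combination hz

/-- For b ≤ 0 the ratio (b+k) / (2y+1−b+k) has absolute value at most 1. The resulting majorant does
not involve b; its excess is 1 − 2y. -/
lemma norm_dixon_term_le {y b : ℝ} (hy : 0 < y) (hb : b ≤ 0) (k : ℕ) :
    ‖term (dixonParams y b) k‖ ≤ ‖term (2 * (y : ℂ), (y : ℂ), 1, 1, (y : ℂ) + 1) k‖ := by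
  induction k with
  | zero => simp [term_zero]
  | succ k ih =>
    rw [term_succ, term_succ, norm_mul, norm_mul]
    refine mul_le_mul ih ?_ (norm_nonneg _) (norm_nonneg _)
    have h1 : ‖(1 : ℂ) + k‖ ≠ 0 := by
      rw [norm_ne_zero_iff, add_comm]; exact Nat.cast_add_one_ne_zero k
    have hk : (0 : ℝ) ≤ k := k.cast_nonneg
    have h2 : ‖(b : ℂ) + k‖ ≤ ‖2 * (y : ℂ) + 1 - b + k‖ := by
      have c1 : (b : ℂ) + k = ((b + k : ℝ) : ℂ) := by push_cast; ring
      have c2 : 2 * (y : ℂ) + 1 - b + k = ((2 * y + 1 - b + k : ℝ) : ℂ) := by push_cast; ring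
      rw [c1, c2, Complex.norm_real, Complex.norm_real, Real.norm_eq_abs, Real.norm_eq_abs,
        abs_of_pos (by linarith : 0 < 2 * y + 1 - b + k), abs_le]
      constructor <;> linarith
    have h3 : 0 < ‖2 * (y : ℂ) + 1 - b + k‖ := by
      have c2 : 2 * (y : ℂ) + 1 - b + k = ((2 * y + 1 - b + k : ℝ) : ℂ) := by push_cast; ring
      rw [c2, Complex.norm_real, Real.norm_eq_abs, abs_of_pos] <;> linarith
    simp only [norm_div, norm_mul]
    have e1 : ∀ p r s t u : ℝ, p * r / (s * t * u) = p / (t * u) * (r / s) := by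
      intros; simp only [div_eq_mul_inv, mul_inv]; ring
    rw [e1, e1, div_self h1]
    exact mul_le_mul_of_nonneg_left ((div_le_one h3).2 h2) (by positivity)

/-- As b → −∞ the quotient (b)_k / (2y+1−b)_k tends to (−1)^k. -/
lemma tendsto_dixon_term (y b : ℂ) (k : ℕ) :
    Tendsto (fun n : ℕ => term (dixonParams y (b - n)) k) atTop
      (𝓝 (term (2 * y, y, 1, 1, y + 1) k * (-1) ^ k)) := by
  induction k with
  | zero => simp [term_zero]
  | succ k ih =>
    have h1 : (1 : ℂ) + k ≠ 0 := by rw [add_comm]; exact Nat.cast_add_one_ne_zero k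
    have hlim := ((tendsto_inv_add_natCast (2 * y + 1 - b + k)).const_mul
      (2 * y + 1 + 2 * k)).const_add (-1)
    have hlim' := ih.mul (hlim.const_mul ((2 * y + k) * (y + k) / ((y + 1 + k) * (k + 1))))
    have hev : ∀ᶠ n : ℕ in atTop, 2 * y + 1 - b + k + n ≠ 0 := by
      filter_upwards [tendsto_natCast_atTop_atTop.eventually_gt_atTop
        (-(2 * y + 1 - b + k).re)] with n hn h0
      have := congrArg Complex.re h0
      simp only [Complex.add_re (2 * y + 1 - b + k), Complex.natCast_re, Complex.zero_re] at this
      linarith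
    have e : term (2 * y, y, 1, 1, y + 1) (k + 1) * (-1) ^ (k + 1) =
        term (2 * y, y, 1, 1, y + 1) k * (-1) ^ k *
          ((2 * y + k) * (y + k) / ((y + 1 + k) * (k + 1)) * (-1 + (2 * y + 1 + 2 * k) * 0)) := by
      rw [term_succ, pow_succ, mul_comm (1 + (k : ℂ)), mul_assoc (y + 1 + (k : ℂ)),
        mul_comm (1 + (k : ℂ)), ← mul_assoc (y + 1 + (k : ℂ)), mul_div_mul_right _ _ h1]
      ring
    rw [e]
    refine hlim'.congr' ?_
    filter_upwards [hev] with n hn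
    simp only [dixonParams]
    have e1 : 2 * y + 1 - (b - n) + k = 2 * y + 1 - b + k + n := by ring
    rw [term_succ, e1]
    congr 1
    have e2 : -1 + (2 * y + 1 + 2 * (k : ℂ)) * (2 * y + 1 - b + k + n)⁻¹ =
        (b - n + k) / (2 * y + 1 - b + k + n) := by
      rw [eq_div_iff hn, add_mul, mul_assoc _ _ (2 * y + 1 - b + k + (n : ℂ)), inv_mul_cancel₀ hn]
      ring
    rw [e2]
    simp only [div_eq_mul_inv, mul_inv]
    ring

/-- Descending b by integers leads to an alternating series independent of b. It need not be
evaluated separately: starting from b = 0, where the series reduces to 1, yields its value, and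
comparison gives every b ≤ 0. The bound y < 1/2 makes the majorant summable. -/
lemma dixon_real {y b : ℝ} (hy : 0 < y) (hy' : y < 1 / 2) (hb : b ≤ 0) :
    ∑' k, term (dixonParams y b) k = Complex.Gamma (1 + y) ^ 2 * Complex.Gamma (1 - b) *
      Complex.Gamma (1 + 2 * y - b) / (Complex.Gamma (1 + 2 * y) * Complex.Gamma (1 + y - b) ^ 2) := by
  have pos : ∀ {z : ℂ}, 0 < z.re → NonPole z := nonPole_of_re_pos
  have hbound : Summable fun k => ‖term (2 * (y : ℂ), (y : ℂ), 1, 1, (y : ℂ) + 1) k‖ :=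
    summable_norm_term (pos (by simp)) (pos (by simp; linarith)) (by simp [excess]; linarith)
  have key : ∀ b : ℝ, b ≤ 0 → ∑' k, term (2 * (y : ℂ), (y : ℂ), 1, 1, (y : ℂ) + 1) k * (-1) ^ k =
      (∑' k, term (dixonParams y b) k) *
        (Complex.Gamma (1 + y - b) * Complex.Gamma (1 + y - b) /
          (Complex.Gamma (1 - b) * Complex.Gamma (1 + 2 * y - b))) := by
    intro b hb
    have hlim : Tendsto (fun n : ℕ => ∑' k, term (dixonParams y ((b : ℂ) - n)) k) atTop
        (𝓝 (∑' k, term (2 * (y : ℂ), (y : ℂ), 1, 1, (y : ℂ) + 1) k * (-1) ^ k)) := by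
      refine tendsto_tsum_of_dominated_convergence hbound (fun k => tendsto_dixon_term y b k) ?_
      refine Eventually.of_forall fun n k => ?_
      have := norm_dixon_term_le (b := b - n) hy (by
        have : (0 : ℝ) ≤ n := n.cast_nonneg
        linarith) k
      push_cast at this
      exact this
    have := eq_of_tendsto_of_recurrence (s₁ := 1 + y - b) (s₂ := 1 + y - b) (s₃ := 1 - b)
      (s₄ := 1 + 2 * y - b) (pos (by simp; linarith)) (pos (by simp; linarith))
      (pos (by simp; linarith)) (pos (by simp; linarith)) (by ring) ?_ hlim
    · simpa only [Nat.cast_zero, sub_zero] using this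
    · intro n
      have hn : (0 : ℝ) ≤ n := n.cast_nonneg
      have h := dixon_contiguous (y := y) (b := (b : ℂ) - n) (pos (by simp; linarith))
        (pos (by simp; linarith)) (pos (by simp; linarith)) (by simp; linarith)
      have e : (b : ℂ) - n - 1 = b - ((n + 1 : ℕ) : ℂ) := by push_cast; ring
      rw [e] at h
      linear_combination h
  have h0 := key 0 le_rfl
  have hS0 : ∑' k, term (dixonParams y (0 : ℝ)) k = 1 := by
    rw [tsum_eq_single 0, term_zero]
    intro k hk
    obtain ⟨k, rfl⟩ := Nat.exists_eq_succ_of_ne_zero hk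
    have : (ascPochhammer ℂ (k + 1)).eval ((0 : ℝ) : ℂ) = 0 := by simp
    simp only [term, this, mul_zero, zero_div]
  rw [hS0, key b hb] at h0
  have g1 : Complex.Gamma (1 + y - b) ≠ 0 := nonPole_iff.1 (pos (by simp; linarith))
  have g2 : Complex.Gamma (1 - b) ≠ 0 := nonPole_iff.1 (pos (by simp; linarith))
  have g3 : Complex.Gamma (1 + 2 * y - b) ≠ 0 := nonPole_iff.1 (pos (by simp; linarith))
  have g4 : Complex.Gamma (1 + 2 * y) ≠ 0 := nonPole_iff.1 (pos (by simp; linarith))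
  have g5 : Complex.Gamma (1 + y) ≠ 0 := nonPole_iff.1 (pos (by simp; linarith))
  simp only [Complex.ofReal_zero, sub_zero, Complex.Gamma_one, one_mul] at h0
  generalize ∑' k, term (dixonParams y b) k = S at h0 ⊢
  generalize Complex.Gamma (1 + y - b) = G1 at *
  generalize Complex.Gamma (1 - b) = G2 at *
  generalize Complex.Gamma (1 + 2 * y - b) = G3 at *
  generalize Complex.Gamma (1 + 2 * y) = G4 at *
  generalize Complex.Gamma (1 + y) = G5 at *
  field_simp at h0 ⊢
  linear_combination h0

end Hyp32

namespace Hyp32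

open Filter Topology

/-! ### Continuation arguments -/

/-- Open sets of complex numbers with countable complement. -/
def OpenCocountable (U : Set ℂ) : Prop := IsOpen U ∧ Uᶜ.Countable

lemma OpenCocountable.inter {U V : Set ℂ} (hU : OpenCocountable U) (hV : OpenCocountable V) :
    OpenCocountable (U ∩ V) :=
  ⟨hU.1.inter hV.1, by rw [Set.compl_inter]; exact hU.2.union hV.2⟩

lemma openCocountable_nonPole {g : ℂ → ℂ} (hg : Continuous g) (hi : Function.Injective g) :
    OpenCocountable {t | NonPole (g t)} :=
  ⟨isOpen_nonPole.preimage hg, countable_not_nonPole hi⟩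

lemma OpenCocountable.eq_of_eq_on_real {U : Set ℂ} (hU : OpenCocountable U) {f g : ℂ → ℂ}
    (hf : DifferentiableOn ℂ f U) (hg : DifferentiableOn ℂ g U) {α β : ℝ} (hαβ : α < β)
    (h : ∀ t : ℝ, (t : ℂ) ∈ U → α < t → t < β → f t = g t) : ∀ z ∈ U, f z = g z :=
  eqOn_of_eq_on_real hU.1 hU.2 hf hg hαβ h

lemma IsHypergeometric.eq_tsum {F : Params → ℂ} (hF : IsHypergeometric F) {p : Params}
    (hp : p ∈ domain) (hs : 0 < (excess p).re) : F p = ∑' k, term p k :=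
  (hF.hasSum p hp hs).tsum_eq.symm

/-- Two hypergeometric functions with the same terms, the lower parameters being moved along the
same line. -/
lemma IsHypergeometric.congr_of_term_eq {F : Params → ℂ} (hF : IsHypergeometric F)
    {g g' : ℂ → Params} (hg : Differentiable ℂ g) (hg' : Differentiable ℂ g') {U : Set ℂ}
    (hU : OpenCocountable U) (hgU : ∀ t ∈ U, g t ∈ domain) (hgU' : ∀ t ∈ U, g' t ∈ domain) {N : ℝ}
    (hs : ∀ t : ℝ, N < t → 0 < (excess (g t)).re ∧ 0 < (excess (g' t)).re)
    (ht : ∀ t k, term (g t) k = term (g' t) k) : ∀ t ∈ U, F (g t) = F (g' t) := by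
  refine hU.eq_of_eq_on_real (hF.differentiableOn_comp hg hgU) (hF.differentiableOn_comp hg' hgU')
    (lt_add_one N) fun t htU hN _ => ?_
  rw [hF.eq_tsum (hgU t htU) (hs t hN).1, hF.eq_tsum (hgU' t htU) (hs t hN).2]
  exact tsum_congr fun k => ht t k

lemma openCocountable_domain (a b c e : ℂ) :
    OpenCocountable ({f : ℂ | NonPole f} ∩ {f : ℂ | NonPole (e + f - a - b - c)}) :=
  (openCocountable_nonPole (g := fun f => f) (by fun_prop) fun x y h => by simpa using h).inter
    (openCocountable_nonPole (g := fun f => e + f - a - b - c) (by fun_prop)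
      fun x y h => by simpa using h)

/-- Off the half-space of convergence F is known only by holomorphy, so even the symmetry in the
parameters needs continuation: f is moved far to the right, where the series agree term by term. -/
lemma IsHypergeometric.congr_params {F : Params → ℂ} (hF : IsHypergeometric F)
    {a b c a' b' c' e f : ℂ} (hp : (a, b, c, e, f) ∈ domain) (hsum : a + b + c = a' + b' + c')
    (ht : ∀ t k, term (a, b, c, e, t) k = term (a', b', c', e, t) k) :
    F (a, b, c, e, f) = F (a', b', c', e, f) := by
  have hex : ∀ t, e + t - a' - b' - c' = e + t - a - b - c := fun t => by linear_combination hsum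
  refine hF.congr_of_term_eq (g := fun t => (a, b, c, e, t)) (g' := fun t => (a', b', c', e, t))
    (by fun_prop) (by fun_prop) (openCocountable_domain a b c e)
    (fun t ht => ⟨hp.1, ht.1, ht.2⟩) (fun t ht => ⟨hp.1, ht.1, ?_⟩) (N := (a + b + c - e).re)
    (fun t hN => ?_) ht f ⟨hp.2.1, hp.2.2⟩
  · simp only [excess]; rw [hex]; exact ht.2
  · simp only [excess]; rw [hex]
    simp only [Complex.sub_re, Complex.add_re, Complex.ofReal_re] at hN ⊢
    constructor <;> linarith

lemma IsHypergeometric.swap_left {F : Params → ℂ} (hF : IsHypergeometric F)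
    {a b c e f : ℂ} (hp : (a, b, c, e, f) ∈ domain) : F (a, b, c, e, f) = F (b, a, c, e, f) :=
  hF.congr_params hp (by ring) fun t k => by simp only [term]; ring

lemma IsHypergeometric.swap_right {F : Params → ℂ} (hF : IsHypergeometric F)
    {a b c e f : ℂ} (hp : (a, b, c, e, f) ∈ domain) : F (a, b, c, e, f) = F (a, c, b, e, f) :=
  hF.congr_params hp (by ring) fun t k => by simp only [term]; ring

lemma IsHypergeometric.swap_lower {F : Params → ℂ} (hF : IsHypergeometric F)
    {a b c e f : ℂ} (hp : (a, b, c, e, f) ∈ domain) : F (a, b, c, e, f) = F (a, b, c, f, e) := by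
  have hex : ∀ t, t + e - a - b - c = e + t - a - b - c := fun t => by ring
  refine hF.congr_of_term_eq (g := fun t => (a, b, c, e, t)) (g' := fun t => (a, b, c, t, e))
    (by fun_prop) (by fun_prop) (openCocountable_domain a b c e)
    (fun t ht => ⟨hp.1, ht.1, ht.2⟩) (fun t ht => ⟨ht.1, hp.1, ?_⟩) (N := (a + b + c - e).re)
    (fun t hN => ?_) (fun t k => term_swap_lower _ _ _ _ _ _) f ⟨hp.2.1, hp.2.2⟩
  · simp only [excess]; rw [hex]; exact ht.2
  · simp only [excess]; rw [hex]
    simp only [Complex.sub_re, Complex.add_re, Complex.ofReal_re] at hN ⊢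
    constructor <;> linarith

/-- Dixon's theorem with unit difference of parameters. -/
theorem IsHypergeometric.dixon {F : Params → ℂ} (hF : IsHypergeometric F) {y b : ℂ}
    (hy : NonPole (y + 1)) (hyb : NonPole (1 + 2 * y - b)) (hb : NonPole (1 - b))
    (hb2 : NonPole (2 - 2 * b)) (hy2 : NonPole (1 + 2 * y)) (hyb2 : NonPole (1 + y - b)) :
    F (dixonParams y b) = Complex.Gamma (1 + y) ^ 2 * Complex.Gamma (1 - b) *
      Complex.Gamma (1 + 2 * y - b) /
        (Complex.Gamma (1 + 2 * y) * Complex.Gamma (1 + y - b) ^ 2) := by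
  have hex : ∀ y b, excess (dixonParams y b) = 2 - 2 * b := fun y b => by simp only [excess]; ring
  have hmem : ∀ {y b}, NonPole (y + 1) → NonPole (1 + 2 * y - b) → NonPole (2 - 2 * b) →
      dixonParams y b ∈ domain := fun {y b} h1 h2 h3 =>
    ⟨by simpa only [add_comm (2 * y) 1] using h2, h1, by rw [hex]; exact h3⟩
  have pos : ∀ {z : ℂ}, 0 < z.re → NonPole z := nonPole_of_re_pos
  -- Two continuations in turn: first in b, from (−1, 0), with real y in (0, 1/2) fixed; then in y,
  -- from that interval, with b fixed.
  have step : ∀ y : ℝ, 0 < y → y < 1 / 2 → ∀ b : ℂ, NonPole (1 + 2 * y - b) → NonPole (1 - b) →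
      NonPole (2 - 2 * b) → NonPole (1 + y - b) →
      F (dixonParams y b) = Complex.Gamma (1 + y) ^ 2 * Complex.Gamma (1 - b) *
        Complex.Gamma (1 + 2 * y - b) /
          (Complex.Gamma (1 + 2 * y) * Complex.Gamma (1 + y - b) ^ 2) := by
    intro y hy0 hy1 b h1 h2 h3 h4
    have n1 : NonPole ((y : ℂ) + 1) := pos (by simp; linarith)
    have n2 : NonPole (1 + 2 * (y : ℂ)) := pos (by simp; linarith)
    have hU : OpenCocountable ({b : ℂ | NonPole (1 + 2 * y - b)} ∩ ({b : ℂ | NonPole (1 - b)} ∩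
        ({b : ℂ | NonPole (2 - 2 * b)} ∩ {b : ℂ | NonPole (1 + y - b)}))) := by
      refine (openCocountable_nonPole (g := fun b => 1 + 2 * (y : ℂ) - b) (by fun_prop) ?_).inter
        ((openCocountable_nonPole (g := fun b => 1 - b) (by fun_prop) ?_).inter
        ((openCocountable_nonPole (g := fun b => 2 - 2 * b) (by fun_prop) ?_).inter
        (openCocountable_nonPole (g := fun b => 1 + (y : ℂ) - b) (by fun_prop) ?_))) <;>
      · intro x x' h
        simpa using h
    refine hU.eq_of_eq_on_real (α := -1) (β := 0) (f := fun b => F (dixonParams y b))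
      (g := fun b => Complex.Gamma (1 + y) ^ 2 * Complex.Gamma (1 - b) *
        Complex.Gamma (1 + 2 * y - b) /
          (Complex.Gamma (1 + 2 * y) * Complex.Gamma (1 + y - b) ^ 2)) ?_ ?_ (by norm_num) ?_ b
      ⟨h1, h2, h3, h4⟩
    · exact hF.differentiableOn_comp (g := fun b => dixonParams y b) (by fun_prop)
        fun t ht => hmem n1 ht.1 ht.2.2.1
    · refine DifferentiableOn.div (DifferentiableOn.mul (DifferentiableOn.const_mul
        (differentiableOn_Gamma_comp (by fun_prop) fun t ht => ht.2.1) _)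
        (differentiableOn_Gamma_comp (by fun_prop) fun t ht => ht.1)) (DifferentiableOn.const_mul
        ((differentiableOn_Gamma_comp (by fun_prop) fun t ht => ht.2.2.2).pow 2) _) ?_
      exact fun t ht => mul_ne_zero (nonPole_iff.1 n2) (pow_ne_zero 2 (nonPole_iff.1 ht.2.2.2))
    · intro t ht h5 h6
      rw [hF.eq_tsum (hmem n1 ht.1 ht.2.2.1) (by rw [hex]; simp; linarith)]
      exact dixon_real hy0 hy1 h6.le
  have hU : OpenCocountable ({y : ℂ | NonPole (1 + 2 * y - b)} ∩ ({y : ℂ | NonPole (y + 1)} ∩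
        ({y : ℂ | NonPole (1 + 2 * y)} ∩ {y : ℂ | NonPole (1 + y - b)}))) := by
    refine (openCocountable_nonPole (g := fun y => 1 + 2 * y - b) (by fun_prop) ?_).inter
        ((openCocountable_nonPole (g := fun y => y + 1) (by fun_prop) ?_).inter
        ((openCocountable_nonPole (g := fun y => 1 + 2 * y) (by fun_prop) ?_).inter
        (openCocountable_nonPole (g := fun y => 1 + y - b) (by fun_prop) ?_))) <;>
    · intro x x' h
      simpa using h
  refine hU.eq_of_eq_on_real (α := 0) (β := 1 / 2) (f := fun y => F (dixonParams y b))
      (g := fun y => Complex.Gamma (1 + y) ^ 2 * Complex.Gamma (1 - b) *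
        Complex.Gamma (1 + 2 * y - b) /
          (Complex.Gamma (1 + 2 * y) * Complex.Gamma (1 + y - b) ^ 2)) ?_ ?_ (by norm_num) ?_ y
      ⟨hyb, hy, hy2, hyb2⟩
  · exact hF.differentiableOn_comp (g := fun y => dixonParams y b) (by fun_prop)
        fun t ht => hmem ht.2.1 ht.1 hb2
  · refine DifferentiableOn.div (DifferentiableOn.mul (DifferentiableOn.mul_const
        ((differentiableOn_Gamma_comp (by fun_prop) fun t ht => ?_).pow 2) _)
        (differentiableOn_Gamma_comp (by fun_prop) fun t ht => ht.1)) (DifferentiableOn.mul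
        (differentiableOn_Gamma_comp (by fun_prop) fun t ht => ht.2.2.1)
        ((differentiableOn_Gamma_comp (by fun_prop) fun t ht => ht.2.2.2).pow 2)) ?_
    · rw [add_comm]; exact ht.2.1
    · exact fun t ht => mul_ne_zero (nonPole_iff.1 ht.2.2.1)
        (pow_ne_zero 2 (nonPole_iff.1 ht.2.2.2))
  · exact fun t ht h5 h6 => step t h5 h6 b ht.1 hb hb2 ht.2.2.2

/-- Contiguous relation raising an upper parameter, when another one is one less than a lower
one. -/
theorem IsHypergeometric.contiguous_upper {F : Params → ℂ} (hF : IsHypergeometric F)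
    {A B y C : ℂ} (hy : NonPole (y + 1)) (hC : NonPole C) (hs : NonPole (C - A - B))
    (hCA : NonPole (C - A)) (hCB : NonPole (C - B)) :
    A * F (A + 1, y, B, C, y + 1) = y * (Complex.Gamma C * Complex.Gamma (C - A - B) /
      (Complex.Gamma (C - A) * Complex.Gamma (C - B))) + (A - y) * F (A, y, B, C, y + 1) := by
  have ex0 : ∀ C, excess (A + 1, y, B, C, y + 1) = C - A - B := fun C => by simp only [excess]; ring
  have ex1 : ∀ C, excess (A, y, B, C, y + 1) = C - A - B + 1 := fun C => by
    simp only [excess]; ring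
  have ex2 : ∀ C, excess (A, B, 1, C, 1) = C - A - B := fun C => by simp only [excess]; ring
  have hU : OpenCocountable ({C : ℂ | NonPole C} ∩ ({C : ℂ | NonPole (C - A - B)} ∩
        ({C : ℂ | NonPole (C - A)} ∩ {C : ℂ | NonPole (C - B)}))) := by
    refine (openCocountable_nonPole (g := fun C => C) (by fun_prop) ?_).inter
        ((openCocountable_nonPole (g := fun C => C - A - B) (by fun_prop) ?_).inter
        ((openCocountable_nonPole (g := fun C => C - A) (by fun_prop) ?_).inter
        (openCocountable_nonPole (g := fun C => C - B) (by fun_prop) ?_))) <;>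
    · intro x x' h
      simpa using h
  refine hU.eq_of_eq_on_real (α := (A + B).re) (β := (A + B).re + 1)
    (f := fun C => A * F (A + 1, y, B, C, y + 1))
    (g := fun C => y * (Complex.Gamma C * Complex.Gamma (C - A - B) /
      (Complex.Gamma (C - A) * Complex.Gamma (C - B))) + (A - y) * F (A, y, B, C, y + 1))
    ?_ ?_ (by linarith) ?_ C ⟨hC, hs, hCA, hCB⟩
  · exact (hF.differentiableOn_comp (g := fun C => (A + 1, y, B, C, y + 1)) (by fun_prop)
      fun t ht => ⟨ht.1, hy, by rw [ex0]; exact ht.2.1⟩).const_mul A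
  · refine (DifferentiableOn.const_mul (DifferentiableOn.div (DifferentiableOn.mul
      (differentiableOn_Gamma_comp (by fun_prop) fun t ht => ht.1)
      (differentiableOn_Gamma_comp (by fun_prop) fun t ht => ht.2.1)) (DifferentiableOn.mul
      (differentiableOn_Gamma_comp (by fun_prop) fun t ht => ht.2.2.1)
      (differentiableOn_Gamma_comp (by fun_prop) fun t ht => ht.2.2.2)) ?_) _).add
      (DifferentiableOn.const_mul ?_ _)
    · exact fun t ht => mul_ne_zero (nonPole_iff.1 ht.2.2.1) (nonPole_iff.1 ht.2.2.2)
    · exact hF.differentiableOn_comp (g := fun C => (A, y, B, C, y + 1)) (by fun_prop)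
        fun t ht => ⟨ht.1, hy, by rw [ex1]; exact ht.2.1.add_one⟩
  · intro t ht h1 _
    have hone : NonPole 1 := nonPole_of_re_pos (by simp)
    have hre : 0 < ((t : ℂ) - A - B).re := by
      simp only [Complex.sub_re, Complex.add_re, Complex.ofReal_re] at h1 ⊢; linarith
    have hre1 : 0 < ((t : ℂ) - A - B + 1).re := by
      rw [Complex.add_re, Complex.one_re]; linarith
    change A * F (A + 1, y, B, (t : ℂ), y + 1) = y * (Complex.Gamma t * Complex.Gamma (t - A - B) /
      (Complex.Gamma (t - A) * Complex.Gamma (t - B))) + (A - y) * F (A, y, B, (t : ℂ), y + 1)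
    rw [hF.eq_tsum (p := (A + 1, y, B, (t : ℂ), y + 1))
        ⟨ht.1, hy, by rw [ex0]; exact ht.2.1⟩ (by rw [ex0]; exact hre),
      hF.eq_tsum (p := (A, y, B, (t : ℂ), y + 1))
        ⟨ht.1, hy, by rw [ex1]; exact ht.2.1.add_one⟩ (by rw [ex1]; exact hre1),
      ← tsum_gauss ht.1 ht.2.2.1 ht.2.2.2 hre, ← tsum_mul_left, ← tsum_mul_left, ← tsum_mul_left]
    have s1 : Summable (term (A, B, 1, (t : ℂ), 1)) :=
      summable_term ht.1 hone (by rw [ex2]; exact hre)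
    have s2 : Summable (term (A, y, B, (t : ℂ), y + 1)) :=
      summable_term ht.1 hy (by rw [ex1]; exact hre1)
    rw [← (s1.mul_left y).tsum_add (s2.mul_left (A - y))]
    refine tsum_congr fun k => ?_
    -- Termwise, A (A+1)_k = (A+k) (A)_k and A + k = (y+k) + (A−y); the part with y + k is y times a
    -- Gauss term.
    have p1 := term_lower_cancel A B y (e := t) hy k
    have p2 : term (A, B, 1, (t : ℂ), 1) k = term (A, 1, B, (t : ℂ), 1) k := by
      simp only [term]; ring
    have p3 : A * term (A + 1, y, B, (t : ℂ), y + 1) k = (A + k) * term (A, y, B, (t : ℂ), y + 1) k := by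
      have h : A * (ascPochhammer ℂ k).eval (A + 1) = (ascPochhammer ℂ k).eval A * (A + k) :=
        (poch_mul_add A k).symm
      simp only [term]
      rw [mul_div_assoc', mul_div_assoc', ← mul_assoc, ← mul_assoc, h]
      congr 1; ring
    rw [p2, ← p1, p3]
    ring

end Hyp32

namespace Hyp32

open Filter Topology

/-! ### Oriented sums over the integers -/

/-- The oriented sum `∑_{L=1}^{m} g L`. -/
noncomputable def ozsum (m : ℤ) (g : ℤ → ℂ) : ℂ :=
  ∑ L ∈ Finset.Icc 1 m, g L - ∑ L ∈ Finset.Icc (m + 1) 0, g L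

lemma ozsum_zero (g : ℤ → ℂ) : ozsum 0 g = 0 := by simp [ozsum]

/-- The orientation convention makes this hold for every integer m, so that a recurrence in m needs
no separation by sign. -/
lemma ozsum_add_one (m : ℤ) (g : ℤ → ℂ) : ozsum (m + 1) g = ozsum m g + g (m + 1) := by
  rcases le_or_gt 0 m with h | h
  · have e1 : Finset.Icc 1 (m + 1) = insert (m + 1) (Finset.Icc 1 m) := by
      ext x; simp only [Finset.mem_Icc, Finset.mem_insert]; omega
    have e2 : Finset.Icc (m + 1 + 1) 0 = ∅ := Finset.Icc_eq_empty (by omega)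
    have e3 : Finset.Icc (m + 1) 0 = ∅ := Finset.Icc_eq_empty (by omega)
    rw [ozsum, ozsum, e1, e2, e3, Finset.sum_insert (by simp)]
    simp; ring
  · have e1 : Finset.Icc (m + 1) 0 = insert (m + 1) (Finset.Icc (m + 1 + 1) 0) := by
      ext x; simp only [Finset.mem_Icc, Finset.mem_insert]; omega
    have e2 : Finset.Icc 1 (m + 1) = ∅ := Finset.Icc_eq_empty (by omega)
    have e3 : Finset.Icc 1 m = ∅ := Finset.Icc_eq_empty (by omega)
    rw [ozsum, ozsum, e1, e2, e3, Finset.sum_insert (by simp)]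
    simp

lemma ozsum_congr {m : ℤ} {g h : ℤ → ℂ} (hgh : ∀ L, g L = h L) : ozsum m g = ozsum m h := by
  simp only [ozsum, hgh]

lemma ozsum_add (m : ℤ) (g h : ℤ → ℂ) : ozsum m (fun L => g L + h L) = ozsum m g + ozsum m h := by
  simp only [ozsum, Finset.sum_add_distrib]; ring

lemma ozsum_const_mul (m : ℤ) (c : ℂ) (g : ℤ → ℂ) :
    ozsum m (fun L => c * g L) = c * ozsum m g := by
  simp only [ozsum, ← Finset.mul_sum]; ring

lemma ozsum_reflect (m : ℤ) (g : ℤ → ℂ) : ozsum m (fun L => g (m + 1 - L)) = ozsum m g := by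
  have h : ∀ p q : ℤ, p + q = m + 1 →
      ∑ L ∈ Finset.Icc p q, g (m + 1 - L) = ∑ L ∈ Finset.Icc p q, g L := by
    intro p q hpq
    refine Finset.sum_nbij' (fun L => m + 1 - L) (fun L => m + 1 - L) ?_ ?_ ?_ ?_ ?_
    · intro L hL; simp only [Finset.mem_Icc] at hL ⊢; omega
    · intro L hL; simp only [Finset.mem_Icc] at hL ⊢; omega
    · intro L _; ring
    · intro L _; ring
    · intro L _; rfl
  rw [ozsum, ozsum, h 1 m (by ring), h (m + 1) 0 (by ring)]

lemma ozsum_shift (m : ℤ) (g : ℤ → ℂ) :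
    ozsum m (fun L => g (L - 1)) = ozsum (m - 1) g + g 0 := by
  have h0 := ozsum_add_one (-1) g
  norm_num at h0
  rw [ozsum_zero] at h0
  induction m using Int.induction_on with
  | zero => rw [ozsum_zero]; simp only [zero_sub]; exact h0
  | succ i ih =>
    have h := ozsum_add_one ((i : ℤ) - 1) g
    rw [sub_add_cancel] at h
    rw [ozsum_add_one, ih]
    simp only [add_sub_cancel_right]
    rw [h]; ring
  | pred i ih =>
    have h1 := ozsum_add_one (-(i : ℤ) - 1) (fun L => g (L - 1))
    have h2 := ozsum_add_one (-(i : ℤ) - 1 - 1) g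
    simp only [sub_add_cancel] at h1 h2
    rw [ih] at h1
    rw [h2] at h1
    linear_combination -h1

lemma osum_eq_ozsum (n : ℕ) (g : ℤ → ℂ) : osum n g = ozsum ((n : ℤ) - 2) g := by
  rw [osum, ozsum, show (n : ℤ) - 2 + 1 = n - 1 by ring]

/-- For m = −n − 2 the oriented sum is minus the sum over −n − 1, …, 0, an interval of n + 2
integers; the shift by n + 1 moves it to 0, …, n + 1. -/
lemma sum_range_eq_ozsum (n : ℕ) (g : ℤ → ℂ) :
    ∑ L ∈ Finset.range (n + 2), g L = -ozsum (-(n : ℤ) - 2) (fun L => g (L + n + 1)) := by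
  have e : Finset.Icc 1 (-(n : ℤ) - 2) = ∅ := Finset.Icc_eq_empty (by omega)
  rw [ozsum, e, Finset.sum_empty, zero_sub, neg_neg]
  refine Finset.sum_bij' (fun L _ => (L : ℤ) - n - 1) (fun L _ => (L + n + 1).toNat) ?_ ?_ ?_ ?_ ?_
  · intro L hL; simp only [Finset.mem_range, Finset.mem_Icc] at hL ⊢; omega
  · intro L hL; simp only [Finset.mem_range, Finset.mem_Icc] at hL ⊢; omega
  · intro L hL; omega
  · intro L hL; simp only [Finset.mem_Icc] at hL; omega
  · intro L hL; congr 1; ring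

/-- First-order recurrence for the oriented self-convolution of a sequence with a first-order
recurrence. -/
lemma ozsum_convolution {y B : ℂ} {z : ℤ → ℂ} (hz : ∀ L : ℤ, (L - B) * z L = (L - 1 - y) * z (L - 1))
    (m : ℤ) :
    (m + 1 - 2 * B) * ozsum m (fun L => z L * z (m + 1 - L)) =
      (m - 2 * y) * ozsum (m - 1) (fun L => z L * z (m - L)) - 2 * y * (z 0 * z m) := by
  -- Averaging over the reflection L ↦ m + 1 − L replaces the weight L by its mean (m+1)/2. With
  -- weight L − B the recurrence of z shifts one factor, and the shifted sum has weight L − y and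
  -- the boundary term at L = 0.
  have sym : ∀ (m : ℤ) (w : ℂ), 2 * ozsum m (fun L => (L - w) * (z L * z (m + 1 - L))) =
      (m + 1 - 2 * w) * ozsum m (fun L => z L * z (m + 1 - L)) := by
    intro m w
    have h := ozsum_reflect m (fun L => (L - w) * (z L * z (m + 1 - L)))
    rw [two_mul]
    nth_rewrite 1 [← h]
    rw [← ozsum_add, ← ozsum_const_mul]
    refine ozsum_congr fun L => ?_
    rw [sub_sub_cancel]; push_cast; ring
  have h1 := sym m B
  have h2 := sym (m - 1) y
  have h3 := ozsum_shift m (fun L => (L - y) * (z L * z (m - L)))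
  have h4 : ozsum m (fun L => (L - B) * (z L * z (m + 1 - L))) =
      ozsum m (fun L => ((L - 1 : ℤ) - y) * (z (L - 1) * z (m - (L - 1)))) := by
    refine ozsum_congr fun L => ?_
    have := hz L
    rw [show m + 1 - L = m - (L - 1) by ring]
    push_cast
    linear_combination z (m - (L - 1)) * this
  simp only [sub_add_cancel] at h2
  push_cast at h2
  rw [← h1, h4, h3, mul_add, h2]
  simp only [Int.cast_zero, sub_zero]
  ring

/-! ### Pairs of parameters in general position -/

/-- The numbers `1, a, b` are linearly independent over the rational numbers. -/
def Generic (a b : ℂ) : Prop := ∀ p q r : ℤ, (p : ℂ) * a + q * b = r → p = 0 ∧ q = 0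

/-- The denominator d is cleared so that half-integral combinations of a and b, which occur as gamma
arguments, are covered. -/
lemma Generic.ne {a b : ℂ} (h : Generic a b) (p q r d : ℤ) {z : ℂ}
    (hz : (d : ℂ) * z = p * a + q * b + r) (hpq : p ≠ 0 ∨ q ≠ 0) (k : ℤ) : z ≠ k := by
  intro hk
  have := h p q (d * k - r) (by push_cast; rw [← hk, hz]; ring)
  tauto

lemma Generic.nonPole {a b : ℂ} (h : Generic a b) (p q r d : ℤ) {z : ℂ}
    (hz : (d : ℂ) * z = p * a + q * b + r) (hpq : p ≠ 0 ∨ q ≠ 0) : NonPole z := fun k => by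
  have := h.ne p q r d hz hpq (-k)
  simpa using this

lemma Generic.ne_zero {a b : ℂ} (h : Generic a b) (p q r d : ℤ) {z : ℂ}
    (hz : (d : ℂ) * z = p * a + q * b + r) (hpq : p ≠ 0 ∨ q ≠ 0) : z ≠ 0 := by
  simpa using h.ne p q r d hz hpq 0

lemma Generic.Gamma_ne_zero {a b : ℂ} (h : Generic a b) (p q r d : ℤ) {z : ℂ}
    (hz : (d : ℂ) * z = p * a + q * b + r) (hpq : p ≠ 0 ∨ q ≠ 0) : Complex.Gamma z ≠ 0 :=
  nonPole_iff.1 (h.nonPole p q r d hz hpq)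

lemma Generic.sin_ne_zero {a b : ℂ} (h : Generic a b) (p q r d : ℤ) {z : ℂ}
    (hz : (d : ℂ) * z = p * a + q * b + r) (hpq : p ≠ 0 ∨ q ≠ 0) :
    Complex.sin (Real.pi * z) ≠ 0 := by
  rw [Complex.sin_ne_zero_iff]
  intro k hk
  refine h.ne p q r d hz hpq k ?_
  have : (Real.pi : ℂ) ≠ 0 := Complex.ofReal_ne_zero.2 Real.pi_ne_zero
  rw [mul_comm (k : ℂ)] at hk
  exact mul_left_cancel₀ this hk

/-! ### The basic family -/

/-- The parameters of the basic family. -/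
noncomputable abbrev baseParams (m : ℤ) (y B : ℂ) : Params :=
  (2 * y - m, y, B, 2 * y + 1 - B, y + 1)

/-- The gamma quotient in the closed form of the basic family. -/
noncomputable def baseH (m : ℤ) (y B : ℂ) : ℂ :=
  1 / 2 * (Complex.Gamma (1 + y) * Complex.Gamma (1 - B) * Complex.Gamma (2 * y + 1 - B) *
    Complex.Gamma (y - m)) / (Complex.Gamma (1 + y - B) ^ 2 * Complex.Gamma (2 * y - m))

/-- The coefficient of the convolution in the closed form of the basic family. -/
noncomputable def baseCoeff (m : ℤ) (y B : ℂ) : ℂ :=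
  -(1 / 2) * (Complex.Gamma (2 * y + 1 - B) * Complex.Gamma (1 - B) *
    Complex.Gamma (2 + m - 2 * B)) /
    (Complex.Gamma (2 * y + 1 - 2 * B) * Complex.Gamma (-y) * Complex.Gamma (m + 1 - y))

/-- The gamma quotients whose convolution occurs in the closed form of the basic family. -/
noncomputable def baseZ (y B : ℂ) (L : ℤ) : ℂ := Complex.Gamma (L - y) / Complex.Gamma (1 - B + L)

lemma baseZ_rec {y B : ℂ} (hg : Generic y B) (L : ℤ) :
    (L - B) * baseZ y B L = (L - 1 - y) * baseZ y B (L - 1) := by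
  have h1 : (L : ℂ) - 1 - y ≠ 0 := hg.ne_zero (-1) 0 (L - 1) 1 (by push_cast; ring) (by simp)
  have h2 : -B + (L : ℂ) ≠ 0 := hg.ne_zero 0 (-1) L 1 (by push_cast; ring) (by simp)
  have h3 : Complex.Gamma (-B + L) ≠ 0 :=
    hg.Gamma_ne_zero 0 (-1) L 1 (by push_cast; ring) (by simp)
  have e1 : (L : ℂ) - y = L - 1 - y + 1 := by ring
  have e2 : 1 - B + (L : ℂ) = -B + L + 1 := by ring
  have e3 : (((L - 1 : ℤ) : ℂ)) - y = L - 1 - y := by push_cast; ring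
  have e4 : 1 - B + (((L - 1 : ℤ) : ℂ)) = -B + L := by push_cast; ring
  simp only [baseZ]
  rw [e1, e2, e3, e4, Complex.Gamma_add_one _ h1, Complex.Gamma_add_one _ h2]
  field_simp
  ring

/-- The closed form of the basic family. -/
noncomputable def baseVal (m : ℤ) (y B : ℂ) : ℂ :=
  baseH m y B + baseCoeff m y B * ozsum m (fun L => baseZ y B L * baseZ y B (m + 1 - L))

/-- The homogeneous part of the recurrence of the basic family. -/
lemma baseH_rec {y B : ℂ} (hg : Generic y B) (m : ℤ) :
    (2 * y - m) * baseH (m - 1) y B = (y - m) * baseH m y B := by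
  have h1 : y - (m : ℂ) ≠ 0 := hg.ne_zero 1 0 (-m) 1 (by push_cast; ring) (by simp)
  have h2 : 2 * y - (m : ℂ) ≠ 0 := hg.ne_zero 2 0 (-m) 1 (by push_cast; ring) (by simp)
  have h3 : Complex.Gamma (2 * y - m) ≠ 0 :=
    hg.Gamma_ne_zero 2 0 (-m) 1 (by push_cast; ring) (by simp)
  have h4 : Complex.Gamma (1 + y - B) ≠ 0 :=
    hg.Gamma_ne_zero 1 (-1) 1 1 (by push_cast; ring) (by simp)
  have e1 : y - ((m - 1 : ℤ) : ℂ) = y - m + 1 := by push_cast; ring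
  have e2 : 2 * y - ((m - 1 : ℤ) : ℂ) = 2 * y - m + 1 := by push_cast; ring
  simp only [baseH]
  rw [e1, e2, Complex.Gamma_add_one _ h1, Complex.Gamma_add_one _ h2]
  field_simp

lemma baseCoeff_rec {y B : ℂ} (hg : Generic y B) (m : ℤ) :
    (y - m) * baseCoeff m y B = -(1 + m - 2 * B) * baseCoeff (m - 1) y B := by
  have h1 : (m : ℂ) - y ≠ 0 := hg.ne_zero (-1) 0 m 1 (by push_cast; ring) (by simp)
  have h2 : 1 + (m : ℂ) - 2 * B ≠ 0 := hg.ne_zero 0 (-2) (1 + m) 1 (by push_cast; ring) (by simp)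
  have h3 : Complex.Gamma (m - y) ≠ 0 :=
    hg.Gamma_ne_zero (-1) 0 m 1 (by push_cast; ring) (by simp)
  have h4 : Complex.Gamma (2 * y + 1 - 2 * B) ≠ 0 :=
    hg.Gamma_ne_zero 2 (-2) 1 1 (by push_cast; ring) (by simp)
  have h5 : Complex.Gamma (-y) ≠ 0 :=
    hg.Gamma_ne_zero (-1) 0 0 1 (by push_cast; ring) (by simp)
  have e1 : 2 + (m : ℂ) - 2 * B = 1 + m - 2 * B + 1 := by ring
  have e2 : (m : ℂ) + 1 - y = m - y + 1 := by ring
  have e3 : 2 + ((m - 1 : ℤ) : ℂ) - 2 * B = 1 + m - 2 * B := by push_cast; ring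
  have e4 : ((m - 1 : ℤ) : ℂ) + 1 - y = m - y := by push_cast; ring
  simp only [baseCoeff]
  rw [e1, e2, e3, e4, Complex.Gamma_add_one _ h1, Complex.Gamma_add_one _ h2]
  generalize Complex.Gamma (m - y) = G1 at *
  generalize Complex.Gamma (2 * y + 1 - 2 * B) = G2 at *
  generalize Complex.Gamma (-y) = G3 at *
  field_simp
  ring

/-- The boundary term of the convolution is, up to the factor −y, the Gauss sum in the contiguous
relation. -/
lemma baseCoeff_mul_baseZ {y B : ℂ} (hg : Generic y B) (m : ℤ) :
    2 * baseCoeff (m - 1) y B * (baseZ y B 0 * baseZ y B m) =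
      -(Complex.Gamma (2 * y + 1 - B) * Complex.Gamma (1 + m - 2 * B) /
        (Complex.Gamma (1 + m - B) * Complex.Gamma (2 * y + 1 - 2 * B))) := by
  have h3 : Complex.Gamma (m - y) ≠ 0 :=
    hg.Gamma_ne_zero (-1) 0 m 1 (by push_cast; ring) (by simp)
  have h4 : Complex.Gamma (2 * y + 1 - 2 * B) ≠ 0 :=
    hg.Gamma_ne_zero 2 (-2) 1 1 (by push_cast; ring) (by simp)
  have h5 : Complex.Gamma (-y) ≠ 0 :=
    hg.Gamma_ne_zero (-1) 0 0 1 (by push_cast; ring) (by simp)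
  have h6 : Complex.Gamma (1 - B) ≠ 0 :=
    hg.Gamma_ne_zero 0 (-1) 1 1 (by push_cast; ring) (by simp)
  have h7 : Complex.Gamma (1 + m - B) ≠ 0 :=
    hg.Gamma_ne_zero 0 (-1) (1 + m) 1 (by push_cast; ring) (by simp)
  have e3 : 2 + ((m - 1 : ℤ) : ℂ) - 2 * B = 1 + m - 2 * B := by push_cast; ring
  have e4 : ((m - 1 : ℤ) : ℂ) + 1 - y = m - y := by push_cast; ring
  have e5 : 1 - B + (m : ℂ) = 1 + m - B := by ring
  have e6 : ((0 : ℤ) : ℂ) - y = -y := by simp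
  have e7 : 1 - B + ((0 : ℤ) : ℂ) = 1 - B := by simp
  simp only [baseCoeff, baseZ]
  rw [e3, e4, e5, e6, e7]
  generalize Complex.Gamma (m - y) = G1 at *
  generalize Complex.Gamma (2 * y + 1 - 2 * B) = G2 at *
  generalize Complex.Gamma (-y) = G3 at *
  generalize Complex.Gamma (1 - B) = G4 at *
  generalize Complex.Gamma (1 + m - B) = G5 at *
  field_simp

/-- The recurrence of the coefficient matches that of the convolution, so the two convolutions
cancel up to the boundary term, which supplies the inhomogeneity. -/
lemma baseVal_rec {y B : ℂ} (hg : Generic y B) (m : ℤ) :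
    (2 * y - m) * baseVal (m - 1) y B =
      y * (Complex.Gamma (2 * y + 1 - B) * Complex.Gamma (1 + m - 2 * B) /
        (Complex.Gamma (1 + m - B) * Complex.Gamma (2 * y + 1 - 2 * B))) +
      (y - m) * baseVal m y B := by
  have h1 := baseH_rec hg m
  have h2 := baseCoeff_rec hg m
  have h3 := baseCoeff_mul_baseZ hg m
  have h4 := ozsum_convolution (baseZ_rec hg) m
  simp only [baseVal, sub_add_cancel]
  linear_combination h1 - (ozsum m fun L => baseZ y B L * baseZ y B (m + 1 - L)) * h2 +
    baseCoeff (m - 1) y B * h4 - y * h3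

lemma baseParams_mem_domain {y B : ℂ} (hg : Generic y B) (m : ℤ) : baseParams m y B ∈ domain := by
  refine ⟨hg.nonPole 2 (-1) 1 1 (by push_cast; ring) (by simp),
    hg.nonPole 1 0 1 1 (by push_cast; ring) (by simp), ?_⟩
  exact hg.nonPole 0 (-2) (2 + m) 1 (by simp only [excess]; push_cast; ring) (by simp)

lemma IsHypergeometric.base_rec {F : Params → ℂ} (hF : IsHypergeometric F) {y B : ℂ}
    (hg : Generic y B) (m : ℤ) :
    (2 * y - m) * F (baseParams (m - 1) y B) =
      y * (Complex.Gamma (2 * y + 1 - B) * Complex.Gamma (1 + m - 2 * B) /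
        (Complex.Gamma (1 + m - B) * Complex.Gamma (2 * y + 1 - 2 * B))) +
      (y - m) * F (baseParams m y B) := by
  have e1 : 2 * y + 1 - B - (2 * y - m) - B = 1 + m - 2 * B := by ring
  have e2 : 2 * y + 1 - B - (2 * y - m) = 1 + m - B := by ring
  have e3 : 2 * y + 1 - B - B = 2 * y + 1 - 2 * B := by ring
  have h := hF.contiguous_upper (A := 2 * y - m) (B := B) (y := y) (C := 2 * y + 1 - B)
    (hg.nonPole 1 0 1 1 (by push_cast; ring) (by simp))
    (hg.nonPole 2 (-1) 1 1 (by push_cast; ring) (by simp))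
    (hg.nonPole 0 (-2) (1 + m) 1 (by push_cast; ring) (by simp))
    (hg.nonPole 0 (-1) (1 + m) 1 (by push_cast; ring) (by simp))
    (hg.nonPole 2 (-2) 1 1 (by push_cast; ring) (by simp))
  rw [e1, e2, e3] at h
  have e4 : 2 * y - ((m - 1 : ℤ) : ℂ) = 2 * y - m + 1 := by push_cast; ring
  simp only [baseParams, e4]
  rw [h]
  ring

lemma IsHypergeometric.base_zero {F : Params → ℂ} (hF : IsHypergeometric F) {y B : ℂ}
    (hg : Generic y B) : F (baseParams 0 y B) = baseVal 0 y B := by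
  have h := hF.dixon (y := y) (b := B)
    (hg.nonPole 1 0 1 1 (by push_cast; ring) (by simp))
    (hg.nonPole 2 (-1) 1 1 (by push_cast; ring) (by simp))
    (hg.nonPole 0 (-1) 1 1 (by push_cast; ring) (by simp))
    (hg.nonPole 0 (-2) 2 1 (by push_cast; ring) (by simp))
    (hg.nonPole 2 0 1 1 (by push_cast; ring) (by simp))
    (hg.nonPole 1 (-1) 1 1 (by push_cast; ring) (by simp))
  have e1 : baseParams 0 y B = dixonParams y B := by simp [baseParams]
  rw [e1, h, baseVal, ozsum_zero, mul_zero, add_zero, baseH]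
  have h1 : y ≠ 0 := hg.ne_zero 1 0 0 1 (by push_cast; ring) (by simp)
  have h2 : 2 * y ≠ 0 := mul_ne_zero two_ne_zero h1
  have h3 : Complex.Gamma (2 * y) ≠ 0 := hg.Gamma_ne_zero 2 0 0 1 (by push_cast; ring) (by simp)
  have h4 : Complex.Gamma (1 + y - B) ≠ 0 :=
    hg.Gamma_ne_zero 1 (-1) 1 1 (by push_cast; ring) (by simp)
  simp only [Int.cast_zero, sub_zero]
  rw [add_comm 1 y, add_comm 1 (2 * y), Complex.Gamma_add_one _ h1, Complex.Gamma_add_one _ h2]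
  rw [add_comm y 1]
  generalize Complex.Gamma (1 + y - B) = G1 at *
  field_simp

/-- The closed form of the basic family. -/
theorem IsHypergeometric.base {F : Params → ℂ} (hF : IsHypergeometric F) {y B : ℂ}
    (hg : Generic y B) (m : ℤ) : F (baseParams m y B) = baseVal m y B := by
  -- From Dixon's case m = 0 the recurrence runs upwards after division by y − m and downwards after
  -- division by 2y − m, both nonzero for generic y, B.
  induction m using Int.induction_on with
  | zero => exact hF.base_zero hg
  | succ i ih =>
    have h1 := hF.base_rec hg (i + 1)
    have h2 := baseVal_rec hg (i + 1)
    rw [add_sub_cancel_right] at h1 h2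
    rw [ih] at h1
    have hne : y - (((i : ℤ) + 1 : ℤ) : ℂ) ≠ 0 :=
      hg.ne_zero 1 0 (-(i + 1)) 1 (by push_cast; ring) (by simp)
    exact mul_left_cancel₀ hne (by linear_combination h2 - h1)
  | pred i ih =>
    have h1 := hF.base_rec hg (-i)
    have h2 := baseVal_rec hg (-i)
    rw [ih] at h1
    have hne : 2 * y - ((-(i : ℤ) : ℤ) : ℂ) ≠ 0 :=
      hg.ne_zero 2 0 i 1 (by push_cast; ring) (by simp)
    exact mul_left_cancel₀ hne (by linear_combination h1 - h2)

end Hyp32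

namespace Hyp32

open Complex (Gamma sin cos)
open scoped Real

/-! ### The closed form of the basic family -/

lemma sin_pi_mul_add_int (z : ℂ) (k : ℤ) : sin (π * (z + k)) = (-1) ^ k * sin (π * z) := by
  rw [mul_add, mul_comm (π : ℂ) k, Complex.sin_antiperiodic.add_int_mul_eq, Int.cast_negOnePow]

lemma Gamma_reflection_shift (z : ℂ) (k : ℤ) :
    Gamma z * Gamma (1 - z) = (-1) ^ k * (Gamma (z + k) * Gamma (1 - (z + k))) := by
  rw [Complex.Gamma_mul_Gamma_one_sub, Complex.Gamma_mul_Gamma_one_sub, sin_pi_mul_add_int]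
  have h : ((-1 : ℂ) ^ k) ≠ 0 := zpow_ne_zero _ (by norm_num)
  field_simp

lemma Generic.sin_mul_Gamma {a b : ℂ} (h : Generic a b) (p q r d : ℤ) {z w : ℂ}
    (hz : (d : ℂ) * z = p * a + q * b + r) (hpq : p ≠ 0 ∨ q ≠ 0) (hw : w = 1 - z) :
    Gamma z * Gamma w * sin (π * z) = π := by
  rw [hw, Complex.Gamma_mul_Gamma_one_sub, div_mul_cancel₀]
  exact h.sin_ne_zero p q r d hz hpq

/-- The coefficient of the sum in the closed form of the basic family. -/
noncomputable def baseK (m : ℤ) (y B : ℂ) : ℂ :=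
  -(1 / 2) * (Gamma (1 + y) * Gamma (2 * y + 1 - B) * Gamma (2 + m - 2 * B)) /
    (Gamma B * Gamma (2 * y + 1 - 2 * B) * Gamma (m + 1 - y))

/-- The summand in the closed form of the basic family. -/
noncomputable def baseS (m : ℤ) (y B : ℂ) (L : ℤ) : ℂ :=
  Gamma (B - 1 - m + L) * Gamma (-y + L) / (Gamma (1 - B + L) * Gamma (y - m + L))

/-- Reflection of the two gamma functions with argument involving −L. Each produces the sign
(−1)^(L−1−m), one with an additional minus, so the ratio of the two summands does not depend on L.
-/
lemma baseS_eq {y B : ℂ} (hg : Generic y B) (m L : ℤ) :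
    sin (π * B) * baseS m y B L =
      -(sin (π * y)) * (baseZ y B L * baseZ y B (m + 1 - L)) := by
  have r1 := hg.sin_mul_Gamma 0 1 (-1 - m + L) 1 (z := B - 1 - m + L)
    (w := 1 - B + ((m + 1 - L : ℤ) : ℂ)) (by push_cast; ring) (by simp) (by push_cast; ring)
  have r2 := hg.sin_mul_Gamma 1 0 (L - m) 1 (z := y - m + L)
    (w := ((m + 1 - L : ℤ) : ℂ) - y) (by push_cast; ring) (by simp) (by push_cast; ring)
  have e1 : B - 1 - m + L = B + ((L - 1 - m : ℤ) : ℂ) := by push_cast; ring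
  have e2 : y - m + L = y + ((L - 1 - m + 1 : ℤ) : ℂ) := by push_cast; ring
  have s1 : sin (π * (B - 1 - m + L)) = (-1) ^ (L - 1 - m) * sin (π * B) := by
    rw [e1, sin_pi_mul_add_int]
  have s2 : sin (π * (y - m + L)) = -((-1) ^ (L - 1 - m) * sin (π * y)) := by
    rw [e2, sin_pi_mul_add_int, zpow_add_one₀ (by norm_num)]; ring
  have hB : sin (π * B) ≠ 0 := hg.sin_ne_zero 0 1 0 1 (by push_cast; ring) (by simp)
  have hy : sin (π * y) ≠ 0 := hg.sin_ne_zero 1 0 0 1 (by push_cast; ring) (by simp)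
  have g1 : Gamma (y - m + L) ≠ 0 :=
    hg.Gamma_ne_zero 1 0 (L - m) 1 (by push_cast; ring) (by simp)
  have g2 : Gamma (1 - B + ((m + 1 - L : ℤ) : ℂ)) ≠ 0 :=
    hg.Gamma_ne_zero 0 (-1) (1 + (m + 1 - L)) 1 (by push_cast; ring) (by simp)
  have g3 : Gamma (1 - B + L) ≠ 0 :=
    hg.Gamma_ne_zero 0 (-1) (1 + L) 1 (by push_cast; ring) (by simp)
  have hε : ((-1 : ℂ) ^ (L - 1 - m)) ≠ 0 := zpow_ne_zero _ (by norm_num)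
  have e3 : (L : ℂ) - y = -y + L := by ring
  rw [s1] at r1
  rw [s2] at r2
  simp only [baseS, baseZ]
  rw [e3]
  generalize Gamma (B - 1 - m + L) = G1 at *
  generalize Gamma (1 - B + ((m + 1 - L : ℤ) : ℂ)) = G2 at *
  generalize Gamma (y - m + L) = G3 at *
  generalize Gamma (((m + 1 - L : ℤ) : ℂ) - y) = G4 at *
  generalize Gamma (1 - B + L) = G5 at *
  generalize Gamma (-y + L) = G6 at *
  generalize sin (π * B) = S1 at *
  generalize sin (π * y) = S2 at *
  generalize ((-1 : ℂ) ^ (L - 1 - m)) = ε at *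
  have : S1 * G1 * G2 = -(S2 * G3 * G4) :=
    mul_left_cancel₀ hε (by linear_combination r1 - r2)
  field_simp
  linear_combination G6 * this

/-- The ratio −sin(πy)/sin(πB) of the summands, independent of L, is absorbed into the coefficient
by two more reflections. -/
lemma baseVal_eq {y B : ℂ} (hg : Generic y B) (m : ℤ) :
    baseVal m y B = baseH m y B + baseK m y B * ozsum m (baseS m y B) := by
  have hB : sin (π * B) ≠ 0 := hg.sin_ne_zero 0 1 0 1 (by push_cast; ring) (by simp)
  have hy : sin (π * y) ≠ 0 := hg.sin_ne_zero 1 0 0 1 (by push_cast; ring) (by simp)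
  have hsum : sin (π * B) * ozsum m (baseS m y B) =
      -(sin (π * y)) * ozsum m (fun L => baseZ y B L * baseZ y B (m + 1 - L)) := by
    rw [← ozsum_const_mul, ← ozsum_const_mul]
    exact ozsum_congr fun L => baseS_eq hg m L
  have r1 := hg.sin_mul_Gamma 0 1 0 1 (z := B) (w := 1 - B) (by push_cast; ring) (by simp) rfl
  have r2 := hg.sin_mul_Gamma 1 0 0 1 (z := y) (w := 1 - y) (by push_cast; ring) (by simp) rfl
  have hy0 : y ≠ 0 := hg.ne_zero 1 0 0 1 (by push_cast; ring) (by simp)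
  have hy1 : -y ≠ 0 := neg_ne_zero.2 hy0
  have g1 : Gamma (-y) ≠ 0 := hg.Gamma_ne_zero (-1) 0 0 1 (by push_cast; ring) (by simp)
  have g2 : Gamma B ≠ 0 := hg.Gamma_ne_zero 0 1 0 1 (by push_cast; ring) (by simp)
  have g3 : Gamma (2 * y + 1 - 2 * B) ≠ 0 :=
    hg.Gamma_ne_zero 2 (-2) 1 1 (by push_cast; ring) (by simp)
  have g4 : Gamma (m + 1 - y) ≠ 0 :=
    hg.Gamma_ne_zero (-1) 0 (m + 1) 1 (by push_cast; ring) (by simp)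
  have e1 : 1 - y = -y + 1 := by ring
  rw [e1, Complex.Gamma_add_one _ hy1] at r2
  have key : sin (π * y) * baseK m y B = -(sin (π * B)) * baseCoeff m y B := by
    simp only [baseK, baseCoeff]
    rw [add_comm 1 y, Complex.Gamma_add_one _ hy0]
    generalize Gamma (2 * y + 1 - 2 * B) = G1 at *
    generalize Gamma (-y) = G2 at *
    generalize Gamma (m + 1 - y) = G3 at *
    generalize Gamma (2 * y + 1 - B) = G4 at *
    field_simp
    linear_combination (G4 * Gamma (2 + m - 2 * B)) * (r2 - r1)
  rw [baseVal]
  have : sin (π * B) * (baseCoeff m y B * ozsum m (fun L => baseZ y B L * baseZ y B (m + 1 - L))) =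
      sin (π * B) * (baseK m y B * ozsum m (baseS m y B)) := by
    refine mul_left_cancel₀ hy ?_
    linear_combination (sin (π * B) * baseCoeff m y B) * hsum -
      (sin (π * B) * ozsum m (baseS m y B)) * key
  rw [mul_left_cancel₀ hB this]

lemma IsHypergeometric.base_closed {F : Params → ℂ} (hF : IsHypergeometric F) {y B : ℂ}
    (hg : Generic y B) (m : ℤ) :
    F (2 * y - m, y, B, 2 * y + 1 - B, y + 1) =
      baseH m y B + baseK m y B * ozsum m (baseS m y B) := by
  rw [← baseVal_eq hg]; exact hF.base hg m

/-! ### Transforms of the basic family -/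

/-- One Thomae–Kummer step that keeps the upper parameter 2y − m, surrounded by permutations of the
parameters. It serves `family4` and `family9`. -/
lemma IsHypergeometric.base_unitUpper {F : Params → ℂ} (hF : IsHypergeometric F) {y B : ℂ}
    (hg : Generic y B) (m : ℤ) :
    F (2 * y - m, y + 1 - B, 1, 2 * y + 2 - 2 * B, y + 1) =
      Gamma (2 * y + 2 - 2 * B) * Gamma (1 + m - B) /
        (Gamma (2 + m - 2 * B) * Gamma (2 * y + 1 - B)) *
        (baseH m y B + baseK m y B * ozsum m (baseS m y B)) := by
  have hd : ((2 * y - m, y + 1 - B, 1, 2 * y + 2 - 2 * B, y + 1) : Params) ∈ domain :=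
    ⟨hg.nonPole 2 (-2) 2 1 (by push_cast; ring) (by simp),
      hg.nonPole 1 0 1 1 (by push_cast; ring) (by simp),
      hg.nonPole 0 (-1) (m + 1) 1 (by simp only [excess]; push_cast; ring) (by simp)⟩
  have h1 := hF.swap_lower hd
  have hd1 : ((2 * y - m, y + 1 - B, 1, y + 1, 2 * y + 2 - 2 * B) : Params) ∈ domain :=
    ⟨hd.2.1, hd.1, hg.nonPole 0 (-1) (m + 1) 1 (by simp only [excess]; push_cast; ring) (by simp)⟩
  have h2 := hF.swap_left hd1
  have hd2 : ((y + 1 - B, 2 * y - m, 1, y + 1, 2 * y + 2 - 2 * B) : Params) ∈ domain :=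
    ⟨hd.2.1, hd.1, hg.nonPole 0 (-1) (m + 1) 1 (by simp only [excess]; push_cast; ring) (by simp)⟩
  have h3 := hF.swap_right hd2
  have h4 := hF.thomae (a := y + 1 - B) (b := 1) (c := 2 * y - m) (e := y + 1)
    (f := 2 * y + 2 - 2 * B) hd.2.1 hd.1
    (hg.nonPole 0 (-1) (m + 1) 1 (by push_cast; ring) (by simp))
    (hg.nonPole 0 (-2) (m + 2) 1 (by push_cast; ring) (by simp))
    (hg.nonPole 2 (-1) 1 1 (by push_cast; ring) (by simp))
  rw [show y + 1 + (2 * y + 2 - 2 * B) - (y + 1 - B) - 1 - (2 * y - m) = 1 + m - B by ring,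
    show y + 1 + (2 * y + 2 - 2 * B) - (y + 1 - B) - 1 = 2 * y + 1 - B by ring,
    show 2 * y + 2 - 2 * B - (2 * y - m) = 2 + m - 2 * B by ring,
    show y + 1 - (y + 1 - B) = B by ring, show y + 1 - 1 = y by ring] at h4
  have hb := baseParams_mem_domain hg m
  rw [h1, h2, h3, h4, ← hF.base_closed hg m, hF.swap_lower hb]
  have hb1 : ((2 * y - m, y, B, y + 1, 2 * y + 1 - B) : Params) ∈ domain :=
    ⟨hb.2.1, hb.1, hg.nonPole 0 (-2) (2 + m) 1 (by simp only [excess]; push_cast; ring) (by simp)⟩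
  have hb2 : ((2 * y - m, B, y, y + 1, 2 * y + 1 - B) : Params) ∈ domain :=
    ⟨hb.2.1, hb.1, hg.nonPole 0 (-2) (2 + m) 1 (by simp only [excess]; push_cast; ring) (by simp)⟩
  have hb3 : ((B, 2 * y - m, y, y + 1, 2 * y + 1 - B) : Params) ∈ domain :=
    ⟨hb.2.1, hb.1, hg.nonPole 0 (-2) (2 + m) 1 (by simp only [excess]; push_cast; ring) (by simp)⟩
  rw [hF.swap_right hb1, hF.swap_left hb2, hF.swap_right hb3]

/-- The Thomae–Kummer step keeping B; it serves `family6` and `family7`. -/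
lemma IsHypergeometric.base_unitShift {F : Params → ℂ} (hF : IsHypergeometric F) {y B : ℂ}
    (hg : Generic y B) (m : ℤ) :
    F (y + 1 - B, 1 + m - B, B, 2 * y + 1 - B, 2 + m - B) =
      Gamma (2 + m - B) * Gamma (y + 1 - B) / (Gamma (2 + m - 2 * B) * Gamma (y + 1)) *
        (baseH m y B + baseK m y B * ozsum m (baseS m y B)) := by
  have h4 := hF.thomae (a := y + 1 - B) (b := 1 + m - B) (c := B) (e := 2 * y + 1 - B)
    (f := 2 + m - B)
    (hg.nonPole 2 (-1) 1 1 (by push_cast; ring) (by simp))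
    (hg.nonPole 0 (-1) (m + 2) 1 (by push_cast; ring) (by simp))
    (hg.nonPole 1 (-1) 1 1 (by push_cast; ring) (by simp))
    (hg.nonPole 0 (-2) (m + 2) 1 (by push_cast; ring) (by simp))
    (hg.nonPole 1 0 1 1 (by push_cast; ring) (by simp))
  rw [show 2 * y + 1 - B + (2 + m - B) - (y + 1 - B) - (1 + m - B) - B = y + 1 - B by ring,
    show 2 * y + 1 - B + (2 + m - B) - (y + 1 - B) - (1 + m - B) = y + 1 by ring,
    show 2 + m - B - B = 2 + m - 2 * B by ring,
    show 2 * y + 1 - B - (y + 1 - B) = y by ring,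
    show 2 * y + 1 - B - (1 + m - B) = 2 * y - m by ring] at h4
  rw [h4, ← hF.base_closed hg m, hF.swap_left (baseParams_mem_domain hg m)]

/-- Again the parameter kept is 2y − m, but with 2y + 1 − B as the retained lower parameter. It
serves `family3` and `family8`. -/
lemma IsHypergeometric.base_halfShift {F : Params → ℂ} (hF : IsHypergeometric F) {y B : ℂ}
    (hg : Generic y B) (m : ℤ) :
    F (2 * y + 1 - 2 * B, 2 * y - m, y + 1 - B, 2 * y + 2 - 2 * B, 2 * y + 1 - B) =
      Gamma (2 * y + 2 - 2 * B) * Gamma (1 + m - y) / (Gamma (2 + m - 2 * B) * Gamma (y + 1)) *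
        (baseH m y B + baseK m y B * ozsum m (baseS m y B)) := by
  have hd : ((2 * y + 1 - 2 * B, 2 * y - m, y + 1 - B, 2 * y + 2 - 2 * B, 2 * y + 1 - B) : Params) ∈
      domain :=
    ⟨hg.nonPole 2 (-2) 2 1 (by push_cast; ring) (by simp),
      hg.nonPole 2 (-1) 1 1 (by push_cast; ring) (by simp),
      hg.nonPole (-1) 0 (m + 1) 1 (by simp only [excess]; push_cast; ring) (by simp)⟩
  have h1 := hF.swap_lower hd
  have hd1 : ((2 * y + 1 - 2 * B, 2 * y - m, y + 1 - B, 2 * y + 1 - B, 2 * y + 2 - 2 * B) : Params) ∈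
      domain :=
    ⟨hd.2.1, hd.1, hg.nonPole (-1) 0 (m + 1) 1 (by simp only [excess]; push_cast; ring) (by simp)⟩
  have h2 := hF.swap_right hd1
  have h4 := hF.thomae (a := 2 * y + 1 - 2 * B) (b := y + 1 - B) (c := 2 * y - m)
    (e := 2 * y + 1 - B) (f := 2 * y + 2 - 2 * B) hd.2.1 hd.1
    (hg.nonPole (-1) 0 (m + 1) 1 (by push_cast; ring) (by simp))
    (hg.nonPole 0 (-2) (m + 2) 1 (by push_cast; ring) (by simp))
    (hg.nonPole 1 0 1 1 (by push_cast; ring) (by simp))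
  rw [show 2 * y + 1 - B + (2 * y + 2 - 2 * B) - (2 * y + 1 - 2 * B) - (y + 1 - B) - (2 * y - m) =
      1 + m - y by ring,
    show 2 * y + 1 - B + (2 * y + 2 - 2 * B) - (2 * y + 1 - 2 * B) - (y + 1 - B) = y + 1 by ring,
    show 2 * y + 2 - 2 * B - (2 * y - m) = 2 + m - 2 * B by ring,
    show 2 * y + 1 - B - (2 * y + 1 - 2 * B) = B by ring,
    show 2 * y + 1 - B - (y + 1 - B) = y by ring] at h4
  have hb := baseParams_mem_domain hg m
  have hb2 : ((2 * y - m, B, y, 2 * y + 1 - B, y + 1) : Params) ∈ domain :=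
    ⟨hb.1, hb.2.1, hg.nonPole 0 (-2) (2 + m) 1 (by simp only [excess]; push_cast; ring) (by simp)⟩
  have hb3 : ((B, 2 * y - m, y, 2 * y + 1 - B, y + 1) : Params) ∈ domain :=
    ⟨hb.1, hb.2.1, hg.nonPole 0 (-2) (2 + m) 1 (by simp only [excess]; push_cast; ring) (by simp)⟩
  rw [h1, h2, h4, ← hF.base_closed hg m, hF.swap_right hb, hF.swap_left hb2, hF.swap_right hb3]

/-- The Thomae–Kummer step keeping y. The transformed series has excess identically 1, so one gamma
factor is Γ(1). It serves `family1` and `family2`. -/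
lemma IsHypergeometric.base_unitExcess {F : Params → ℂ} (hF : IsHypergeometric F) {y B : ℂ}
    (hg : Generic y B) (m : ℤ) :
    F (2 * y + 1 - 2 * B, 1 + m - B, y, y + 2 + m - 2 * B, 2 * y + 1 - B) =
      Gamma (y + 2 + m - 2 * B) / (Gamma (2 + m - 2 * B) * Gamma (y + 1)) *
        (baseH m y B + baseK m y B * ozsum m (baseS m y B)) := by
  have hone : NonPole 1 := nonPole_of_re_pos (by simp)
  have hd : ((2 * y + 1 - 2 * B, 1 + m - B, y, y + 2 + m - 2 * B, 2 * y + 1 - B) : Params) ∈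
      domain :=
    ⟨hg.nonPole 1 (-2) (2 + m) 1 (by push_cast; ring) (by simp),
      hg.nonPole 2 (-1) 1 1 (by push_cast; ring) (by simp), by
      convert hone using 1; simp only [excess]; ring⟩
  have h1 := hF.swap_lower hd
  have h4 := hF.thomae (a := 2 * y + 1 - 2 * B) (b := 1 + m - B) (c := y)
    (e := 2 * y + 1 - B) (f := y + 2 + m - 2 * B) hd.2.1 hd.1
    (by convert hone using 1; ring)
    (hg.nonPole 0 (-2) (m + 2) 1 (by push_cast; ring) (by simp))
    (hg.nonPole 1 0 1 1 (by push_cast; ring) (by simp))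
  rw [show 2 * y + 1 - B + (y + 2 + m - 2 * B) - (2 * y + 1 - 2 * B) - (1 + m - B) - y = 1 by ring,
    show 2 * y + 1 - B + (y + 2 + m - 2 * B) - (2 * y + 1 - 2 * B) - (1 + m - B) = y + 1 by ring,
    show y + 2 + m - 2 * B - y = 2 + m - 2 * B by ring,
    show 2 * y + 1 - B - (2 * y + 1 - 2 * B) = B by ring,
    show 2 * y + 1 - B - (1 + m - B) = 2 * y - m by ring, Complex.Gamma_one, mul_one] at h4
  have hb := baseParams_mem_domain hg m
  have hb2 : ((2 * y - m, B, y, 2 * y + 1 - B, y + 1) : Params) ∈ domain :=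
    ⟨hb.1, hb.2.1, hg.nonPole 0 (-2) (2 + m) 1 (by simp only [excess]; push_cast; ring) (by simp)⟩
  rw [h1, h4, ← hF.base_closed hg m, hF.swap_right hb, hF.swap_left hb2]

end Hyp32

namespace Hyp32

open Complex (Gamma sin cos)
open scoped Real

/-! ### The ten families at parameters in general position -/

lemma two_cpow_mul {x y z : ℂ} (k : ℤ) (h : x + y = z + k) :
    (2 : ℂ) ^ x * 2 ^ y = 2 ^ k * 2 ^ z := by
  rw [← Complex.cpow_add _ _ two_ne_zero, h, Complex.cpow_add _ _ two_ne_zero,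
    Complex.cpow_intCast, mul_comm]

lemma two_cpow_mul_eq {x y : ℂ} {k : ℤ} (h : x + y = k) : (2 : ℂ) ^ x * 2 ^ y = 2 ^ k := by
  rw [← Complex.cpow_add _ _ two_ne_zero, h, Complex.cpow_intCast]

lemma pi_cpow_three_halves : (π : ℂ) ^ (3/2 : ℂ) = π * (√π : ℝ) := by
  have hpi : (π : ℂ) ≠ 0 := Complex.ofReal_ne_zero.2 Real.pi_ne_zero
  rw [show (3/2 : ℂ) = 1 + ((1/2 : ℝ) : ℂ) by push_cast; norm_num, Complex.cpow_add _ _ hpi,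
    Complex.cpow_one, ← Complex.ofReal_cpow Real.pi_pos.le, ← Real.sqrt_eq_rpow]

lemma ofReal_sqrt_pi_mul_self : ((√π : ℝ) : ℂ) * (√π : ℝ) = π := by
  rw [← Complex.ofReal_mul, Real.mul_self_sqrt Real.pi_pos.le]

lemma two_cpow_ne_zero (z : ℂ) : (2 : ℂ) ^ z ≠ 0 := by simp [Complex.cpow_eq_zero_iff]

lemma Gamma_duplication {s t u : ℂ} (ht : t = s + 1 / 2) (hu : u = 2 * s) :
    Gamma s * Gamma t = Gamma u * 2 ^ (1 - 2 * s) * (√π : ℝ) := by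
  rw [ht, hu, Complex.Gamma_mul_Gamma_add_half]

lemma Gamma_reflection_shift' {z w z' w' : ℂ} (k : ℤ) (hw : w = 1 - z) (hz' : z' = z + k)
    (hw' : w' = 1 - z') : Gamma z * Gamma w = (-1) ^ k * (Gamma z' * Gamma w') := by
  rw [hw, hw', hz', ← Gamma_reflection_shift]

/-- Here, and for `baseK` below, the gamma arguments are put in the shape they have in the stated
values, so that comparing coefficients becomes a polynomial identity in common gamma factors. -/
lemma baseH_of {m : ℤ} {y B A₁ A₂ A₃ A₄ A₅ A₆ : ℂ} (h₁ : 1 + y = A₁) (h₂ : 1 - B = A₂)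
    (h₃ : 2 * y + 1 - B = A₃) (h₄ : y - m = A₄) (h₅ : 1 + y - B = A₅) (h₆ : 2 * y - m = A₆) :
    baseH m y B = 1 / 2 * (Gamma A₁ * Gamma A₂ * Gamma A₃ * Gamma A₄) /
      (Gamma A₅ ^ 2 * Gamma A₆) := by
  rw [baseH, h₅, h₁, h₂, h₃, h₄, h₆]

lemma baseK_of {m : ℤ} {y B A₁ A₂ A₃ A₄ A₅ A₆ : ℂ} (h₁ : 1 + y = A₁) (h₂ : 2 * y + 1 - B = A₂)
    (h₃ : 2 + m - 2 * B = A₃) (h₄ : B = A₄) (h₅ : 2 * y + 1 - 2 * B = A₅)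
    (h₆ : m + 1 - y = A₆) :
    baseK m y B = -(1 / 2) * (Gamma A₁ * Gamma A₂ * Gamma A₃) /
      (Gamma A₄ * Gamma A₅ * Gamma A₆) := by
  rw [baseK, h₁, h₂, h₃, h₅, h₆, h₄]

/-- The pattern of all ten: m is read off the range of summation, y and B from the parameters, and
the prefactor times `baseH` (in `h1`) and times `baseK` (in `h2`) is compared with the two stated
coefficients. Here only `h1` needs a gamma identity, one reflection, which yields the cosine. -/
lemma IsHypergeometric.family1 {F : Params → ℂ} (hF : IsHypergeometric F) {a b : ℂ}
    (hg : Generic a b) (n : ℕ) : F (params1 n a b) = value1 n a b := by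
  obtain ⟨m, hm⟩ : ∃ m : ℤ, m = -n - 2 := ⟨_, rfl⟩
  have hmc : (m : ℂ) = -n - 2 := by rw [hm]; push_cast; ring
  obtain ⟨y, hy⟩ : ∃ y : ℂ, y = a / 2 - n - 3 / 2 - b := ⟨_, rfl⟩
  obtain ⟨B, hB⟩ : ∃ B : ℂ, B = -n - 1 - b := ⟨_, rfl⟩
  -- An integer relation between y, B and 1 is rewritten as one between a, b and 1; its coefficients
  -- vanish only if the original ones do.
  have hyb : Generic y B := by
    intro p q r h
    have := hg (p) (-2 * p - 2 * q)
      (2 * r + 2 * p * n + 3 * p + 2 * q * n + 2 * q)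
      (by push_cast; rw [← h, hy, hB]; ring)
    omega
  have e : params1 n a b =
      (2 * y + 1 - 2 * B, 1 + m - B, y, y + 2 + m - 2 * B, 2 * y + 1 - B) := by
    simp only [params1, Prod.mk.injEq, hy, hB, hmc]
    refine ⟨?_, ?_, ?_, ?_, ?_⟩ <;> first | trivial | ring
  have hs : (∑ L ∈ Finset.range (n + 2), Gamma (-a/2 + b + 1/2 + L) * Gamma (-b - n - 1 + L) /
    (Gamma (a/2 - b - 1/2 - n + L) * Gamma (b + 1 + L))) = -ozsum m (baseS m y B) := by
    have h := sum_range_eq_ozsum n fun L => Gamma (-a/2 + b + 1/2 + L) * Gamma (-b - n - 1 + L) /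
      (Gamma (a/2 - b - 1/2 - n + L) * Gamma (b + 1 + L))
    simp only [Int.cast_natCast] at h
    rw [h, ← hm]
    congr 1
    refine ozsum_congr fun L => ?_
    simp only [baseS]
    rw [mul_comm (Gamma (B - 1 - m + L)), mul_comm (Gamma (1 - B + L))]
    congr 3 <;> push_cast <;> (try simp only [hy, hB, hmc]) <;> ring
  have g1 : Gamma (a/2 + 1/2) ≠ 0 :=
    hg.Gamma_ne_zero 1 0 1 2 (by push_cast; ring) (by simp)
  have g2 : Gamma (-2*b - n + a - 1) ≠ 0 :=
    hg.Gamma_ne_zero 1 (-2) (-n - 1) 1 (by push_cast; ring) (by simp)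
  have g3 : Gamma (-b - n - 1) ≠ 0 :=
    hg.Gamma_ne_zero 0 (-1) (-n - 1) 1 (by push_cast; ring) (by simp)
  have g4 : Gamma a ≠ 0 :=
    hg.Gamma_ne_zero 1 0 0 1 (by push_cast; ring) (by simp)
  have g5 : Gamma (-a/2 + b + 1/2) ≠ 0 :=
    hg.Gamma_ne_zero (-1) 2 1 2 (by push_cast; ring) (by simp)
  have g6 : Gamma (2 + n + 2*b) ≠ 0 :=
    hg.Gamma_ne_zero 0 2 (n + 2) 1 (by push_cast; ring) (by simp)
  have g7 : Gamma (a/2 - n - 1/2 - b) ≠ 0 :=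
    hg.Gamma_ne_zero 1 (-2) (-2 * n - 1) 2 (by push_cast; ring) (by simp)
  have hpi : (π : ℂ) ≠ 0 := Complex.ofReal_ne_zero.2 Real.pi_ne_zero
  have r1 := hg.sin_mul_Gamma 1 (-2) 1 2 (z := a/2 + 1/2 - b) (w := -a/2 + b + 1/2)
    (by push_cast; ring) (by simp) (by ring)
  rw [show (π : ℂ) * (a/2 + 1/2 - b) = -(π/2 * (2*b - a)) + π / 2 by ring,
    Complex.sin_add_pi_div_two, Complex.cos_neg] at r1
  have hcos : cos (π/2 * (2*b - a)) ≠ 0 := fun h => hpi (by rw [← r1, h, mul_zero])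
  have h1 : Gamma (a/2 + b + 1/2) / (Gamma (2 + n + 2*b) * Gamma (a/2 - n - 1/2 - b)) * baseH m y B
    = 1/2 * (Gamma (a/2 + b + 1/2) * Gamma (b + n + 2) * Gamma (a - b - 1 - n) * π) / (cos (π/2 *
    (2*b - a)) * Gamma (-a/2 + b + 1/2) * Gamma (a/2 + 1/2) ^ 2 * Gamma (2 + n + 2*b) *
    Gamma (-2*b - n + a - 1)) := by
    rw [baseH_of (A₁ := a/2 - n - 1/2 - b) (A₂ := b + n + 2) (A₃ := a - b - 1 - n)
      (A₄ := a/2 + 1/2 - b) (A₅ := a/2 + 1/2) (A₆ := -2*b - n + a - 1) (by rw [hy]; ring)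
      (by rw [hB]; ring) (by rw [hy, hB]; ring) (by rw [hy, hmc]; ring)
      (by rw [hy, hB]; ring) (by rw [hy, hmc]; ring), div_mul_div_comm, div_eq_div_iff
      (by repeat' first | assumption | apply pow_ne_zero | apply mul_ne_zero)
      (by repeat' first | assumption | apply pow_ne_zero | apply mul_ne_zero)]
    linear_combination (1/2 * Gamma (a/2 + b + 1/2) * Gamma (a/2 - n - 1/2 - b) * Gamma (b + n + 2)
      * Gamma (a - b - 1 - n) * Gamma (a/2 + 1/2) ^ 2 * Gamma (2 + n + 2*b) *
      Gamma (-2*b - n + a - 1)) * r1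
  have h2 : Gamma (a/2 + b + 1/2) / (Gamma (2 + n + 2*b) * Gamma (a/2 - n - 1/2 - b)) * baseK m y B
    = -(1/2) * (Gamma (a/2 + b + 1/2) * Gamma (a - b - 1 - n)) / (Gamma (-b - n - 1) * Gamma a *
    Gamma (-a/2 + b + 1/2)) := by
    rw [baseK_of (A₁ := a/2 - n - 1/2 - b) (A₂ := a - b - 1 - n) (A₃ := 2 + n + 2*b)
      (A₄ := -b - n - 1) (A₅ := a) (A₆ := -a/2 + b + 1/2) (by rw [hy]; ring)
      (by rw [hy, hB]; ring) (by rw [hmc, hB]; ring) (by rw [hB]; ring)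
      (by rw [hy, hB]; ring) (by rw [hmc, hy]; ring), div_mul_div_comm, div_eq_div_iff
      (by repeat' first | assumption | apply pow_ne_zero | apply mul_ne_zero)
      (by repeat' first | assumption | apply pow_ne_zero | apply mul_ne_zero)]
    ring
  have h := hF.base_unitExcess hyb m
  rw [← e, show y + 2 + m - 2 * B = a/2 + b + 1/2 by rw [hy, hB, hmc]; ring,
    show 2 + m - 2 * B = 2 + n + 2*b by rw [hB, hmc]; ring,
    show y + 1 = a/2 - n - 1/2 - b by rw [hy]; ring] at h
  rw [h, value1, hs]
  linear_combination h1 + ozsum m (baseS m y B) * h2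

/-- The trigonometric factors over π² in front of the sum come from two reflections, the shift by n
giving the sign (−1)^n. -/
lemma IsHypergeometric.family2 {F : Params → ℂ} (hF : IsHypergeometric F) {a b : ℂ}
    (hg : Generic a b) (n : ℕ) : F (params2 n a b) = value2 n a b := by
  obtain ⟨m, hm⟩ : ∃ m : ℤ, m = n - 2 := ⟨_, rfl⟩
  have hmc : (m : ℂ) = n - 2 := by rw [hm]; push_cast; ring
  obtain ⟨y, hy⟩ : ∃ y : ℂ, y = a / 2 + n - 3 / 2 - b := ⟨_, rfl⟩
  obtain ⟨B, hB⟩ : ∃ B : ℂ, B = n - 1 - b := ⟨_, rfl⟩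
  have hyb : Generic y B := by
    intro p q r h
    have := hg (p) (-2 * p - 2 * q)
      (2 * r - 2 * p * n + 3 * p - 2 * q * n + 2 * q)
      (by push_cast; rw [← h, hy, hB]; ring)
    omega
  have e : params2 n a b =
      (2 * y + 1 - 2 * B, 1 + m - B, y, y + 2 + m - 2 * B, 2 * y + 1 - B) := by
    simp only [params2, Prod.mk.injEq, hy, hB, hmc]
    refine ⟨?_, ?_, ?_, ?_, ?_⟩ <;> first | trivial | ring
  have hs : (osum n fun L => Gamma (3/2 - a/2 + b - n + L) * Gamma (-b + L) /
    (Gamma (1/2 + a/2 - b + L) * Gamma (2 + b - n + L))) = ozsum m (baseS m y B) := by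
    rw [osum_eq_ozsum, ← hm]
    refine ozsum_congr fun L => ?_
    simp only [baseS]
    rw [mul_comm (Gamma (B - 1 - m + L)), mul_comm (Gamma (1 - B + L))]
    congr 3 <;> (try simp only [hy, hB, hmc]) <;> ring
  have g1 : Gamma (a/2 + 1/2) ≠ 0 :=
    hg.Gamma_ne_zero 1 0 1 2 (by push_cast; ring) (by simp)
  have g2 : Gamma (n + a - 2*b - 1) ≠ 0 :=
    hg.Gamma_ne_zero 1 (-2) (n - 1) 1 (by push_cast; ring) (by simp)
  have g3 : Gamma (n - 1 - b) ≠ 0 :=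
    hg.Gamma_ne_zero 0 (-1) (n - 1) 1 (by push_cast; ring) (by simp)
  have g4 : Gamma a ≠ 0 :=
    hg.Gamma_ne_zero 1 0 0 1 (by push_cast; ring) (by simp)
  have g5 : Gamma (1/2 + b - a/2) ≠ 0 :=
    hg.Gamma_ne_zero (-1) 2 1 2 (by push_cast; ring) (by simp)
  have g6 : Gamma (-n + 2*b + 2) ≠ 0 :=
    hg.Gamma_ne_zero 0 2 (-n + 2) 1 (by push_cast; ring) (by simp)
  have g7 : Gamma (a/2 + n - 1/2 - b) ≠ 0 :=
    hg.Gamma_ne_zero 1 (-2) (2 * n - 1) 2 (by push_cast; ring) (by simp)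
  have hpi : (π : ℂ) ≠ 0 := Complex.ofReal_ne_zero.2 Real.pi_ne_zero
  have h1 : Gamma (a/2 + b + 1/2) / (Gamma (-n + 2*b + 2) * Gamma (a/2 + n - 1/2 - b)) * baseH m y B
    = 1/2 * (Gamma (a/2 - b + 1/2) * Gamma (a/2 + b + 1/2) * Gamma (b - n + 2) *
    Gamma (n + a - b - 1)) / (Gamma (a/2 + 1/2) ^ 2 * Gamma (n + a - 2*b - 1) *
    Gamma (-n + 2*b + 2)) := by
    rw [baseH_of (A₁ := a/2 + n - 1/2 - b) (A₂ := b - n + 2) (A₃ := n + a - b - 1)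
      (A₄ := a/2 - b + 1/2) (A₅ := a/2 + 1/2) (A₆ := n + a - 2*b - 1) (by rw [hy]; ring)
      (by rw [hB]; ring) (by rw [hy, hB]; ring) (by rw [hy, hmc]; ring)
      (by rw [hy, hB]; ring) (by rw [hy, hmc]; ring), div_mul_div_comm, div_eq_div_iff
      (by repeat' first | assumption | apply pow_ne_zero | apply mul_ne_zero)
      (by repeat' first | assumption | apply pow_ne_zero | apply mul_ne_zero)]
    ring
  have h2 : Gamma (a/2 + b + 1/2) / (Gamma (-n + 2*b + 2) * Gamma (a/2 + n - 1/2 - b)) * baseK m y B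
    = -(1/2) * Gamma (a/2 - b + 1/2) * Gamma (b - n + 2) * Gamma (a/2 + b + 1/2) *
    Gamma (n + a - b - 1) * sin (π * b) * (-1) ^ n * cos (π * (a/2 - b)) / (Gamma a * π ^ 2) := by
    have r1 := hg.sin_mul_Gamma 1 (-2) 1 2 (z := a/2 - b + 1/2) (w := 1/2 + b - a/2)
      (by push_cast; ring) (by simp) (by ring)
    rw [show (π : ℂ) * (a/2 - b + 1/2) = π * (a/2 - b) + π / 2 by ring, Complex.sin_add_pi_div_two]
      at r1
    have r2 := hg.sin_mul_Gamma 0 1 (2 - n) 1 (z := b - n + 2) (w := n - 1 - b) (by push_cast; ring)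
      (by simp) (by ring)
    rw [show (π : ℂ) * (b - n + 2) = π * b - n * π + 2 * π by ring, Complex.sin_add_two_pi,
      Complex.sin_antiperiodic.sub_nat_mul_eq] at r2
    rw [baseK_of (A₁ := a/2 + n - 1/2 - b) (A₂ := n + a - b - 1) (A₃ := -n + 2*b + 2)
      (A₄ := n - 1 - b) (A₅ := a) (A₆ := 1/2 + b - a/2) (by rw [hy]; ring)
      (by rw [hy, hB]; ring) (by rw [hmc, hB]; ring) (by rw [hB])
      (by rw [hy, hB]; ring) (by rw [hmc, hy]; ring), div_mul_div_comm, div_eq_div_iff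
      (by repeat' first | assumption | apply pow_ne_zero | apply mul_ne_zero)
      (by repeat' first | assumption | apply pow_ne_zero | apply mul_ne_zero)]
    linear_combination (-(1/2) * Gamma (a/2 + b + 1/2) * Gamma (a/2 + n - 1/2 - b) *
      Gamma (n + a - b - 1) * Gamma (-n + 2*b + 2) * Gamma a) * (-(Gamma (b - n + 2) *
      Gamma (n - 1 - b) * ((-1) ^ n * sin (π * b))) * r1 - π * r2)
  have h := hF.base_unitExcess hyb m
  rw [← e, show y + 2 + m - 2 * B = a/2 + b + 1/2 by rw [hy, hB, hmc]; ring,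
    show 2 + m - 2 * B = -n + 2*b + 2 by rw [hB, hmc]; ring,
    show y + 1 = a/2 + n - 1/2 - b by rw [hy]; ring] at h
  rw [h, value2, hs]
  linear_combination h1 + ozsum m (baseS m y B) * h2

/-- Reflection gives the sine, duplication of Γ(1 + a) the power of 2 and √π; the factor a is Γ(1 +
a)/Γ(a). -/
lemma IsHypergeometric.family3 {F : Params → ℂ} (hF : IsHypergeometric F) {a b : ℂ}
    (hg : Generic a b) (n : ℕ) : F (params3 n a b) = value3 n a b := by
  obtain ⟨m, hm⟩ : ∃ m : ℤ, m = -n - 2 := ⟨_, rfl⟩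
  have hmc : (m : ℂ) = -n - 2 := by rw [hm]; push_cast; ring
  obtain ⟨y, hy⟩ : ∃ y : ℂ, y = (b - n) / 2 - 1 := ⟨_, rfl⟩
  obtain ⟨B, hB⟩ : ∃ B : ℂ, B = (b - n - 1 - a) / 2 := ⟨_, rfl⟩
  have hyb : Generic y B := by
    intro p q r h
    have := hg (-q) (p + q)
      (2 * r + p * n + 2 * p + q * n + q)
      (by push_cast; rw [← h, hy, hB]; ring)
    omega
  have e : params3 n a b =
      (2 * y + 1 - 2 * B, 2 * y - m, y + 1 - B, 2 * y + 2 - 2 * B, 2 * y + 1 - B) := by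
    simp only [params3, Prod.mk.injEq, hy, hB, hmc]
    refine ⟨?_, ?_, ?_, ?_, ?_⟩ <;> first | trivial | ring
  have hs : (∑ L ∈ Finset.range (n + 2), Gamma (-a/2 - n/2 - 1/2 + b/2 + L) * Gamma (-b/2 - n/2 + L)
    / (Gamma (a/2 - n/2 + 1/2 - b/2 + L) * Gamma (b/2 - n/2 + L))) = -ozsum m (baseS m y B) := by
    have h := sum_range_eq_ozsum n fun L => Gamma (-a/2 - n/2 - 1/2 + b/2 + L) *
      Gamma (-b/2 - n/2 + L) / (Gamma (a/2 - n/2 + 1/2 - b/2 + L) * Gamma (b/2 - n/2 + L))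
    simp only [Int.cast_natCast] at h
    rw [h, ← hm]
    congr 1
    refine ozsum_congr fun L => ?_
    simp only [baseS]
    congr 3 <;> push_cast <;> (try simp only [hy, hB, hmc]) <;> ring
  have g1 : Gamma (a/2 + 1/2) ≠ 0 :=
    hg.Gamma_ne_zero 1 0 1 2 (by push_cast; ring) (by simp)
  have g2 : Gamma b ≠ 0 :=
    hg.Gamma_ne_zero 0 1 0 1 (by push_cast; ring) (by simp)
  have g3 : Gamma (-a/2 - n/2 - 1/2 + b/2) ≠ 0 :=
    hg.Gamma_ne_zero (-1) 1 (-n - 1) 2 (by push_cast; ring) (by simp)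
  have g4 : Gamma a ≠ 0 :=
    hg.Gamma_ne_zero 1 0 0 1 (by push_cast; ring) (by simp)
  have g5 : Gamma (-(b + n) / 2) ≠ 0 :=
    hg.Gamma_ne_zero 0 (-1) (-n) 2 (by push_cast; ring) (by simp)
  have g6 : Gamma (1 + a - b) ≠ 0 :=
    hg.Gamma_ne_zero 1 (-1) 1 1 (by push_cast; ring) (by simp)
  have g7 : Gamma ((b - n) / 2) ≠ 0 :=
    hg.Gamma_ne_zero 0 1 (-n) 2 (by push_cast; ring) (by simp)
  have hpi : (π : ℂ) ≠ 0 := Complex.ofReal_ne_zero.2 Real.pi_ne_zero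
  have rs := hg.sin_mul_Gamma 0 (-1) (-n) 2 (z := -(b + n) / 2) (w := (b + n) / 2 + 1)
    (by push_cast; ring) (by simp) (by ring)
  rw [show (π : ℂ) * (-(b + n) / 2) = -(π/2 * (b + n)) by ring, Complex.sin_neg] at rs
  have hsin : sin (π/2 * (b + n)) ≠ 0 := fun h => hpi (by rw [← rs, h, neg_zero, mul_zero])
  have h1 : Gamma (1 + a) * Gamma (-(b + n) / 2) / (Gamma (1 + a - b) * Gamma ((b - n) / 2)) * baseH
    m y B = -(1/2) * (Gamma (a/2 - n/2 - 1/2 + b/2) * Gamma (a/2 + n/2 + 3/2 - b/2) * (√π : ℝ) * 2 ^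
    a * Gamma (1 + a/2)) / (Gamma b * Gamma (1 + a - b) * Gamma (a/2 + 1/2) * sin (π/2 * (b + n)))
    := by
    have d := Gamma_duplication (s := a/2 + 1/2) (t := 1 + a/2) (u := 1 + a) (by ring) (by ring)
    have q : (2 : ℂ) ^ a * 2 ^ (1 - 2 * (a/2 + 1/2)) = 2 ^ (0 : ℤ) := two_cpow_mul_eq
      (by push_cast; ring)
    have rR : ((√π : ℝ) : ℂ) * (√π : ℝ) = π := ofReal_sqrt_pi_mul_self
    rw [baseH_of (A₁ := (b - n) / 2) (A₂ := a/2 + n/2 + 3/2 - b/2) (A₃ := a/2 - n/2 - 1/2 + b/2) (A₄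
      := (b + n) / 2 + 1) (A₅ := a/2 + 1/2) (A₆ := b) (by rw [hy]; ring) (by rw [hB]; ring)
      (by rw [hy, hB]; ring) (by rw [hy, hmc]; ring) (by rw [hy, hB]; ring)
      (by rw [hy, hmc]; ring), div_mul_div_comm, div_eq_div_iff
      (by repeat' first | assumption | apply pow_ne_zero | apply mul_ne_zero)
      (by repeat' first | assumption | apply pow_ne_zero | apply mul_ne_zero)]
    linear_combination (Gamma ((b - n) / 2) * Gamma (a/2 + n/2 + 3/2 - b/2) *
      Gamma (a/2 - n/2 - 1/2 + b/2) * Gamma (1 + a - b) * Gamma (a/2 + 1/2) * Gamma b) * (-(1/2) *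
      Gamma (1 + a) * rs + 1/2 * (√π : ℝ) * 2 ^ a * d + 1/2 * (√π : ℝ) * (√π : ℝ) * Gamma (1 + a) *
      q + 1/2 * Gamma (1 + a) * rR)
  have h2 : Gamma (1 + a) * Gamma (-(b + n) / 2) / (Gamma (1 + a - b) * Gamma ((b - n) / 2)) * baseK
    m y B = -(1/2) * (Gamma (a/2 - n/2 - 1/2 + b/2) * a) / Gamma (-a/2 - n/2 - 1/2 + b/2) := by
    have ga : Gamma (1 + a) = a * Gamma a := by
      rw [add_comm, Complex.Gamma_add_one _ (hg.ne_zero 1 0 0 1 (by push_cast; ring) (by simp))]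
    rw [baseK_of (A₁ := (b - n) / 2) (A₂ := a/2 - n/2 - 1/2 + b/2) (A₃ := 1 + a - b)
      (A₄ := -a/2 - n/2 - 1/2 + b/2) (A₅ := a) (A₆ := -(b + n) / 2) (by rw [hy]; ring)
      (by rw [hy, hB]; ring) (by rw [hmc, hB]; ring) (by rw [hB]; ring)
      (by rw [hy, hB]; ring) (by rw [hmc, hy]; ring), div_mul_div_comm, div_eq_div_iff
      (by repeat' first | assumption | apply pow_ne_zero | apply mul_ne_zero)
      (by repeat' first | assumption | apply pow_ne_zero | apply mul_ne_zero)]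
    linear_combination (-(1/2) * Gamma (-(b + n) / 2) * Gamma ((b - n) / 2) *
      Gamma (a/2 - n/2 - 1/2 + b/2) * Gamma (1 + a - b) * Gamma (-a/2 - n/2 - 1/2 + b/2)) * ga
  have h := hF.base_halfShift hyb m
  rw [← e, show 2 * y + 2 - 2 * B = 1 + a by rw [hy, hB]; ring,
    show 1 + m - y = -(b + n) / 2 by rw [hy, hmc]; ring,
    show 2 + m - 2 * B = 1 + a - b by rw [hB, hmc]; ring, show y + 1 = (b - n) / 2 by rw [hy]; ring]
    at h
  rw [h, value3, hs]
  linear_combination h1 + ozsum m (baseS m y B) * h2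

/-- Duplication is applied to Γ(2b), and b − 1/2 is half of Γ(2b)/Γ(2b − 1). -/
lemma IsHypergeometric.family4 {F : Params → ℂ} (hF : IsHypergeometric F) {a b : ℂ}
    (hg : Generic a b) (n : ℕ) : F (params4 n a b) = value4 n a b := by
  obtain ⟨m, hm⟩ : ∃ m : ℤ, m = -n - 2 := ⟨_, rfl⟩
  have hmc : (m : ℂ) = -n - 2 := by rw [hm]; push_cast; ring
  obtain ⟨y, hy⟩ : ∃ y : ℂ, y = (a - n) / 2 - 1 := ⟨_, rfl⟩
  obtain ⟨B, hB⟩ : ∃ B : ℂ, B = (a - n) / 2 - b := ⟨_, rfl⟩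
  have hyb : Generic y B := by
    intro p q r h
    have := hg (p + q) (-2 * q)
      (2 * r + p * n + 2 * p + q * n)
      (by push_cast; rw [← h, hy, hB]; ring)
    omega
  have e : params4 n a b =
      (2 * y - m, y + 1 - B, 1, 2 * y + 2 - 2 * B, y + 1) := by
    simp only [params4, Prod.mk.injEq, hy, hB, hmc]
    refine ⟨?_, ?_, ?_, ?_, ?_⟩ <;> first | trivial | ring
  have hs : (∑ L ∈ Finset.range (n + 2), Gamma (-b - n/2 + a/2 + L) * Gamma (-a/2 - n/2 + L) /
    (Gamma (b - n/2 - a/2 + L) * Gamma (a/2 - n/2 + L))) = -ozsum m (baseS m y B) := by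
    have h := sum_range_eq_ozsum n fun L => Gamma (-b - n/2 + a/2 + L) * Gamma (-a/2 - n/2 + L) /
      (Gamma (b - n/2 - a/2 + L) * Gamma (a/2 - n/2 + L))
    simp only [Int.cast_natCast] at h
    rw [h, ← hm]
    congr 1
    refine ozsum_congr fun L => ?_
    simp only [baseS]
    congr 3 <;> push_cast <;> (try simp only [hy, hB, hmc]) <;> ring
  have g1 : Gamma b ≠ 0 :=
    hg.Gamma_ne_zero 0 1 0 1 (by push_cast; ring) (by simp)
  have g2 : Gamma a ≠ 0 :=
    hg.Gamma_ne_zero 1 0 0 1 (by push_cast; ring) (by simp)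
  have g3 : Gamma (a/2 - b - n/2) ≠ 0 :=
    hg.Gamma_ne_zero 1 (-2) (-n) 2 (by push_cast; ring) (by simp)
  have g4 : Gamma (2 * b - 1) ≠ 0 :=
    hg.Gamma_ne_zero 0 2 (-1) 1 (by push_cast; ring) (by simp)
  have g5 : Gamma (-a/2 - n/2) ≠ 0 :=
    hg.Gamma_ne_zero (-1) 0 (-n) 2 (by push_cast; ring) (by simp)
  have g6 : Gamma (2*b - a) ≠ 0 :=
    hg.Gamma_ne_zero (-1) 2 0 1 (by push_cast; ring) (by simp)
  have g7 : Gamma ((a - n) / 2 - 1 + b) ≠ 0 :=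
    hg.Gamma_ne_zero 1 2 (-n - 2) 2 (by push_cast; ring) (by simp)
  have hpi : (π : ℂ) ≠ 0 := Complex.ofReal_ne_zero.2 Real.pi_ne_zero
  have rs := hg.sin_mul_Gamma (-1) 0 (-n) 2 (z := -a/2 - n/2) (w := (a + n) / 2 + 1)
    (by push_cast; ring) (by simp) (by ring)
  rw [show (π : ℂ) * (-a/2 - n/2) = -(π/2 * (a + n)) by ring, Complex.sin_neg] at rs
  have hsin : sin (π/2 * (a + n)) ≠ 0 := fun h => hpi (by rw [← rs, h, neg_zero, mul_zero])
  have h1 : Gamma (2 * b) * Gamma (b - n/2 - a/2 - 1) / (Gamma (2*b - a) * Gamma ((a - n) / 2 - 1 +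
    b)) * baseH m y B = -((√π : ℝ) * 2 ^ (2*b - 2) * Gamma (a/2 - n/2) * Gamma (b + n/2 - a/2 + 1) *
    Gamma (b + 1/2) * Gamma (b - n/2 - a/2 - 1)) / (Gamma (2*b - a) * Gamma a * sin (π/2 * (a + n))
    * Gamma (-a/2 - n/2) * Gamma b) := by
    have d := Gamma_duplication (s := b) (t := b + 1/2) (u := 2 * b) rfl rfl
    have q : (2 : ℂ) ^ (2*b - 2) * 2 ^ (1 - 2 * b) = 2 ^ (-1 : ℤ) := two_cpow_mul_eq
      (by push_cast; ring)
    have rR : ((√π : ℝ) : ℂ) * (√π : ℝ) = π := ofReal_sqrt_pi_mul_self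
    rw [baseH_of (A₁ := a/2 - n/2) (A₂ := b + n/2 - a/2 + 1) (A₃ := (a - n) / 2 - 1 + b) (A₄ := (a +
      n) / 2 + 1) (A₅ := b) (A₆ := a) (by rw [hy]; ring) (by rw [hB]; ring)
      (by rw [hy, hB]; ring) (by rw [hy, hmc]; ring) (by rw [hy, hB]; ring)
      (by rw [hy, hmc]; ring), div_mul_div_comm, div_eq_div_iff
      (by repeat' first | assumption | apply pow_ne_zero | apply mul_ne_zero)
      (by repeat' first | assumption | apply pow_ne_zero | apply mul_ne_zero)]
    linear_combination (Gamma (b - n/2 - a/2 - 1) * Gamma (a/2 - n/2) * Gamma (b + n/2 - a/2 + 1) *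
      Gamma ((a - n) / 2 - 1 + b) * Gamma (2*b - a) * Gamma a * Gamma b) * (-(1/2) * Gamma (2 * b) *
      rs + (√π : ℝ) * 2 ^ (2*b - 2) * d + (√π : ℝ) * (√π : ℝ) * Gamma (2 * b) * q + 1/2 *
      Gamma (2 * b) * rR)
  have h2 : Gamma (2 * b) * Gamma (b - n/2 - a/2 - 1) / (Gamma (2*b - a) * Gamma ((a - n) / 2 - 1 +
    b)) * baseK m y B = -(Gamma (a/2 - n/2) * (b - 1/2) * Gamma (b - n/2 - a/2 - 1)) /
    (Gamma (a/2 - b - n/2) * Gamma (-a/2 - n/2)) := by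
    have gt : Gamma (2 * b) = (2 * b - 1) * Gamma (2 * b - 1) := by
      rw [← Complex.Gamma_add_one _ (hg.ne_zero 0 2 (-1) 1 (by push_cast; ring) (by simp)),
        sub_add_cancel]
    rw [baseK_of (A₁ := a/2 - n/2) (A₂ := (a - n) / 2 - 1 + b) (A₃ := 2*b - a) (A₄ := a/2 - b - n/2)
      (A₅ := 2 * b - 1) (A₆ := -a/2 - n/2) (by rw [hy]; ring) (by rw [hy, hB]; ring)
      (by rw [hmc, hB]; ring) (by rw [hB]; ring) (by rw [hy, hB]; ring)
      (by rw [hmc, hy]; ring), div_mul_div_comm, div_eq_div_iff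
      (by repeat' first | assumption | apply pow_ne_zero | apply mul_ne_zero)
      (by repeat' first | assumption | apply pow_ne_zero | apply mul_ne_zero)]
    linear_combination (-(1/2) * Gamma (b - n/2 - a/2 - 1) * Gamma (a/2 - n/2) * Gamma ((a - n) / 2
      - 1 + b) * Gamma (2*b - a) * Gamma (a/2 - b - n/2) * Gamma (-a/2 - n/2)) * gt
  have h := hF.base_unitUpper hyb m
  rw [← e, show 2 * y + 2 - 2 * B = 2 * b by rw [hy, hB]; ring,
    show 1 + m - B = b - n/2 - a/2 - 1 by rw [hB, hmc]; ring,
    show 2 + m - 2 * B = 2*b - a by rw [hB, hmc]; ring,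
    show 2 * y + 1 - B = (a - n) / 2 - 1 + b by rw [hy, hB]; ring] at h
  rw [h, value4, hs]
  linear_combination h1 + ozsum m (baseS m y B) * h2

/-- This is the basic family itself. Γ(a) in `baseH` is compared with Γ(a − n) by reflecting both,
which gives (−1)^n, and the latter is split by duplication. -/
lemma IsHypergeometric.family5 {F : Params → ℂ} (hF : IsHypergeometric F) {a b : ℂ}
    (hg : Generic a b) (n : ℕ) : F (params5 n a b) = value5 n a b := by
  obtain ⟨m, hm⟩ : ∃ m : ℤ, m = -n - 2 := ⟨_, rfl⟩
  have hmc : (m : ℂ) = -n - 2 := by rw [hm]; push_cast; ring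
  obtain ⟨y, hy⟩ : ∃ y : ℂ, y = (a - n) / 2 - 1 := ⟨_, rfl⟩
  have hyb : Generic y b := by
    intro p q r h
    have := hg (p) (2 * q)
      (2 * r + p * n + 2 * p)
      (by push_cast; rw [← h, hy]; ring)
    omega
  have e : params5 n a b =
      (2 * y - m, y, b, 2 * y + 1 - b, y + 1) := by
    simp only [params5, Prod.mk.injEq, hy, hmc]
    refine ⟨?_, ?_, ?_, ?_, ?_⟩ <;> first | trivial | ring
  have hs : (∑ L ∈ Finset.range (n + 2), Gamma (b + L) * Gamma (-a/2 - n/2 + L) /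
    (Gamma (-b - n + L) * Gamma (a/2 - n/2 + L))) = -ozsum m (baseS m y b) := by
    have h := sum_range_eq_ozsum n fun L => Gamma (b + L) * Gamma (-a/2 - n/2 + L) /
      (Gamma (-b - n + L) * Gamma (a/2 - n/2 + L))
    simp only [Int.cast_natCast] at h
    rw [h, ← hm]
    congr 1
    refine ozsum_congr fun L => ?_
    simp only [baseS]
    congr 3 <;> push_cast <;> (try simp only [hy, hmc]) <;> ring
  have g1 : Gamma (a/2 - b - n/2) ≠ 0 :=
    hg.Gamma_ne_zero 1 (-2) (-n) 2 (by push_cast; ring) (by simp)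
  have g2 : Gamma a ≠ 0 :=
    hg.Gamma_ne_zero 1 0 0 1 (by push_cast; ring) (by simp)
  have g3 : Gamma b ≠ 0 :=
    hg.Gamma_ne_zero 0 1 0 1 (by push_cast; ring) (by simp)
  have g4 : Gamma (-2*b - n + a - 1) ≠ 0 :=
    hg.Gamma_ne_zero 1 (-2) (-n - 1) 1 (by push_cast; ring) (by simp)
  have g5 : Gamma (-a/2 - n/2) ≠ 0 :=
    hg.Gamma_ne_zero (-1) 0 (-n) 2 (by push_cast; ring) (by simp)
  have g6 : Gamma (1/2 + a/2 - n/2) ≠ 0 :=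
    hg.Gamma_ne_zero 1 0 (-n + 1) 2 (by push_cast; ring) (by simp)
  have g7 : Gamma (n + 1 - a) ≠ 0 :=
    hg.Gamma_ne_zero (-1) 0 (n + 1) 1 (by push_cast; ring) (by simp)
  have hpi : (π : ℂ) ≠ 0 := Complex.ofReal_ne_zero.2 Real.pi_ne_zero
  have hsin : sin (π * b) ≠ 0 := hg.sin_ne_zero 0 1 0 1 (by push_cast; ring) (by simp)
  have h2 := two_cpow_ne_zero (a - n)
  have h1 : baseH m y b = (π : ℂ) ^ (3/2 : ℂ) * (-1) ^ n * Gamma (-a + 1) * Gamma (a/2 + n/2 + 1) *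
    Gamma (a - b - 1 - n) / (sin (π * b) * 2 ^ (a - n) * Gamma (a/2 - b - n/2) ^ 2 *
    Gamma (1/2 + a/2 - n/2) * Gamma (n + 1 - a) * Gamma b) := by
    have d := Gamma_duplication (s := a/2 - n/2) (t := 1/2 + a/2 - n/2) (u := a - n) (by ring)
      (by ring)
    have q : (2 : ℂ) ^ (a - n) * 2 ^ (1 - 2 * (a/2 - n/2)) = 2 ^ (1 : ℤ) := two_cpow_mul_eq
      (by push_cast; ring)
    have rB := hg.sin_mul_Gamma 0 1 0 1 (z := b) (w := 1 - b) (by push_cast; ring) (by simp)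
      (by ring)
    have rA := Gamma_reflection_shift' (z := a - n) (w := n + 1 - a) (z' := a) (w' := -a + 1) n
      (by ring) (by push_cast; ring) (by ring)
    rw [zpow_natCast] at rA
    have tp := pi_cpow_three_halves
    rw [baseH_of (A₁ := a/2 - n/2) (A₂ := 1 - b) (A₃ := a - b - 1 - n) (A₄ := a/2 + n/2 + 1)
      (A₅ := a/2 - b - n/2) (A₆ := a) (by rw [hy]; ring) (by ring) (by rw [hy]; ring)
      (by rw [hy, hmc]; ring) (by rw [hy]; ring) (by rw [hy, hmc]; ring), div_eq_div_iff
      (by repeat' first | assumption | apply pow_ne_zero | apply mul_ne_zero)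
      (by repeat' first | assumption | apply pow_ne_zero | apply mul_ne_zero)]
    linear_combination (Gamma (a - b - 1 - n) * Gamma (a/2 + n/2 + 1) * Gamma (a/2 - b - n/2) ^ 2) *
      (1/2 * 2 ^ (a - n) * Gamma (n + 1 - a) * Gamma (1 - b) * sin (π * b) * Gamma b * d + 1/2 * 2 ^
      (a - n) * Gamma (n + 1 - a) * Gamma (a - n) * 2 ^ (1 - 2 * (a/2 - n/2)) * (√π : ℝ) * rB + 1/2
      * Gamma (n + 1 - a) * π * Gamma (a - n) * (√π : ℝ) * q - (-1) ^ n * Gamma (-a + 1) * Gamma a *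
      tp + π * (√π : ℝ) * rA)
  have h2 : baseK m y b = 1/2 * sin (π/2 * (a + n)) * Gamma (a/2 - n/2) * Gamma (-n - 2*b) *
    Gamma (a/2 + n/2 + 1) * Gamma (a - b - 1 - n) / (π * Gamma (-2*b - n + a - 1) * Gamma b) := by
    have rs := hg.sin_mul_Gamma (-1) 0 (-n) 2 (z := -a/2 - n/2) (w := a/2 + n/2 + 1)
      (by push_cast; ring) (by simp) (by ring)
    rw [show (π : ℂ) * (-a/2 - n/2) = -(π/2 * (a + n)) by ring, Complex.sin_neg] at rs
    rw [baseK_of (A₁ := a/2 - n/2) (A₂ := a - b - 1 - n) (A₃ := -n - 2*b) (A₄ := b)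
      (A₅ := -2*b - n + a - 1) (A₆ := -a/2 - n/2) (by rw [hy]; ring) (by rw [hy]; ring)
      (by rw [hmc]; ring) rfl (by rw [hy]; ring) (by rw [hmc, hy]; ring), div_eq_div_iff
      (by repeat' first | assumption | apply pow_ne_zero | apply mul_ne_zero)
      (by repeat' first | assumption | apply pow_ne_zero | apply mul_ne_zero)]
    linear_combination (-(1/2) * Gamma (a/2 - n/2) * Gamma (a - b - 1 - n) * Gamma (-n - 2*b) *
      Gamma (-2*b - n + a - 1) * Gamma b) * -rs
  rw [e, hF.base_closed hyb, value5, hs, h1, h2]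
  ring

/-- The coefficient without the sum takes three duplications and two reflections shifted by n, whose
signs cancel; the two sides then carry the same power of 2. -/
lemma IsHypergeometric.family6 {F : Params → ℂ} (hF : IsHypergeometric F) {a b : ℂ}
    (hg : Generic a b) (n : ℕ) : F (params6 n a b) = value6 n a b := by
  obtain ⟨m, hm⟩ : ∃ m : ℤ, m = -n - 2 := ⟨_, rfl⟩
  have hmc : (m : ℂ) = -n - 2 := by rw [hm]; push_cast; ring
  obtain ⟨y, hy⟩ : ∃ y : ℂ, y = a - n - 2 - b := ⟨_, rfl⟩
  obtain ⟨B, hB⟩ : ∃ B : ℂ, B = -n - 1 - b := ⟨_, rfl⟩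
  have hyb : Generic y B := by
    intro p q r h
    have := hg (p) (-p - q)
      (r + p * n + 2 * p + q * n + q)
      (by push_cast; rw [← h, hy, hB]; ring)
    omega
  have e : params6 n a b =
      (y + 1 - B, 1 + m - B, B, 2 * y + 1 - B, 2 + m - B) := by
    simp only [params6, Prod.mk.injEq, hy, hB, hmc]
    refine ⟨?_, ?_, ?_, ?_, ?_⟩ <;> first | trivial | ring
  have hs : (∑ L ∈ Finset.range (n + 2), Gamma (-b - n - 1 + L) * Gamma (b - a + 1 + L) /
    (Gamma (b + 1 + L) * Gamma (a - b - 1 - n + L))) = -ozsum m (baseS m y B) := by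
    have h := sum_range_eq_ozsum n fun L => Gamma (-b - n - 1 + L) * Gamma (b - a + 1 + L) /
      (Gamma (b + 1 + L) * Gamma (a - b - 1 - n + L))
    simp only [Int.cast_natCast] at h
    rw [h, ← hm]
    congr 1
    refine ozsum_congr fun L => ?_
    simp only [baseS]
    congr 3 <;> push_cast <;> (try simp only [hy, hB, hmc]) <;> ring
  have g1 : Gamma a ≠ 0 :=
    hg.Gamma_ne_zero 1 0 0 1 (by push_cast; ring) (by simp)
  have g2 : Gamma (2*a - n - 2 - 2*b) ≠ 0 :=
    hg.Gamma_ne_zero 2 (-2) (-n - 2) 1 (by push_cast; ring) (by simp)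
  have g3 : Gamma (-b - n - 1) ≠ 0 :=
    hg.Gamma_ne_zero 0 (-1) (-n - 1) 1 (by push_cast; ring) (by simp)
  have g4 : Gamma (2*a - 1) ≠ 0 :=
    hg.Gamma_ne_zero 2 0 (-1) 1 (by push_cast; ring) (by simp)
  have g5 : Gamma (b - a + 1) ≠ 0 :=
    hg.Gamma_ne_zero (-1) 1 1 1 (by push_cast; ring) (by simp)
  have g6 : Gamma (n + 2 + 2*b) ≠ 0 :=
    hg.Gamma_ne_zero 0 2 (n + 2) 1 (by push_cast; ring) (by simp)
  have g7 : Gamma (a - b - 1 - n) ≠ 0 :=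
    hg.Gamma_ne_zero 1 (-1) (-n - 1) 1 (by push_cast; ring) (by simp)
  have g8 : Gamma (3 + 2*n - 2*a + 2*b) ≠ 0 :=
    hg.Gamma_ne_zero (-2) 2 (2 * n + 3) 1 (by push_cast; ring) (by simp)
  have g9 : Gamma (3/2 + b) ≠ 0 :=
    hg.Gamma_ne_zero 0 2 3 2 (by push_cast; ring) (by simp)
  have g10 : Gamma (-1/2 + a - b - n) ≠ 0 :=
    hg.Gamma_ne_zero 2 (-2) (-2 * n - 1) 2 (by push_cast; ring) (by simp)
  have g11 : Gamma (-1 - 2*b) ≠ 0 :=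
    hg.Gamma_ne_zero 0 (-2) (-1) 1 (by push_cast; ring) (by simp)
  have h1 : Gamma (b + 1) * Gamma a / (Gamma (n + 2 + 2*b) * Gamma (a - b - 1 - n)) * baseH m y B =
    2 ^ (2*(n : ℂ) - 1) * (√π : ℝ) * Gamma (-1 - n - 2*b) * Gamma (3 + n - 2*a + 2*b) *
    Gamma (b + n + 2) * Gamma (a - b) * Gamma (a - 1/2) * Gamma (-b - n - 2 + 2*a) /
    (Gamma (3 + 2*n - 2*a + 2*b) * Gamma (3/2 + b) * Gamma (-1/2 + a - b - n) * Gamma (2*a - 1) *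
    Gamma (a - b - 1 - n) * Gamma (-1 - 2*b)) := by
    have d₁ := Gamma_duplication (s := a - 1/2) (t := a) (u := 2*a - 1) (by ring) (by ring)
    have d₂ := Gamma_duplication (s := a - b - 1 - n) (t := -1/2 + a - b - n) (u := 2*a - 2*b - 2 -
      2*n) (by ring) (by ring)
    have d₃ := Gamma_duplication (s := b + 1) (t := 3/2 + b) (u := 2*b + 2) (by ring) (by ring)
    have r₁ := Gamma_reflection_shift' (z := 2*b + 2) (w := -1 - 2*b) (z' := n + 2 + 2*b) (w' := -1
      - n - 2*b) n (by ring) (by push_cast; ring) (by ring)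
    have r₂ := Gamma_reflection_shift' (z := 2*a - 2*b - 2 - 2*n) (w := 3 + 2*n - 2*a + 2*b) (z' :=
      2*a - n - 2 - 2*b) (w' := 3 + n - 2*a + 2*b) n (by ring) (by push_cast; ring) (by ring)
    have q₁ : (2 : ℂ) ^ (2*(n : ℂ) - 1) * 2 ^ (1 - 2 * (a - 1/2)) = 2 ^ (-1 : ℤ) * 2 ^ (2 - 2 * a +
      2 * n) := two_cpow_mul _ (by push_cast; ring)
    have q₂ : (2 : ℂ) ^ (1 - 2 * (b + 1)) * 2 ^ (1 - 2 * (a - b - 1 - n)) = 2 ^ (0 : ℤ) * 2 ^ (2 - 2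
      * a + 2 * n) := two_cpow_mul _ (by push_cast; ring)
    have e₂ : (-1 : ℂ) ^ (n : ℤ) * (-1) ^ (n : ℤ) = 1 := by
      rw [← mul_zpow]
      norm_num
    rw [baseH_of (A₁ := a - b - 1 - n) (A₂ := b + n + 2) (A₃ := -b - n - 2 + 2*a) (A₄ := a - b)
      (A₅ := a) (A₆ := 2*a - n - 2 - 2*b) (by rw [hy]; ring) (by rw [hB]; ring)
      (by rw [hy, hB]; ring) (by rw [hy, hmc]; ring) (by rw [hy, hB]; ring)
      (by rw [hy, hmc]; ring), div_mul_div_comm, div_eq_div_iff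
      (by repeat' first | assumption | apply pow_ne_zero | apply mul_ne_zero)
      (by repeat' first | assumption | apply pow_ne_zero | apply mul_ne_zero)]
    linear_combination (Gamma a * Gamma (a - b - 1 - n) * Gamma (b + n + 2) *
      Gamma (-b - n - 2 + 2*a) * Gamma (a - b)) * (1/2 * Gamma (3 + 2*n - 2*a + 2*b) *
      Gamma (-1/2 + a - b - n) * Gamma (2*a - 1) * Gamma (a - b - 1 - n) * Gamma (-1 - 2*b) * d₃ +
      1/2 * Gamma (3 + 2*n - 2*a + 2*b) * Gamma (2*a - 1) * Gamma (-1 - 2*b) * Gamma (2*b + 2) * 2 ^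
      (1 - 2 * (b + 1)) * (√π : ℝ) * d₂ + 1/2 * Gamma (2*a - 1) * (√π : ℝ) * (√π : ℝ) * 2 ^ (1 - 2 *
      (b + 1)) * 2 ^ (1 - 2 * (a - b - 1 - n)) * Gamma (2*a - 2*b - 2 - 2*n) *
      Gamma (3 + 2*n - 2*a + 2*b) * r₁ + 1/2 * Gamma (2*a - 1) * (√π : ℝ) * (√π : ℝ) * 2 ^ (1 - 2 *
      (b + 1)) * 2 ^ (1 - 2 * (a - b - 1 - n)) * (-1) ^ (n : ℤ) * Gamma (n + 2 + 2*b) *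
      Gamma (-1 - n - 2*b) * r₂ + 1/2 * Gamma (2*a - 1) * (√π : ℝ) * (√π : ℝ) * 2 ^ (1 - 2 * (b +
      1)) * 2 ^ (1 - 2 * (a - b - 1 - n)) * Gamma (n + 2 + 2*b) * Gamma (-1 - n - 2*b) *
      Gamma (2*a - n - 2 - 2*b) * Gamma (3 + n - 2*a + 2*b) * e₂ + 1/2 * Gamma (2*a - 1) * (√π : ℝ)
      * (√π : ℝ) * Gamma (n + 2 + 2*b) * Gamma (-1 - n - 2*b) * Gamma (2*a - n - 2 - 2*b) *
      Gamma (3 + n - 2*a + 2*b) * q₂ - 2 ^ (2*(n : ℂ) - 1) * (√π : ℝ) * Gamma (-1 - n - 2*b) *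
      Gamma (3 + n - 2*a + 2*b) * Gamma (n + 2 + 2*b) * Gamma (2*a - n - 2 - 2*b) * d₁ - (√π : ℝ) *
      (√π : ℝ) * Gamma (2*a - 1) * Gamma (-1 - n - 2*b) * Gamma (3 + n - 2*a + 2*b) *
      Gamma (n + 2 + 2*b) * Gamma (2*a - n - 2 - 2*b) * q₁)
  have h2 : Gamma (b + 1) * Gamma a / (Gamma (n + 2 + 2*b) * Gamma (a - b - 1 - n)) * baseK m y B =
    -(1/2) * (Gamma a * Gamma (b + 1) * Gamma (-b - n - 2 + 2*a)) / (Gamma (2*a - 1) *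
    Gamma (-b - n - 1) * Gamma (b - a + 1)) := by
    rw [baseK_of (A₁ := a - b - 1 - n) (A₂ := -b - n - 2 + 2*a) (A₃ := n + 2 + 2*b)
      (A₄ := -b - n - 1) (A₅ := 2*a - 1) (A₆ := b - a + 1) (by rw [hy]; ring)
      (by rw [hy, hB]; ring) (by rw [hmc, hB]; ring) (by rw [hB]; ring)
      (by rw [hy, hB]; ring) (by rw [hmc, hy]; ring), div_mul_div_comm, div_eq_div_iff
      (by repeat' first | assumption | apply pow_ne_zero | apply mul_ne_zero)
      (by repeat' first | assumption | apply pow_ne_zero | apply mul_ne_zero)]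
    ring
  have h := hF.base_unitShift hyb m
  rw [← e, show 2 + m - B = b + 1 by rw [hB, hmc]; ring, show y + 1 - B = a by rw [hy, hB]; ring,
    show 2 + m - 2 * B = n + 2 + 2*b by rw [hB, hmc]; ring,
    show y + 1 = a - b - 1 - n by rw [hy]; ring] at h
  rw [h, value6, hs]
  linear_combination h1 + ozsum m (baseS m y B) * h2

/-- In the coefficient of the sum two reflected pairs are shifted by 1 − n, and the two signs
cancel. -/
lemma IsHypergeometric.family7 {F : Params → ℂ} (hF : IsHypergeometric F) {a b : ℂ}
    (hg : Generic a b) (n : ℕ) : F (params7 n a b) = value7 n a b := by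
  obtain ⟨m, hm⟩ : ∃ m : ℤ, m = n - 2 := ⟨_, rfl⟩
  have hmc : (m : ℂ) = n - 2 := by rw [hm]; push_cast; ring
  obtain ⟨y, hy⟩ : ∃ y : ℂ, y = a + n - 2 - b := ⟨_, rfl⟩
  obtain ⟨B, hB⟩ : ∃ B : ℂ, B = n - 1 - b := ⟨_, rfl⟩
  have hyb : Generic y B := by
    intro p q r h
    have := hg (p) (-p - q)
      (r - p * n + 2 * p - q * n + q)
      (by push_cast; rw [← h, hy, hB]; ring)
    omega
  have e : params7 n a b =
      (y + 1 - B, 1 + m - B, B, 2 * y + 1 - B, 2 + m - B) := by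
    simp only [params7, Prod.mk.injEq, hy, hB, hmc]
    refine ⟨?_, ?_, ?_, ?_, ?_⟩ <;> first | trivial | ring
  have hs : (osum n fun L => Gamma (-b + L) * Gamma (-a + b + 2 + L - n) / (Gamma (2 + b - n + L) *
    Gamma (-b + a + L))) = ozsum m (baseS m y B) := by
    rw [osum_eq_ozsum, ← hm]
    refine ozsum_congr fun L => ?_
    simp only [baseS]
    congr 3 <;> (try simp only [hy, hB, hmc]) <;> ring
  have g1 : Gamma a ≠ 0 :=
    hg.Gamma_ne_zero 1 0 0 1 (by push_cast; ring) (by simp)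
  have g2 : Gamma (n + 2*a - 2*b - 2) ≠ 0 :=
    hg.Gamma_ne_zero 2 (-2) (n - 2) 1 (by push_cast; ring) (by simp)
  have g3 : Gamma (n - b - 1) ≠ 0 :=
    hg.Gamma_ne_zero 0 (-1) (n - 1) 1 (by push_cast; ring) (by simp)
  have g4 : Gamma (2*a - 1) ≠ 0 :=
    hg.Gamma_ne_zero 2 0 (-1) 1 (by push_cast; ring) (by simp)
  have g5 : Gamma (b + 1 - a) ≠ 0 :=
    hg.Gamma_ne_zero (-1) 1 1 1 (by push_cast; ring) (by simp)
  have g6 : Gamma (-n + 2*b + 2) ≠ 0 :=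
    hg.Gamma_ne_zero 0 2 (-n + 2) 1 (by push_cast; ring) (by simp)
  have g7 : Gamma (n + a - b - 1) ≠ 0 :=
    hg.Gamma_ne_zero 1 (-1) (n - 1) 1 (by push_cast; ring) (by simp)
  have g8 : Gamma (-b) ≠ 0 :=
    hg.Gamma_ne_zero 0 (-1) 0 1 (by push_cast; ring) (by simp)
  have g9 : Gamma (2 + b - a - n) ≠ 0 :=
    hg.Gamma_ne_zero (-1) 1 (-n + 2) 1 (by push_cast; ring) (by simp)
  have hsin : sin (π * b) ≠ 0 := hg.sin_ne_zero 0 1 0 1 (by push_cast; ring) (by simp)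
  have h1 : Gamma (b + 1) * Gamma a / (Gamma (-n + 2*b + 2) * Gamma (n + a - b - 1)) * baseH m y B =
    -(1/2) * (π * Gamma (a - b) * Gamma (n - b - 2 + 2*a) * Gamma (b - n + 2)) / (sin (π * b) *
    Gamma (-b) * Gamma (n + 2*a - 2*b - 2) * Gamma a * Gamma (-n + 2*b + 2)) := by
    have rs := hg.sin_mul_Gamma 0 (-1) 0 1 (z := -b) (w := b + 1) (by push_cast; ring) (by simp)
      (by ring)
    rw [mul_neg, Complex.sin_neg] at rs
    rw [baseH_of (A₁ := n + a - b - 1) (A₂ := b - n + 2) (A₃ := n - b - 2 + 2*a) (A₄ := a - b)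
      (A₅ := a) (A₆ := n + 2*a - 2*b - 2) (by rw [hy]; ring) (by rw [hB]; ring)
      (by rw [hy, hB]; ring) (by rw [hy, hmc]; ring) (by rw [hy, hB]; ring)
      (by rw [hy, hmc]; ring), div_mul_div_comm, div_eq_div_iff
      (by repeat' first | assumption | apply pow_ne_zero | apply mul_ne_zero)
      (by repeat' first | assumption | apply pow_ne_zero | apply mul_ne_zero)]
    linear_combination (1/2 * Gamma a ^ 2 * Gamma (n + a - b - 1) * Gamma (b - n + 2) *
      Gamma (n - b - 2 + 2*a) * Gamma (a - b) * Gamma (n + 2*a - 2*b - 2) * Gamma (-n + 2*b + 2)) *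
      -rs
  have h2 : Gamma (b + 1) * Gamma a / (Gamma (-n + 2*b + 2) * Gamma (n + a - b - 1)) * baseK m y B =
    -(1/2) * (Gamma (b - n + 2) * Gamma (a - b) * Gamma a * Gamma (n - b - 2 + 2*a)) /
    (Gamma (2 + b - a - n) * Gamma (n + a - b - 1) * Gamma (-b) * Gamma (2*a - 1)) := by
    have r1 := Gamma_reflection_shift' (z := b + 1) (w := -b) (z' := b - n + 2) (w' := n - b - 1) (1
      - n) (by ring) (by push_cast; ring) (by ring)
    have r2 := Gamma_reflection_shift' (z := b + 1 - a) (w := a - b) (z' := 2 + b - a - n) (w' := n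
      + a - b - 1) (1 - n) (by ring) (by push_cast; ring) (by ring)
    rw [baseK_of (A₁ := n + a - b - 1) (A₂ := n - b - 2 + 2*a) (A₃ := -n + 2*b + 2)
      (A₄ := n - b - 1) (A₅ := 2*a - 1) (A₆ := b + 1 - a) (by rw [hy]; ring)
      (by rw [hy, hB]; ring) (by rw [hmc, hB]; ring) (by rw [hB]; ring)
      (by rw [hy, hB]; ring) (by rw [hmc, hy]; ring), div_mul_div_comm, div_eq_div_iff
      (by repeat' first | assumption | apply pow_ne_zero | apply mul_ne_zero)
      (by repeat' first | assumption | apply pow_ne_zero | apply mul_ne_zero)]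
    linear_combination (-(1/2) * Gamma a * Gamma (n + a - b - 1) * Gamma (n - b - 2 + 2*a) *
      Gamma (-n + 2*b + 2) * Gamma (2*a - 1)) * (Gamma (2 + b - a - n) * Gamma (n + a - b - 1) * r1
      - Gamma (b - n + 2) * Gamma (n - b - 1) * r2)
  have h := hF.base_unitShift hyb m
  rw [← e, show 2 + m - B = b + 1 by rw [hB, hmc]; ring, show y + 1 - B = a by rw [hy, hB]; ring,
    show 2 + m - 2 * B = -n + 2*b + 2 by rw [hB, hmc]; ring,
    show y + 1 = n + a - b - 1 by rw [hy]; ring] at h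
  rw [h, value7, hs]
  linear_combination h1 + ozsum m (baseS m y B) * h2

/-- In the coefficient of the sum the two sines differ only by the sign −(−1)^n, and the cosine
comes from reflecting the gamma function at B. -/
lemma IsHypergeometric.family8 {F : Params → ℂ} (hF : IsHypergeometric F) {a b : ℂ}
    (hg : Generic a b) (n : ℕ) : F (params8 n a b) = value8 n a b := by
  obtain ⟨m, hm⟩ : ∃ m : ℤ, m = n - 2 := ⟨_, rfl⟩
  have hmc : (m : ℂ) = n - 2 := by rw [hm]; push_cast; ring
  obtain ⟨y, hy⟩ : ∃ y : ℂ, y = (b + n) / 2 - 1 := ⟨_, rfl⟩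
  obtain ⟨B, hB⟩ : ∃ B : ℂ, B = (b + n - 1 - a) / 2 := ⟨_, rfl⟩
  have hyb : Generic y B := by
    intro p q r h
    have := hg (-q) (p + q)
      (2 * r - p * n + 2 * p - q * n + q)
      (by push_cast; rw [← h, hy, hB]; ring)
    omega
  have e : params8 n a b =
      (2 * y + 1 - 2 * B, 2 * y - m, y + 1 - B, 2 * y + 2 - 2 * B, 2 * y + 1 - B) := by
    simp only [params8, Prod.mk.injEq, hy, hB, hmc]
    refine ⟨?_, ?_, ?_, ?_, ?_⟩ <;> first | trivial | ring
  have hs : (osum n fun L => Gamma (-a/2 - n/2 + 1/2 + b/2 + L) * Gamma (-b/2 - n/2 + 1 + L) /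
    (Gamma (3/2 + a/2 - n/2 - b/2 + L) * Gamma (1 + b/2 - n/2 + L))) = ozsum m (baseS m y B) := by
    rw [osum_eq_ozsum, ← hm]
    refine ozsum_congr fun L => ?_
    simp only [baseS]
    congr 3 <;> (try simp only [hy, hB, hmc]) <;> ring
  have g1 : Gamma (a/2 + 1/2) ≠ 0 :=
    hg.Gamma_ne_zero 1 0 1 2 (by push_cast; ring) (by simp)
  have g2 : Gamma b ≠ 0 :=
    hg.Gamma_ne_zero 0 1 0 1 (by push_cast; ring) (by simp)
  have g3 : Gamma ((b + n - 1 - a) / 2) ≠ 0 :=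
    hg.Gamma_ne_zero (-1) 1 (n - 1) 2 (by push_cast; ring) (by simp)
  have g4 : Gamma a ≠ 0 :=
    hg.Gamma_ne_zero 1 0 0 1 (by push_cast; ring) (by simp)
  have g5 : Gamma ((n - b) / 2) ≠ 0 :=
    hg.Gamma_ne_zero 0 (-1) n 2 (by push_cast; ring) (by simp)
  have g6 : Gamma (1 + a - b) ≠ 0 :=
    hg.Gamma_ne_zero 1 (-1) 1 1 (by push_cast; ring) (by simp)
  have g7 : Gamma ((b + n) / 2) ≠ 0 :=
    hg.Gamma_ne_zero 0 1 n 2 (by push_cast; ring) (by simp)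
  have hpi : (π : ℂ) ≠ 0 := Complex.ofReal_ne_zero.2 Real.pi_ne_zero
  have rs := hg.sin_mul_Gamma 0 (-1) n 2 (z := (n - b) / 2) (w := (b - n) / 2 + 1)
    (by push_cast; ring) (by simp) (by ring)
  rw [show (π : ℂ) * ((n - b) / 2) = π/2 * (-b + n) by ring] at rs
  have hsin : sin (π/2 * (-b + n)) ≠ 0 := fun h => hpi (by rw [← rs, h, mul_zero])
  have h1 : Gamma (1 + a) * Gamma ((n - b) / 2) / (Gamma (1 + a - b) * Gamma ((b + n) / 2)) * baseH
    m y B = 2 ^ (a - 1) * (√π : ℝ) * Gamma (1 + a/2) * Gamma (n/2 + a/2 - 1/2 + b/2) *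
    Gamma (3/2 + a/2 - n/2 - b/2) / (Gamma (1 + a - b) * Gamma (a/2 + 1/2) * Gamma b * sin (π/2 *
    (-b + n))) := by
    have d := Gamma_duplication (s := a/2 + 1/2) (t := 1 + a/2) (u := 1 + a) (by ring) (by ring)
    have q : (2 : ℂ) ^ (a - 1) * 2 ^ (1 - 2 * (a/2 + 1/2)) = 2 ^ (-1 : ℤ) := two_cpow_mul_eq
      (by push_cast; ring)
    have rR : ((√π : ℝ) : ℂ) * (√π : ℝ) = π := ofReal_sqrt_pi_mul_self
    rw [baseH_of (A₁ := (b + n) / 2) (A₂ := 3/2 + a/2 - n/2 - b/2) (A₃ := n/2 + a/2 - 1/2 + b/2) (A₄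
      := (b - n) / 2 + 1) (A₅ := a/2 + 1/2) (A₆ := b) (by rw [hy]; ring) (by rw [hB]; ring)
      (by rw [hy, hB]; ring) (by rw [hy, hmc]; ring) (by rw [hy, hB]; ring)
      (by rw [hy, hmc]; ring), div_mul_div_comm, div_eq_div_iff
      (by repeat' first | assumption | apply pow_ne_zero | apply mul_ne_zero)
      (by repeat' first | assumption | apply pow_ne_zero | apply mul_ne_zero)]
    linear_combination (Gamma ((b + n) / 2) * Gamma (3/2 + a/2 - n/2 - b/2) *
      Gamma (n/2 + a/2 - 1/2 + b/2) * Gamma (1 + a - b) * Gamma (a/2 + 1/2) * Gamma b) * (1/2 *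
      Gamma (1 + a) * rs - 2 ^ (a - 1) * (√π : ℝ) * d - (√π : ℝ) * (√π : ℝ) * Gamma (1 + a) * q -
      1/2 * Gamma (1 + a) * rR)
  have h2 : Gamma (1 + a) * Gamma ((n - b) / 2) / (Gamma (1 + a - b) * Gamma ((b + n) / 2)) * baseK
    m y B = -(1/2) * cos (π/2 * (b - a - n)) * Gamma (3/2 + a/2 - n/2 - b/2) * a *
    Gamma (n/2 + a/2 - 1/2 + b/2) * sin (π/2 * (b + n)) / (π * sin (π/2 * (-b + n))) := by
    have ga : Gamma (1 + a) = a * Gamma a := by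
      rw [add_comm, Complex.Gamma_add_one _ (hg.ne_zero 1 0 0 1 (by push_cast; ring) (by simp))]
    have rB := hg.sin_mul_Gamma (-1) 1 (n - 1) 2 (z := (b + n - 1 - a) / 2) (w := 3/2 + a/2 - n/2 -
      b/2) (by push_cast; ring) (by simp) (by ring)
    rw [show (π : ℂ) * ((b + n - 1 - a) / 2) = π/2 * (b + n - a) - π / 2 by ring,
      Complex.sin_sub_pi_div_two] at rB
    have hcos : cos (π/2 * (b - a - n)) = (-1) ^ n * cos (π/2 * (b + n - a)) := by
      rw [← Complex.cos_antiperiodic.sub_nat_mul_eq]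
      congr 1
      ring
    have hs' : sin (π/2 * (-b + n)) = -((-1) ^ n * sin (π/2 * (b + n))) := by
      rw [← mul_neg, ← Complex.sin_neg, ← Complex.sin_antiperiodic.add_nat_mul_eq]
      congr 1
      ring
    rw [baseK_of (A₁ := (b + n) / 2) (A₂ := n/2 + a/2 - 1/2 + b/2) (A₃ := 1 + a - b) (A₄ := (b + n -
      1 - a) / 2) (A₅ := a) (A₆ := (n - b) / 2) (by rw [hy]; ring) (by rw [hy, hB]; ring)
      (by rw [hmc, hB]; ring) (by rw [hB]) (by rw [hy, hB]; ring)
      (by rw [hmc, hy]; ring), div_mul_div_comm, div_eq_div_iff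
      (by repeat' first | assumption | apply pow_ne_zero | apply mul_ne_zero)
      (by repeat' first | assumption | apply pow_ne_zero | apply mul_ne_zero)]
    linear_combination (-(1/2) * Gamma ((n - b) / 2) * Gamma ((b + n) / 2) *
      Gamma (n/2 + a/2 - 1/2 + b/2) * Gamma (1 + a - b)) * (π * sin (π/2 * (-b + n)) * ga + a *
      Gamma a * π * hs' - Gamma (3/2 + a/2 - n/2 - b/2) * a * sin (π/2 * (b + n)) * Gamma ((b + n -
      1 - a) / 2) * Gamma a * hcos + (-1) ^ n * a * sin (π/2 * (b + n)) * Gamma a * rB)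
  have h := hF.base_halfShift hyb m
  rw [← e, show 2 * y + 2 - 2 * B = 1 + a by rw [hy, hB]; ring,
    show 1 + m - y = (n - b) / 2 by rw [hy, hmc]; ring,
    show 2 + m - 2 * B = 1 + a - b by rw [hB, hmc]; ring, show y + 1 = (b + n) / 2 by rw [hy]; ring]
    at h
  rw [h, value8, hs]
  linear_combination h1 + ozsum m (baseS m y B) * h2

/-- The linear denominator arises from Γ(w) = (w − 1)Γ(w − 1) at w = n/2 + b − a/2. The reflected
pairs are shifted by 2 − n and 1 − n, so the signs leave −1 and the sum enters with a plus. -/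
lemma IsHypergeometric.family9 {F : Params → ℂ} (hF : IsHypergeometric F) {a b : ℂ}
    (hg : Generic a b) (n : ℕ) : F (params9 n a b) = value9 n a b := by
  obtain ⟨m, hm⟩ : ∃ m : ℤ, m = n - 2 := ⟨_, rfl⟩
  have hmc : (m : ℂ) = n - 2 := by rw [hm]; push_cast; ring
  obtain ⟨y, hy⟩ : ∃ y : ℂ, y = (a + n) / 2 - 1 := ⟨_, rfl⟩
  obtain ⟨B, hB⟩ : ∃ B : ℂ, B = (a + n) / 2 - b := ⟨_, rfl⟩
  have hyb : Generic y B := by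
    intro p q r h
    have := hg (p + q) (-2 * q)
      (2 * r - p * n + 2 * p - q * n)
      (by push_cast; rw [← h, hy, hB]; ring)
    omega
  have e : params9 n a b =
      (2 * y - m, y + 1 - B, 1, 2 * y + 2 - 2 * B, y + 1) := by
    simp only [params9, Prod.mk.injEq, hy, hB, hmc]
    refine ⟨?_, ?_, ?_, ?_, ?_⟩ <;> first | trivial | ring
  have hs : (osum n fun L => Gamma (1 - b - n/2 + a/2 + L) * Gamma (-a/2 - n/2 + 1 + L) /
    (Gamma (1 + b - n/2 - a/2 + L) * Gamma (1 + a/2 - n/2 + L))) = ozsum m (baseS m y B) := by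
    rw [osum_eq_ozsum, ← hm]
    refine ozsum_congr fun L => ?_
    simp only [baseS]
    congr 3 <;> (try simp only [hy, hB, hmc]) <;> ring
  have g1 : Gamma b ≠ 0 :=
    hg.Gamma_ne_zero 0 1 0 1 (by push_cast; ring) (by simp)
  have g2 : Gamma a ≠ 0 :=
    hg.Gamma_ne_zero 1 0 0 1 (by push_cast; ring) (by simp)
  have g3 : Gamma ((a + n) / 2 - b) ≠ 0 :=
    hg.Gamma_ne_zero 1 (-2) n 2 (by push_cast; ring) (by simp)
  have g4 : Gamma (2 * b - 1) ≠ 0 :=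
    hg.Gamma_ne_zero 0 2 (-1) 1 (by push_cast; ring) (by simp)
  have g5 : Gamma ((n - a) / 2) ≠ 0 :=
    hg.Gamma_ne_zero (-1) 0 n 2 (by push_cast; ring) (by simp)
  have g6 : Gamma (2*b - a) ≠ 0 :=
    hg.Gamma_ne_zero (-1) 2 0 1 (by push_cast; ring) (by simp)
  have g7 : Gamma ((a + n) / 2 - 1 + b) ≠ 0 :=
    hg.Gamma_ne_zero 1 2 (n - 2) 2 (by push_cast; ring) (by simp)
  have g8 : Gamma (b + n/2 + 1/2 - a/2) ≠ 0 :=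
    hg.Gamma_ne_zero (-1) 2 (n + 1) 2 (by push_cast; ring) (by simp)
  have g9 : Gamma (a/2 + n/2 + 1/2) ≠ 0 :=
    hg.Gamma_ne_zero 1 0 (n + 1) 2 (by push_cast; ring) (by simp)
  have g10 : Gamma (-b - n/2 + a/2 + 2) ≠ 0 :=
    hg.Gamma_ne_zero 1 (-2) (-n + 4) 2 (by push_cast; ring) (by simp)
  have g11 : Gamma (-n/2 - a/2 + 1) ≠ 0 :=
    hg.Gamma_ne_zero (-1) 0 (-n + 2) 2 (by push_cast; ring) (by simp)
  have hl : n/2 + b - a/2 - 1 ≠ 0 := hg.ne_zero (-1) 2 (n - 2) 2 (by push_cast; ring) (by simp)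
  have h20 : (2 : ℂ) ≠ 0 := two_ne_zero
  have h1 : Gamma (2 * b) * Gamma (n/2 + b - a/2 - 1) / (Gamma (2*b - a) * Gamma ((a + n) / 2 - 1 +
    b)) * baseH m y B = (√π : ℝ) * Gamma (n - a + 2*b) * Gamma (a + n) * Gamma (b + 1/2) *
    Gamma (1 + b - n/2 - a/2) * Gamma (a/2 - n/2 + 1) / (Gamma a * Gamma b * 2 ^ (2*n) *
    Gamma (b + n/2 + 1/2 - a/2) * Gamma (a/2 + n/2 + 1/2) * (n/2 + b - a/2 - 1) * Gamma (2*b - a))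
    := by
    have d₁ := Gamma_duplication (s := b) (t := b + 1/2) (u := 2 * b) rfl rfl
    have d₂ := Gamma_duplication (s := (a + n) / 2) (t := a/2 + n/2 + 1/2) (u := a + n) (by ring)
      (by ring)
    have d₃ := Gamma_duplication (s := n/2 + b - a/2) (t := b + n/2 + 1/2 - a/2) (u := n - a + 2*b)
      (by ring) (by ring)
    have gw : Gamma (n/2 + b - a/2) = (n/2 + b - a/2 - 1) * Gamma (n/2 + b - a/2 - 1) := by
      rw [← Complex.Gamma_add_one _ hl, sub_add_cancel]
    have q : (2 : ℂ) ^ (1 - 2 * ((a + n) / 2)) * 2 ^ (1 - 2 * (n/2 + b - a/2)) = 2 ^ (1 - 2 * (n :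
      ℤ)) * 2 ^ (1 - 2 * b) := two_cpow_mul _ (by push_cast; ring)
    have z : (2 : ℂ) ^ (2*n) * 2 ^ (1 - 2 * (n : ℤ)) = 2 := by
      rw [← zpow_natCast, ← zpow_add₀ two_ne_zero]
      push_cast
      rw [add_sub_cancel, zpow_one]
    rw [baseH_of (A₁ := (a + n) / 2) (A₂ := 1 + b - n/2 - a/2) (A₃ := (a + n) / 2 - 1 + b)
      (A₄ := a/2 - n/2 + 1) (A₅ := b) (A₆ := a) (by rw [hy]; ring) (by rw [hB]; ring)
      (by rw [hy, hB]; ring) (by rw [hy, hmc]; ring) (by rw [hy, hB]; ring)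
      (by rw [hy, hmc]; ring), div_mul_div_comm, div_eq_div_iff
      (by repeat' first | assumption | apply pow_ne_zero | apply mul_ne_zero)
      (by repeat' first | assumption | apply pow_ne_zero | apply mul_ne_zero)]
    linear_combination (Gamma (1 + b - n/2 - a/2) * Gamma ((a + n) / 2 - 1 + b) *
      Gamma (a/2 - n/2 + 1) * Gamma a * Gamma b * Gamma (2*b - a)) * (-(1/2 * Gamma (2 * b) * Gamma
      ((a + n) / 2) * 2 ^ (2*n) * Gamma (a/2 + n/2 + 1/2) * Gamma (b + n/2 + 1/2 - a/2)) * gw + 1/2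
      * Gamma (2 * b) * 2 ^ (2*n) * Gamma (b + n/2 + 1/2 - a/2) * Gamma (n/2 + b - a/2) * d₂ + 1/2 *
      Gamma (2 * b) * 2 ^ (2*n) * Gamma (a + n) * 2 ^ (1 - 2 * ((a + n) / 2)) * (√π : ℝ) * d₃ + 1/2
      * Gamma (2 * b) * 2 ^ (2*n) * Gamma (a + n) * Gamma (n - a + 2*b) * (√π : ℝ) * (√π : ℝ) * q +
      1/2 * Gamma (2 * b) * Gamma (a + n) * Gamma (n - a + 2*b) * (√π : ℝ) * (√π : ℝ) * 2 ^ (1 - 2 *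
      b) * z - (√π : ℝ) * Gamma (n - a + 2*b) * Gamma (a + n) * d₁)
  have h2 : Gamma (2 * b) * Gamma (n/2 + b - a/2 - 1) / (Gamma (2*b - a) * Gamma ((a + n) / 2 - 1 +
    b)) * baseK m y B = Gamma (1 + b - n/2 - a/2) * Gamma (a/2 - n/2 + 1) * (b - 1/2) /
    (Gamma (-b - n/2 + a/2 + 2) * Gamma (-n/2 - a/2 + 1)) := by
    have gt : Gamma (2 * b) = (2 * b - 1) * Gamma (2 * b - 1) := by
      rw [← Complex.Gamma_add_one _ (hg.ne_zero 0 2 (-1) 1 (by push_cast; ring) (by simp)),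
        sub_add_cancel]
    have r1 := Gamma_reflection_shift' (z := n/2 + b - a/2 - 1) (w := -b - n/2 + a/2 + 2) (z' := 1 +
      b - n/2 - a/2) (w' := (a + n) / 2 - b) (1 - n + 1) (by ring) (by push_cast; ring) (by ring)
    rw [zpow_add_one₀ (by norm_num)] at r1
    have r2 := Gamma_reflection_shift' (z := (a + n) / 2) (w := -n/2 - a/2 + 1) (z' := a/2 - n/2 +
      1) (w' := (n - a) / 2) (1 - n) (by ring) (by push_cast; ring) (by ring)
    have e₂ : (-1 : ℂ) ^ (1 - n : ℤ) * (-1) ^ (1 - n : ℤ) = 1 := by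
      rw [← mul_zpow]
      norm_num
    rw [baseK_of (A₁ := (a + n) / 2) (A₂ := (a + n) / 2 - 1 + b) (A₃ := 2*b - a) (A₄ := (a + n) / 2
      - b) (A₅ := 2 * b - 1) (A₆ := (n - a) / 2) (by rw [hy]; ring) (by rw [hy, hB]; ring)
      (by rw [hmc, hB]; ring) (by rw [hB]) (by rw [hy, hB]; ring)
      (by rw [hmc, hy]; ring), div_mul_div_comm, div_eq_div_iff
      (by repeat' first | assumption | apply pow_ne_zero | apply mul_ne_zero)
      (by repeat' first | assumption | apply pow_ne_zero | apply mul_ne_zero)]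
    linear_combination (Gamma ((a + n) / 2 - 1 + b) * Gamma (2*b - a)) * (-(1/2) *
      Gamma (n/2 + b - a/2 - 1) * Gamma ((a + n) / 2) * Gamma (-b - n/2 + a/2 + 2) *
      Gamma (-n/2 - a/2 + 1) * gt - 1/2 * (2 * b - 1) * Gamma (2 * b - 1) * Gamma ((a + n) / 2) *
      Gamma (-n/2 - a/2 + 1) * r1 + 1/2 * (2 * b - 1) * Gamma (2 * b - 1) * (-1) ^ (1 - n : ℤ) *
      Gamma (1 + b - n/2 - a/2) * Gamma ((a + n) / 2 - b) * r2 + 1/2 * (2 * b - 1) *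
      Gamma (2 * b - 1) * Gamma (1 + b - n/2 - a/2) * Gamma ((a + n) / 2 - b) *
      Gamma (a/2 - n/2 + 1) * Gamma ((n - a) / 2) * e₂)
  have h := hF.base_unitUpper hyb m
  rw [← e, show 2 * y + 2 - 2 * B = 2 * b by rw [hy, hB]; ring,
    show 1 + m - B = n/2 + b - a/2 - 1 by rw [hB, hmc]; ring,
    show 2 + m - 2 * B = 2*b - a by rw [hB, hmc]; ring,
    show 2 * y + 1 - B = (a + n) / 2 - 1 + b by rw [hy, hB]; ring] at h
  rw [h, value9, hs]
  linear_combination h1 + ozsum m (baseS m y B) * h2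

/-- The basic family itself with m = n − 2: two duplications for the first coefficient, two
reflected pairs with equal shift for the second. -/
lemma IsHypergeometric.family10 {F : Params → ℂ} (hF : IsHypergeometric F) {a b : ℂ}
    (hg : Generic a b) (n : ℕ) : F (params10 n a b) = value10 n a b := by
  obtain ⟨m, hm⟩ : ∃ m : ℤ, m = n - 2 := ⟨_, rfl⟩
  have hmc : (m : ℂ) = n - 2 := by rw [hm]; push_cast; ring
  obtain ⟨y, hy⟩ : ∃ y : ℂ, y = (a + n) / 2 - 1 := ⟨_, rfl⟩
  have hyb : Generic y b := by
    intro p q r h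
    have := hg p (2 * q) (2 * r + 2 * p - p * n)
      (by push_cast; rw [← h, hy]; ring)
    omega
  have e : params10 n a b = (2 * y - m, y, b, 2 * y + 1 - b, y + 1) := by
    simp only [params10, Prod.mk.injEq, hy, hmc]
    exact ⟨by ring, by ring, trivial, by ring, by ring⟩
  have hs : (osum n fun L => Gamma (b + 1 + L - n) * Gamma (-a/2 - n/2 + 1 + L) /
      (Gamma (1 - b + L) * Gamma (1 + a/2 - n/2 + L))) = ozsum m (baseS m y b) := by
    rw [osum_eq_ozsum, ← hm]
    refine ozsum_congr fun L => ?_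
    simp only [baseS]
    congr 3 <;> (try simp only [hy, hmc]) <;> ring
  have g1 : Gamma (n/2 + a/2 - b) ≠ 0 :=
    hg.Gamma_ne_zero 1 (-2) n 2 (by push_cast; ring) (by simp)
  have g2 : Gamma a ≠ 0 := hg.Gamma_ne_zero 1 0 0 1 (by push_cast; ring) (by simp)
  have g3 : Gamma (a/2 + n/2 + 1/2) ≠ 0 :=
    hg.Gamma_ne_zero 1 0 (n + 1) 2 (by push_cast; ring) (by simp)
  have g4 : Gamma (n + a - 2 * b - 1) ≠ 0 :=
    hg.Gamma_ne_zero 1 (-2) (n - 1) 1 (by push_cast; ring) (by simp)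
  have g5 : Gamma b ≠ 0 := hg.Gamma_ne_zero 0 1 0 1 (by push_cast; ring) (by simp)
  have g6 : Gamma ((n - a) / 2) ≠ 0 :=
    hg.Gamma_ne_zero (-1) 0 n 2 (by push_cast; ring) (by simp)
  have g7 : Gamma (-n + b + 1) ≠ 0 :=
    hg.Gamma_ne_zero 0 1 (-n + 1) 1 (by push_cast; ring) (by simp)
  have g8 : Gamma (-n / 2 - a / 2 + 1) ≠ 0 :=
    hg.Gamma_ne_zero (-1) 0 (-n + 2) 2 (by push_cast; ring) (by simp)
  have g9 : Gamma (-b + n) ≠ 0 :=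
    hg.Gamma_ne_zero 0 (-1) n 1 (by push_cast; ring) (by simp)
  have h1 : baseH m y b =
      2 ^ (-2 - 2 * b) * Gamma (a + n) * Gamma (n/2 + a/2 - b - 1/2) * Gamma (-b + 1) *
        Gamma (a/2 - n/2 + 1) * Gamma (n + a - b - 1) /
      (Gamma a * Gamma (n/2 + a/2 - b) * Gamma (a/2 + n/2 + 1/2) * Gamma (n + a - 2*b - 1)) := by
    have d1 := Gamma_duplication (s := (a + n) / 2) (t := a/2 + n/2 + 1/2) (u := a + n)
      (by ring) (by ring)
    have d2 := Gamma_duplication (s := n/2 + a/2 - b - 1/2) (t := n/2 + a/2 - b)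
      (u := n + a - 2 * b - 1) (by ring) (by ring)
    have d3 : (2 : ℂ) ^ (-2 - 2 * b) * 2 ^ (1 - 2 * (n/2 + a/2 - b - 1/2)) =
      2 ^ (-1 : ℤ) * 2 ^ (1 - 2 * ((a + n) / 2)) := two_cpow_mul _ (by push_cast; ring)
    rw [baseH_of (A₁ := (a + n) / 2) (A₂ := -b + 1) (A₃ := n + a - b - 1) (A₄ := a/2 - n/2 + 1)
      (A₅ := n/2 + a/2 - b) (A₆ := a) (by rw [hy]; ring) (by ring) (by rw [hy]; ring)
      (by rw [hy, hmc]; ring) (by rw [hy]; ring) (by rw [hy, hmc]; ring)]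
    rw [div_eq_div_iff (by repeat' first | assumption | apply pow_ne_zero | apply mul_ne_zero)
      (by repeat' first | assumption | apply pow_ne_zero | apply mul_ne_zero)]
    linear_combination (Gamma (-b + 1) * Gamma (n + a - b - 1) * Gamma (a/2 - n/2 + 1) * Gamma a *
      Gamma (n/2 + a/2 - b)) * (1/2 * Gamma (n + a - 2 * b - 1) * d1 -
        2 ^ (-2 - 2 * b) * Gamma (a + n) * d2 -
        Gamma (a + n) * Gamma (n + a - 2 * b - 1) * (√π : ℝ) * d3)
  have h2 : baseK m y b =
      -(1/2) * Gamma (-b + 1) * Gamma (a/2 - n/2 + 1) * Gamma (n - 2*b) * Gamma (n + a - b - 1) /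
    (Gamma (-n + b + 1) * Gamma (-n/2 - a/2 + 1) * Gamma (n + a - 2*b - 1) * Gamma (-b + n)) := by
    have r1 := Gamma_reflection_shift' (z := b) (w := -b + 1) (z' := -n + b + 1) (w' := -b + n)
      (1 - n) (by ring) (by push_cast; ring) (by ring)
    have r2 := Gamma_reflection_shift' (z := (a + n) / 2) (w := -n/2 - a/2 + 1)
      (z' := a/2 - n/2 + 1) (w' := (n - a) / 2)
      (1 - n) (by ring) (by push_cast; ring) (by ring)
    rw [baseK_of (A₁ := (a + n) / 2) (A₂ := n + a - b - 1) (A₃ := n - 2 * b) (A₄ := b)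
      (A₅ := n + a - 2 * b - 1) (A₆ := (n - a) / 2) (by rw [hy]; ring) (by rw [hy]; ring)
      (by rw [hmc]; ring) rfl (by rw [hy]; ring) (by rw [hmc, hy]; ring)]
    rw [div_eq_div_iff (by repeat' first | assumption | apply pow_ne_zero | apply mul_ne_zero)
      (by repeat' first | assumption | apply pow_ne_zero | apply mul_ne_zero)]
    linear_combination (-(1/2) * Gamma (n + a - b - 1) * Gamma (n - 2*b) *
      Gamma (n + a - 2*b - 1)) * (Gamma (-n + b + 1) * Gamma (-b + n) * r2 -
        Gamma (a/2 - n/2 + 1) * Gamma ((n - a) / 2) * r1)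
  rw [e, hF.base_closed hyb, value10, hs, h1, h2]
  ring

end Hyp32

namespace Hyp32

open Complex (Gamma sin cos)
open scoped Real
open Filter Topology

/-! ### Density of the pairs in general position -/

/-- Along the complex line (a + t, b + it) a relation with integers (p, q) ≠ (0, 0) excludes at most
one t, since p + qi ≠ 0. Countably many relations leave a dense set of t. -/
lemma closure_setOf_generic (a b : ℂ) : (a, b) ∈ closure {p : ℂ × ℂ | Generic p.1 p.2} := by
  set S : Set ℂ := {t | ¬ Generic (a + t) (b + t * Complex.I)} with hS
  have hS' : S ⊆ ⋃ k : {k : ℤ × ℤ × ℤ // ¬ (k.1 = 0 ∧ k.2.1 = 0)},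
      {t | (k.1.1 : ℂ) * (a + t) + k.1.2.1 * (b + t * Complex.I) = k.1.2.2} := by
    intro t ht
    simp only [hS, Generic, Set.mem_ofPred_eq, not_forall] at ht
    obtain ⟨p, q, r, h, hpq⟩ := ht
    exact Set.mem_iUnion.2 ⟨⟨(p, q, r), hpq⟩, h⟩
  have hc : S.Countable := by
    refine (Set.countable_iUnion fun k => Set.Subsingleton.countable ?_).mono hS'
    obtain ⟨⟨p, q, r⟩, hpq⟩ := k
    intro t ht u hu
    simp only [Set.mem_ofPred_eq] at ht hu
    have hne : (p : ℂ) + q * Complex.I ≠ 0 := by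
      intro h
      have h1 := congrArg Complex.re h
      have h2 := congrArg Complex.im h
      simp at h1 h2
      exact hpq ⟨h1, h2⟩
    exact mul_left_cancel₀ hne (by linear_combination ht - hu)
  have hd : (0 : ℂ) ∈ closure Sᶜ := (hc.dense_compl ℂ) 0
  have hcont : Continuous fun t : ℂ => (a + t, b + t * Complex.I) := by fun_prop
  have h := map_mem_closure hcont hd (t := {p : ℂ × ℂ | Generic p.1 p.2}) fun t ht => by
    simpa [hS] using ht
  simpa using h

lemma eq_of_eqOn_generic {f g : ℂ × ℂ → ℂ} {a b : ℂ} (hf : ContinuousAt f (a, b))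
    (hg : ContinuousAt g (a, b)) (h : ∀ x y, Generic x y → f (x, y) = g (x, y)) :
    f (a, b) = g (a, b) := by
  have : (𝓝[{p : ℂ × ℂ | Generic p.1 p.2}] (a, b)).NeBot :=
    mem_closure_iff_nhdsWithin_neBot.1 (closure_setOf_generic a b)
  refine tendsto_nhds_unique (l := 𝓝[{p : ℂ × ℂ | Generic p.1 p.2}] (a, b))
    (hf.mono_left nhdsWithin_le_nhds) ?_
  refine (hg.mono_left nhdsWithin_le_nhds).congr' ?_
  filter_upwards [self_mem_nhdsWithin] with p hp
  exact (h p.1 p.2 hp).symm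

/-! ### Continuity of the closed forms -/

section Continuity

variable {X : Type*} [TopologicalSpace X] {x : X} {f g : X → ℂ}

lemma continuousAt_Gamma_comp (hf : ContinuousAt f x) (h : NonPole (f x)) :
    ContinuousAt (fun y => Gamma (f y)) x :=
  ContinuousAt.comp (f := f) (Complex.differentiableAt_Gamma _ h).continuousAt hf

/-- Denominators are treated through their inverses: 1/Γ is entire, so a gamma function below the
fraction bar needs no condition on its argument. -/
lemma continuousAt_inv_Gamma_comp (hf : ContinuousAt f x) :
    ContinuousAt (fun y => (Gamma (f y))⁻¹) x :=
  ContinuousAt.comp (f := f) Complex.differentiable_one_div_Gamma.continuous.continuousAt hf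

lemma continuousAt_inv_mul (hf : ContinuousAt (fun y => (f y)⁻¹) x)
    (hg : ContinuousAt (fun y => (g y)⁻¹) x) : ContinuousAt (fun y => (f y * g y)⁻¹) x := by
  simp only [mul_inv]; exact hf.mul hg

lemma continuousAt_inv_pow (hf : ContinuousAt (fun y => (f y)⁻¹) x) (k : ℕ) :
    ContinuousAt (fun y => (f y ^ k)⁻¹) x := by
  simp only [← inv_pow]; exact hf.pow k

lemma continuousAt_div_of_inv (hf : ContinuousAt f x) (hg : ContinuousAt (fun y => (g y)⁻¹) x) :
    ContinuousAt (fun y => f y / g y) x := by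
  simp only [div_eq_mul_inv]; exact hf.mul hg

lemma continuousAt_two_cpow (hf : ContinuousAt f x) : ContinuousAt (fun y => (2 : ℂ) ^ f y) x :=
  hf.const_cpow (Or.inl two_ne_zero)

lemma continuousAt_inv_two_cpow (hf : ContinuousAt f x) :
    ContinuousAt (fun y => ((2 : ℂ) ^ f y)⁻¹) x :=
  (continuousAt_two_cpow hf).inv₀ (two_cpow_ne_zero _)

lemma continuousAt_sum {ι : Type*} {s : Finset ι} {u : X → ι → ℂ}
    (h : ∀ i ∈ s, ContinuousAt (fun y => u y i) x) : ContinuousAt (fun y => ∑ i ∈ s, u y i) x :=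
  tendsto_finsetSum s h

lemma continuousAt_osum {n : ℕ} {u : X → ℤ → ℂ}
    (h : ∀ i ∈ idx n, ContinuousAt (fun y => u y i) x) :
    ContinuousAt (fun y => osum n (u y)) x :=
  (continuousAt_sum fun i hi => h i (Finset.mem_union_left _ hi)).sub
    (continuousAt_sum fun i hi => h i (Finset.mem_union_right _ hi))

end Continuity

lemma IsHypergeometric.continuousAt_comp {F : Params → ℂ} (hF : IsHypergeometric F)
    {p : ℂ × ℂ → Params} {z : ℂ × ℂ} (hp : Continuous p) (hz : p z ∈ domain) :
    ContinuousAt (fun w => F (p w)) z :=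
  ContinuousAt.comp (f := p)
    (hF.holomorphic.differentiableAt (isOpen_domain.mem_nhds hz)).continuousAt hp.continuousAt

lemma IsHypergeometric.eq_value {F : Params → ℂ} (hF : IsHypergeometric F)
    {p : ℂ → ℂ → Params} {v : ℂ → ℂ → ℂ} {a b : ℂ}
    (h : ∀ x y, Generic x y → F (p x y) = v x y)
    (hp : Continuous fun z : ℂ × ℂ => p z.1 z.2) (hd : p a b ∈ domain)
    (hv : ContinuousAt (fun z : ℂ × ℂ => v z.1 z.2) (a, b)) : F (p a b) = v a b :=
  eq_of_eqOn_generic (f := fun z => F (p z.1 z.2)) (g := fun z => v z.1 z.2)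
    (hF.continuousAt_comp hp hd) hv h

/-- The closed forms are continuous at regular parameters. -/
lemma continuousAt_value (n : ℕ) (a b : ℂ) :
    (Regular1 n a b → ContinuousAt (fun p : ℂ × ℂ => value1 n p.1 p.2) (a, b)) ∧
    (Regular2 n a b → ContinuousAt (fun p : ℂ × ℂ => value2 n p.1 p.2) (a, b)) ∧
    (Regular3 n a b → ContinuousAt (fun p : ℂ × ℂ => value3 n p.1 p.2) (a, b)) ∧
    (Regular4 n a b → ContinuousAt (fun p : ℂ × ℂ => value4 n p.1 p.2) (a, b)) ∧
    (Regular5 n a b → ContinuousAt (fun p : ℂ × ℂ => value5 n p.1 p.2) (a, b)) ∧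
    (Regular6 n a b → ContinuousAt (fun p : ℂ × ℂ => value6 n p.1 p.2) (a, b)) ∧
    (Regular7 n a b → ContinuousAt (fun p : ℂ × ℂ => value7 n p.1 p.2) (a, b)) ∧
    (Regular8 n a b → ContinuousAt (fun p : ℂ × ℂ => value8 n p.1 p.2) (a, b)) ∧
    (Regular9 n a b → ContinuousAt (fun p : ℂ × ℂ => value9 n p.1 p.2) (a, b)) ∧
    (Regular10 n a b → ContinuousAt (fun p : ℂ × ℂ => value10 n p.1 p.2) (a, b)) := by
  refine ⟨fun ⟨r₁, r₂, r₃, r₄, hL⟩ => ?_,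
    fun ⟨r₁, r₂, r₃, r₄, hL⟩ => ?_,
    fun ⟨r₁, r₂, r₃, r₄, hL⟩ => ?_,
    fun ⟨r₁, r₂, r₃, r₄, r₅, hL⟩ => ?_,
    fun ⟨r₁, r₂, r₃, r₄, r₅, r₆, hL⟩ => ?_,
    fun ⟨r₁, r₂, r₃, r₄, r₅, r₆, r₇, r₈, hL⟩ => ?_,
    fun ⟨r₁, r₂, r₃, r₄, r₅, hL⟩ => ?_,
    fun ⟨r₁, r₂, r₃, r₄, hL⟩ => ?_,
    fun ⟨r₁, r₂, r₃, r₄, r₅, r₆, hL⟩ => ?_,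
    fun ⟨r₁, r₂, r₃, r₄, r₅, r₆, hL⟩ => ?_⟩
  all_goals
    simp only [value1, value2, value3, value4, value5, value6, value7, value8, value9, value10]
    -- The search follows the shape of the expression. What remains are nonpole and nonvanishing
    -- conditions, exactly those in the regularity hypotheses; those under a finite sum are supplied
    -- by `hL`.
    repeat' with_reducible first
      | assumption
      | exact continuousAt_const
      | apply continuousAt_sum
      | apply continuousAt_osum
      | apply continuousAt_Gamma_comp
      | apply continuousAt_inv_Gamma_comp
      | apply continuousAt_two_cpow
      | apply continuousAt_inv_two_cpow
      | apply continuousAt_inv_mul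
      | apply continuousAt_inv_pow
      | apply continuousAt_div_of_inv
      | apply ContinuousAt.fun_mul
      | apply ContinuousAt.fun_add
      | apply ContinuousAt.fun_sub
      | apply ContinuousAt.fun_neg
      | apply ContinuousAt.fun_inv₀
      | (intro L hL'; obtain ⟨l₁, l₂⟩ := hL L hL')
      | fun_prop

end Hyp32

/-! ### The ten identities at regular parameters -/

theorem mainTheorem7 :
    ∃ F : Hyp32.Params → ℂ, Hyp32.IsHypergeometric F ∧
      ∀ n : ℕ, 1 ≤ n → ∀ a b : ℂ,
        (Hyp32.params1 n a b ∈ Hyp32.domain → Hyp32.Regular1 n a b →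
          F (Hyp32.params1 n a b) = Hyp32.value1 n a b) ∧
        (Hyp32.params2 n a b ∈ Hyp32.domain → Hyp32.Regular2 n a b →
          F (Hyp32.params2 n a b) = Hyp32.value2 n a b) ∧
        (Hyp32.params3 n a b ∈ Hyp32.domain → Hyp32.Regular3 n a b →
          F (Hyp32.params3 n a b) = Hyp32.value3 n a b) ∧
        (Hyp32.params4 n a b ∈ Hyp32.domain → Hyp32.Regular4 n a b →
          F (Hyp32.params4 n a b) = Hyp32.value4 n a b) ∧
        (Hyp32.params5 n a b ∈ Hyp32.domain → Hyp32.Regular5 n a b →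
          F (Hyp32.params5 n a b) = Hyp32.value5 n a b) ∧
        (Hyp32.params6 n a b ∈ Hyp32.domain → Hyp32.Regular6 n a b →
          F (Hyp32.params6 n a b) = Hyp32.value6 n a b) ∧
        (Hyp32.params7 n a b ∈ Hyp32.domain → Hyp32.Regular7 n a b →
          F (Hyp32.params7 n a b) = Hyp32.value7 n a b) ∧
        (Hyp32.params8 n a b ∈ Hyp32.domain → Hyp32.Regular8 n a b →
          F (Hyp32.params8 n a b) = Hyp32.value8 n a b) ∧
        (Hyp32.params9 n a b ∈ Hyp32.domain → Hyp32.Regular9 n a b →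
          F (Hyp32.params9 n a b) = Hyp32.value9 n a b) ∧
        (Hyp32.params10 n a b ∈ Hyp32.domain → Hyp32.Regular10 n a b →
          F (Hyp32.params10 n a b) = Hyp32.value10 n a b) := by
  have hF := Hyp32.isHypergeometric_hyp
  refine ⟨Hyp32.hyp, hF, fun n _ a b => ?_⟩
  obtain ⟨h₁, h₂, h₃, h₄, h₅, h₆, h₇, h₈, h₉, h₁₀⟩ := Hyp32.continuousAt_value n a b
  refine ⟨fun hd hr => hF.eq_value (fun _ _ h => hF.family1 h n)
      (by unfold Hyp32.params1; fun_prop) hd (h₁ hr),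
    fun hd hr => hF.eq_value (fun _ _ h => hF.family2 h n)
      (by unfold Hyp32.params2; fun_prop) hd (h₂ hr),
    fun hd hr => hF.eq_value (fun _ _ h => hF.family3 h n)
      (by unfold Hyp32.params3; fun_prop) hd (h₃ hr),
    fun hd hr => hF.eq_value (fun _ _ h => hF.family4 h n)
      (by unfold Hyp32.params4; fun_prop) hd (h₄ hr),
    fun hd hr => hF.eq_value (fun _ _ h => hF.family5 h n)
      (by unfold Hyp32.params5; fun_prop) hd (h₅ hr),
    fun hd hr => hF.eq_value (fun _ _ h => hF.family6 h n)
      (by unfold Hyp32.params6; fun_prop) hd (h₆ hr),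
    fun hd hr => hF.eq_value (fun _ _ h => hF.family7 h n)
      (by unfold Hyp32.params7; fun_prop) hd (h₇ hr),
    fun hd hr => hF.eq_value (fun _ _ h => hF.family8 h n)
      (by unfold Hyp32.params8; fun_prop) hd (h₈ hr),
    fun hd hr => hF.eq_value (fun _ _ h => hF.family9 h n)
      (by unfold Hyp32.params9; fun_prop) hd (h₉ hr),
    fun hd hr => hF.eq_value (fun _ _ h => hF.family10 h n)
      (by unfold Hyp32.params10; fun_prop) hd (h₁₀ hr)⟩
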